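/- Let $K$ be a field of characteristic $0$. A letter is a tuple $(a,b,c,z)$ with integers $a,c\ge 1$, $0\le b<a$, $\gcd(a,b)=1$ and $z\in K\setminus\{0\}$; its degree is $c$. Let $A_h$ be the set of letters $(1,0,c,1)$, $A_a$ the set of letters $(1,0,c,\pm1)$, and, for a finite set $M$ of positive integers, $A_{c(M)}$ the set of letters $(a,b,c,\pm 1)$ with $a\in M$. Let $\mathcal H$ be one of $A_h$, $A_a$, $A_{c(M)}$. The weight $|w|$ of a word $w$ over $\mathcal H$ is the sum of the degrees of its letters. For a word define $S_\epsilon(n)=1$ for the empty word $\epsilon$ and, for a letter $l=(a,b,c,z)$, $$S_{l w}(n)=\sum_{i=1}^n \lambda(l,i)\,S_w(i),\qquad \lambda(l,i)=\frac{z^i}{(a i+b)^c}.$$ Let $K(n)[x]$ be the ring with $x^2=1$ over the rational function field $K(n)$, with the automorphism $\sigma(n)=n+1$, $\sigma(x)=-x$ fixing $K$, and put $\bar\lambda(l)=1/(an+b)^c$ if $z=1$ and $\bar\lambda(l)=x/(an+b)^c$ if $z=-1$. For letters $l,m\in\mathcal H$ let $[l,m]$ be the unique $K$-linear combination of letters of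 $\mathcal H$ with $\bar\lambda([l,m])=\bar\lambda(l)\bar\lambda(m)$, where $\bar\lambda$ is extended linearly. The quasi-shuffle product on linear combinations of words is the bilinear product with unit $\epsilon$ and $$l u * m v = l(u* m v)+m(l u* v)-[l,m](u*v)$$ for letters $l,m$ and words $u,v$. For $d\ge 0$ let $\mathbb A_d$ be the polynomial ring over $K(n)[x]$ in variables $\bar S_w$, one for each nonempty word $w$ over $\mathcal H$ with $|w|\le d$ (and $\bar S_\epsilon:=1$), with the automorphism $\sigma$ extending that of $K(n)[x]$ by $\sigma(\bar S_{l w})=\bar S_{l w}+\sigma(\bar\lambda(l))\,\sigma(\bar S_w)$. Let $L$ be the $K(n)[x]$-linear map on $\mathbb A_d$ with $L(\bar S_{w_1}\cdots\bar S_{w_k})=w_1*\cdots*w_k$, and $I_d=\{f\in\mathbb A_d: L(f)=0\}$, which is an ideal with $\sigma(I_d)=I_d$. The reduced difference ring is $\mathbb E_d=\mathbb A_d/I_d$ with the induced automorphism $\sigma$. Let $\mathcal S(K)$ be the ring of sequences $\langle a_0,a_1,\dots\rangle$ in $K$, two sequences being identified if they agree at almost all indices, with the shift automorphism $\mathcal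 S$. Let $\tau:\mathbb E_d\to\mathcal S(K)$ be the well-defined ring homomorphism which sends $f\in K(n)$ to $\langle f(k)\rangle_{k\ge0}$ (with value $0$ at poles), $x$ to $\langle(-1)^k\rangle_{k\ge0}$ and the class of $\bar S_w$ to $\langle S_w(k)\rangle_{k\ge0}$. Fix any total order $\prec$ on the words over $\mathcal H$. For each $e$, let $R_e$ be the $K$-span of the weight-$e$ parts of all products $w_1*\cdots*w_k$ with $k\ge2$, all $w_i$ nonempty and $|w_1|+\dots+|w_k|=e$. A nonempty word $w$ of weight $e$ is called reducible if it is the position of a corner (pivot) of the reduced row echelon form of $R_e$ with columns ordered by $\prec$, i.e. if $w$ is the first word with nonzero coefficient of some element of $R_e$. The basis sums are the $\bar S_w$ with $w$ nonempty and not reducible. **Theorem.** For every $d\ge 0$ there are only finitely many basis sums of weight $\le d$. Let $t_1,\dots,t_m$ be their classes in $\mathbb E_d$, listed by non-decreasing weight (in any order within a weight). Then $(\mathbb E_d,\sigma)$ is a $\Sigma^*$-extension of $(K(n)[x],\sigma)$ with generators $t_1,\dots,t_m$. That is, $(\mathbb E_d,\sigma)$ is a difference ring extension of $(K(n)[x],\sigma)$,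 $\mathbb E_d=K(n)[x][t_1]\cdots[t_m]$, and for every $i$, writing $\mathbb B_i=K(n)[x][t_1]\cdots[t_{i-1}]$: $t_i$ is transcendental over $\mathbb B_i$, $\sigma(t_i)-t_i\in\mathbb B_i$, and $\{c\in\mathbb B_i[t_i]:\sigma(c)=c\}=\{c\in\mathbb B_i:\sigma(c)=c\}$. Moreover $\tau$ is an injective difference ring homomorphism: $\tau$ is injective and $\tau(\sigma(f))=\mathcal S(\tau(f))$ for all $f\in\mathbb E_d$. -/

import Mathlib

set_option linter.unusedSectionVars false

noncomputable section

open Polynomial TensorProduct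

namespace HarmonicSums

/-! ## The coefficient difference ring `K(n)[x]` -/

/-- The ring `K(n)[x]` with the relation `x ^ 2 = 1`. -/
abbrev RatAlt (K : Type*) [Field K] : Type _ :=
  AdjoinRoot (X ^ 2 - 1 : (RatFunc K)[X])

/-- The inclusion of `K(n)` into `K(n)[x]`. -/
abbrev RatAlt.ofRat (K : Type*) [Field K] : RatFunc K →+* RatAlt K := AdjoinRoot.of _

/-- The element `x` of `K(n)[x]`, which models `(-1) ^ n`. -/
def RatAlt.alt (K : Type*) [Field K] : RatAlt K := AdjoinRoot.root _

/-- The shift `n ↦ n + 1` on `K(n)`. -/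
def shiftRat (K : Type*) [Field K] : RatFunc K ≃+* RatFunc K :=
  IsFractionRing.ringEquivOfRingEquiv (A := K[X]) (B := K[X])
    (Polynomial.algEquivAevalXAddC (1 : K)).toRingEquiv

/-- Sanity check: the shift maps `n` to `n + 1`. -/
theorem shiftRat_X {K : Type*} [Field K] : shiftRat K RatFunc.X = RatFunc.X + 1 := by
  rw [← RatFunc.algebraMap_X, shiftRat, IsFractionRing.ringEquivOfRingEquiv_algebraMap]
  simp

theorem shiftRat_C {K : Type*} [Field K] (c : K) : shiftRat K (RatFunc.C c) = RatFunc.C c := by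
  rw [← RatFunc.algebraMap_C, shiftRat, IsFractionRing.ringEquivOfRingEquiv_algebraMap]
  simp

/-- The automorphism `σ` of `K(n)[x]` with `σ(n) = n + 1` and `σ(x) = - x`. -/
def shiftRatAlt (K : Type*) [Field K] : RatAlt K ≃+* RatAlt K :=
  RingEquiv.ofRingHom
    (AdjoinRoot.lift ((RatAlt.ofRat K).comp (shiftRat K : RatFunc K →+* RatFunc K))
      (-RatAlt.alt K) (by
        have h := AdjoinRoot.eval₂_root (X ^ 2 - 1 : (RatFunc K)[X])
        simpa [RatAlt.alt] using h))
    (AdjoinRoot.lift ((RatAlt.ofRat K).comp ((shiftRat K).symm : RatFunc K →+* RatFunc K))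
      (-RatAlt.alt K) (by
        have h := AdjoinRoot.eval₂_root (X ^ 2 - 1 : (RatFunc K)[X])
        simpa [RatAlt.alt] using h))
    (by ext <;> simp [RatAlt.alt]) (by ext <;> simp [RatAlt.alt])

theorem alt_mul_alt (K : Type*) [Field K] : RatAlt.alt K * RatAlt.alt K = 1 := by
  have h := AdjoinRoot.eval₂_root (X ^ 2 - 1 : (RatFunc K)[X])
  simp only [eval₂_sub, eval₂_X_pow, eval₂_one] at h
  rw [← pow_two]; exact sub_eq_zero.1 h

theorem shiftRatAlt_algebraMap {K : Type*} [Field K] (c : K) :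
    shiftRatAlt K (algebraMap K (RatAlt K) c) = algebraMap K (RatAlt K) c := by
  have h : algebraMap K (RatAlt K) c = RatAlt.ofRat K (RatFunc.C c) := rfl
  rw [h]
  simp [shiftRatAlt, shiftRat_C]

/-! ## Letters, alphabets and nested sums -/

/-- The letters `(a, b, c, z)`. -/
@[ext]
structure Letter (K : Type*) [Field K] where
  a : ℕ
  b : ℕ
  c : ℕ
  z : K
  a_pos : 0 < a
  c_pos : 0 < c
  z_ne_zero : z ≠ 0
  b_lt_a : b < a
  gcd_eq_one : Nat.gcd a b = 1

/-- Names for the alphabets `A_h`, `A_a` and `A_{c(M)}` with `M` a finite set. -/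
inductive Alphabet where
  | harmonic : Alphabet
  | alternating : Alphabet
  | cyclotomic (M : Finset ℕ) : Alphabet

/-- The letters of each alphabet. -/
def Alphabet.letters (K : Type*) [Field K] : Alphabet → Set (Letter K)
  | .harmonic => {l | l.a = 1 ∧ l.b = 0 ∧ l.z = 1}
  | .alternating => {l | l.a = 1 ∧ l.b = 0 ∧ (l.z = 1 ∨ l.z = -1)}
  | .cyclotomic M => {l | l.a ∈ M ∧ (l.z = 1 ∨ l.z = -1)}

/-- The type of letters of the alphabet `H`. -/
abbrev Ltr (K : Type*) [Field K] (H : Alphabet) : Type _ := ↥(H.letters K)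

/-- Words over the alphabet `H`; the empty word is `[]`. -/
abbrev Word (K : Type*) [Field K] (H : Alphabet) : Type _ := List (Ltr K H)

/-- The weight of a word: the sum of the degrees `c` of its letters. -/
def weight {K : Type*} [Field K] {H : Alphabet} (w : Word K H) : ℕ :=
  (w.map fun l => l.1.c).sum

/-- `λ((a, b, c, z), i) = z ^ i / (a i + b) ^ c`. -/
def letterVal {K : Type*} [Field K] (l : Letter K) (i : ℕ) : K :=
  l.z ^ i / ((l.a : K) * i + l.b) ^ l.c

/-- The nested sum `S_w(n)`; the sum of the empty word is `1`. -/
def nestedSum {K : Type*} [Field K] {H : Alphabet} : Word K H → ℕ → K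
  | [], _ => 1
  | l :: w, n => ∑ i ∈ Finset.Icc 1 n, letterVal l.1 i * nestedSum w i

/-- The rational function `1 / (a n + b) ^ c` attached to a letter. -/
def letterRat {K : Type*} [Field K] (l : Letter K) : RatFunc K :=
  1 / (algebraMap K[X] (RatFunc K) (C (l.a : K) * X + C (l.b : K))) ^ l.c

open Classical in
/-- The element of `K(n)[x]` that models `λ(l, n)`, for the letters with `z = 1` or `z = -1`:
`1 / (a n + b) ^ c` in the first case and `x / (a n + b) ^ c` in the second one. -/
def letterBar {K : Type*} [Field K] (l : Letter K) : RatAlt K :=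
  (if l.z = 1 then 1 else RatAlt.alt K) * RatAlt.ofRat K (letterRat l)

theorem sign_of_mem {K : Type*} [Field K] {H : Alphabet} (l : Ltr K H) :
    l.1.z = 1 ∨ l.1.z = -1 := by
  obtain ⟨l, hl⟩ := l
  cases H with
  | harmonic => exact Or.inl hl.2.2
  | alternating => exact hl.2.2
  | cyclotomic M => exact hl.2

theorem mem_of_mem {K : Type*} [Field K] {H : Alphabet} (l₁ l₂ : Ltr K H) (l : Letter K)
    (h : (l.a = l₁.1.a ∧ l.b = l₁.1.b) ∨ (l.a = l₂.1.a ∧ l.b = l₂.1.b))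
    (hz : l.z = l₁.1.z * l₂.1.z) : l ∈ H.letters K := by
  have hs : l.z = 1 ∨ l.z = -1 := by
    rcases sign_of_mem l₁ with h1 | h1 <;> rcases sign_of_mem l₂ with h2 | h2 <;>
      simp [hz, h1, h2]
  obtain ⟨l₁, h₁⟩ := l₁
  obtain ⟨l₂, h₂⟩ := l₂
  cases H with
  | harmonic =>
    have e1 : l₁.a = 1 ∧ l₁.b = 0 ∧ l₁.z = 1 := h₁
    have e2 : l₂.a = 1 ∧ l₂.b = 0 ∧ l₂.z = 1 := h₂
    change l.a = 1 ∧ l.b = 0 ∧ l.z = 1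
    simp only [e1, e2] at h hz
    exact ⟨by tauto, by tauto, by simpa using hz⟩
  | alternating =>
    have e1 : l₁.a = 1 ∧ l₁.b = 0 ∧ _ := h₁
    have e2 : l₂.a = 1 ∧ l₂.b = 0 ∧ _ := h₂
    change l.a = 1 ∧ l.b = 0 ∧ _
    simp only [e1.1, e2.1, e1.2.1, e2.2.1] at h
    exact ⟨by tauto, by tauto, hs⟩
  | cyclotomic M =>
    have e1 : l₁.a ∈ M ∧ _ := h₁
    have e2 : l₂.a ∈ M ∧ _ := h₂
    change l.a ∈ M ∧ _
    refine ⟨?_, hs⟩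
    rcases h with h | h
    · exact h.1 ▸ e1.1
    · exact h.1 ▸ e2.1

/-! ## Products of letters -/

/-- The ring homomorphism `K(n)[x] → K(n)` which maps `x` to `(-1) ^ k`. -/
def projRat (K : Type*) [Field K] (k : ℕ) : RatAlt K →+* RatFunc K :=
  AdjoinRoot.lift (RingHom.id _) ((-1) ^ k) (by
    simp [← pow_mul, mul_comm k 2])

theorem projRat_ofRat {K : Type*} [Field K] (k : ℕ) (f : RatFunc K) :
    projRat K k (RatAlt.ofRat K f) = f := by simp [projRat]

theorem projRat_alt {K : Type*} [Field K] (k : ℕ) : projRat K k (RatAlt.alt K) = (-1) ^ k := by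
  simp [projRat, RatAlt.alt]

/-- `1 / (n + p) ^ (j + 1)` for pairwise different `(p, j)` are linearly independent. -/
theorem linearIndependent_poles (K : Type*) [Field K] :
    LinearIndependent K (fun q : K × ℕ =>
      ((algebraMap K[X] (RatFunc K) (X + C q.1))⁻¹) ^ (q.2 + 1)) := by
  classical
  rw [linearIndependent_iff']
  intro s g hsum q hq
  obtain ⟨N, hN⟩ : ∃ N, ∀ q ∈ s, q.2 < N :=
    ⟨s.sup (fun q => q.2) + 1, fun q hq => Nat.lt_succ_of_le (Finset.le_sup (f := fun q => q.2) hq)⟩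
  let S := s.image Prod.fst
  let r : (i : K) → Fin N → K[X] := fun i j => C (if (i, j.1) ∈ s then g (i, j.1) else 0)
  have key := Polynomial.quo_add_sum_rem_mul_pow_inverse_unique (K := RatFunc K) (s := S)
    (g := fun i : K => X + C i) (n := fun _ => N)
    (gi := fun i => (algebraMap K[X] (RatFunc K) (X + C i))⁻¹)
    (q₁ := 0) (q₂ := 0) (r₁ := r) (r₂ := fun _ _ => 0)
    (fun i _ => monic_X_add_C i)
    (fun i _ j _ hij => by
      have := Polynomial.pairwise_coprime_X_sub_C (K := K) (s := id) Function.injective_id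
      have h2 := this (i := -i) (j := -j) (by simpa using hij)
      simpa [Function.onFun] using h2)
    (fun i _ => inv_mul_cancel₀ (by
      rw [Ne, map_eq_zero_iff _ (RatFunc.algebraMap_injective K)]
      exact (monic_X_add_C i).ne_zero))
    (fun i _ j => by
      rw [degree_X_add_C]; exact lt_of_le_of_lt degree_C_le (by norm_num))
    (fun i _ j => by simp)
    (by
      simp only [map_zero, zero_mul, Finset.sum_const_zero, add_zero, zero_add]
      rw [← hsum]
      have e1 : ∀ i ∈ S, ∑ j : Fin N, algebraMap K[X] (RatFunc K) (r i j) *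
          ((algebraMap K[X] (RatFunc K) (X + C i))⁻¹) ^ (j.1 + 1) =
          ∑ j ∈ Finset.range N, (if (i, j) ∈ s then g (i, j) •
          ((algebraMap K[X] (RatFunc K) (X + C i))⁻¹) ^ (j + 1) else 0) := by
        intro i _
        rw [Finset.sum_range]
        refine Finset.sum_congr rfl fun j _ => ?_
        by_cases h : (i, j.1) ∈ s
        · simp [r, h, Algebra.smul_def]
        · simp [r, h]
      rw [Finset.sum_congr rfl e1, ← Finset.sum_product', ← Finset.sum_filter]
      refine Finset.sum_congr ?_ fun x _ => rfl
      ext x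
      simp only [Finset.mem_filter, Finset.mem_product, Finset.mem_range]
      exact ⟨fun h => h.2, fun h => ⟨⟨Finset.mem_image_of_mem _ h, hN x h⟩, h⟩⟩)
  have h1 := congrFun (key.2 q.1 (Finset.mem_image_of_mem _ hq)) ⟨q.2, hN q hq⟩
  simpa [r, hq] using h1

theorem letterRat_eq {K : Type*} [Field K] [CharZero K] (l : Letter K) :
    letterRat l = ((l.a : K) ^ l.c)⁻¹ •
      ((algebraMap K[X] (RatFunc K) (X + C ((l.b : K) / l.a)))⁻¹) ^ ((l.c - 1) + 1) := by
  have ha : (l.a : K) ≠ 0 := by exact_mod_cast l.a_pos.ne'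
  have e : C (l.a : K) * X + C (l.b : K) = C (l.a : K) * (X + C ((l.b : K) / l.a)) := by
    rw [mul_add, ← C_mul, mul_div_cancel₀ _ ha]
  have hc : l.c - 1 + 1 = l.c := Nat.sub_add_cancel l.c_pos
  rw [letterRat, e, hc, map_mul, mul_pow, one_div, mul_inv, inv_pow, Algebra.smul_def, map_inv₀,
    map_pow]
  rfl

theorem ext_of_pole {K : Type*} [Field K] [CharZero K] (l m : Letter K)
    (hp : (l.b : K) / l.a = (m.b : K) / m.a) : l.a = m.a ∧ l.b = m.b := by
  have ha : (l.a : K) ≠ 0 := by exact_mod_cast l.a_pos.ne'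
  have hb : (m.a : K) ≠ 0 := by exact_mod_cast m.a_pos.ne'
  rw [div_eq_div_iff ha hb] at hp
  have h : l.b * m.a = m.b * l.a := by exact_mod_cast hp
  have h1 : l.a ∣ m.a := (show Nat.Coprime l.a l.b from l.gcd_eq_one).dvd_of_dvd_mul_left
    (h ▸ Dvd.intro_left _ rfl)
  have h2 : m.a ∣ l.a := (show Nat.Coprime m.a m.b from m.gcd_eq_one).dvd_of_dvd_mul_left
    (h ▸ Dvd.intro_left _ rfl)
  have h3 := Nat.dvd_antisymm h1 h2
  refine ⟨h3, ?_⟩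
  rw [h3] at h
  exact Nat.eq_of_mul_eq_mul_right m.a_pos h

/-- The rational functions of letters with a fixed `z` are linearly independent. -/
theorem linearIndependent_letterRat {K : Type*} [Field K] [CharZero K] (z : K) :
    LinearIndependent K (fun l : {l : Letter K // l.z = z} => letterRat l.1) := by
  have h := (linearIndependent_poles K).comp
    (fun l : {l : Letter K // l.z = z} => ((l.1.b : K) / l.1.a, l.1.c - 1)) (by
      rintro ⟨l, hl⟩ ⟨m, hm⟩ e
      simp only [Prod.mk.injEq] at e
      have hab := ext_of_pole l m e.1
      have hc : l.c = m.c := by have := l.c_pos; have := m.c_pos; omega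
      exact Subtype.ext (Letter.ext hab.1 hab.2 hc (hl.trans hm.symm)))
  have h2 := h.units_smul (fun l => Units.mk0 (((l.1.a : K) ^ l.1.c)⁻¹) (by
    have ha : (l.1.a : K) ≠ 0 := by exact_mod_cast l.1.a_pos.ne'
    positivity))
  convert h2 using 1
  funext l
  exact letterRat_eq l.1

/-- The elements of `K(n)[x]` attached to the letters of an alphabet are linearly independent. -/
theorem linearIndependent_letterBar (K : Type*) [Field K] [CharZero K] (H : Alphabet) :
    LinearIndependent K (fun l : Ltr K H => letterBar l.1) := by
  classical
  rw [linearIndependent_iff']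
  intro s g hsum
  have hsm : ∀ (k : ℕ) (c : K) (f : RatAlt K), projRat K k (c • f) = c • projRat K k f := by
    intro k c f
    have : algebraMap K (RatAlt K) c = RatAlt.ofRat K (algebraMap K (RatFunc K) c) := rfl
    rw [Algebra.smul_def, Algebra.smul_def, map_mul, this, projRat_ofRat]
  have hp : ∀ k : ℕ, ∑ l ∈ s, g l • ((if l.1.z = 1 then 1 else (-1) ^ k) * letterRat l.1) = 0 := by
    intro k
    have := congrArg (projRat K k) hsum
    rw [map_sum, map_zero] at this
    rw [← this]
    refine Finset.sum_congr rfl fun l _ => ?_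
    rw [hsm, letterBar, map_mul, projRat_ofRat]
    split_ifs <;> simp [projRat_alt]
  have h0 := hp 0
  have h1 := hp 1
  have hz : ∀ z : K, (z = 1 ∨ z = -1) → ∑ l ∈ s.filter (fun l => l.1.z = z), g l • letterRat l.1 = 0 := by
    have e0 := Finset.sum_filter_add_sum_filter_not s (fun l => l.1.z = 1)
      (fun l => g l • letterRat l.1)
    have e1 := Finset.sum_filter_add_sum_filter_not s (fun l => l.1.z = 1)
      (fun l => g l • ((if l.1.z = 1 then (1 : RatFunc K) else (-1) ^ 1) * letterRat l.1))
    rw [h1] at e1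
    have a1 : ∑ l ∈ s.filter (fun l => l.1.z = 1),
        g l • ((if l.1.z = 1 then (1 : RatFunc K) else (-1) ^ 1) * letterRat l.1) =
        ∑ l ∈ s.filter (fun l => l.1.z = 1), g l • letterRat l.1 :=
      Finset.sum_congr rfl fun l hl => by simp [(Finset.mem_filter.1 hl).2]
    have a2 : ∑ l ∈ s.filter (fun l => ¬ l.1.z = 1),
        g l • ((if l.1.z = 1 then (1 : RatFunc K) else (-1) ^ 1) * letterRat l.1) =
        - ∑ l ∈ s.filter (fun l => ¬ l.1.z = 1), g l • letterRat l.1 := by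
      rw [← Finset.sum_neg_distrib]
      exact Finset.sum_congr rfl fun l hl => by simp [(Finset.mem_filter.1 hl).2]
    have a0 : ∑ l ∈ s, g l • letterRat l.1 = 0 := by
      rw [← h0]; exact Finset.sum_congr rfl fun l _ => by simp
    rw [a0] at e0
    rw [a1, a2] at e1
    have two : (2 : RatFunc K) ≠ 0 := by
      have : (2 : RatFunc K) = RatFunc.C 2 := (map_ofNat RatFunc.C 2).symm
      rw [this, _root_.map_ne_zero]; norm_num
    have b1 : ∑ l ∈ s.filter (fun l => l.1.z = 1), g l • letterRat l.1 = 0 := by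
      have := congrArg₂ (· + ·) e0 e1
      have h2 : (2 : RatFunc K) * ∑ l ∈ s.filter (fun l => l.1.z = 1), g l • letterRat l.1 = 0 := by
        linear_combination e0 + e1
      exact (mul_eq_zero.1 h2).resolve_left two
    rintro z (rfl | rfl)
    · exact b1
    · rw [b1, zero_add] at e0
      rw [← e0]
      refine Finset.sum_congr (Finset.filter_congr fun l _ => ?_) fun _ _ => rfl
      rcases sign_of_mem l with h | h
      · rw [h]; norm_num
      · rw [h]; norm_num
  intro l hl
  have hli := (linearIndependent_letterRat (K := K) l.1.z).comp
    (fun m : {m : Ltr K H // m.1.z = l.1.z} => (⟨m.1.1, m.2⟩ : {l' : Letter K // l'.z = l.1.z}))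
    (fun a b e => Subtype.ext (Subtype.ext (congrArg (fun x => x.1) e)))
  rw [linearIndependent_iff'] at hli
  have := hli (s.subtype (fun m => m.1.z = l.1.z)) (fun m => g m.1) (by
    rw [← hz l.1.z (sign_of_mem l), ← Finset.sum_subtype_eq_sum_filter]
    rfl) ⟨l, rfl⟩ (by simpa using hl)
  exact this

/-- If `u v` is a linear combination of `u` and `v`, then `u ^ i v ^ j` is one of pure powers. -/
theorem mul_pow_mem_span {K R : Type*} [Field K] [CommRing R] [Algebra K R] (u v : R) (α β : K)
    (h : u * v = α • u + β • v) : ∀ N i j : ℕ, i + j = N → 0 < i + j →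
    u ^ i * v ^ j ∈ Submodule.span K
      ({y | ∃ c, 0 < c ∧ y = u ^ c} ∪ {y | ∃ c, 0 < c ∧ y = v ^ c}) := by
  intro N
  induction N with
  | zero => intro i j h1 h2; omega
  | succ N ih =>
    intro i j h1 h2
    rcases Nat.eq_zero_or_pos i with rfl | hi
    · exact Submodule.subset_span (Or.inr ⟨j, by omega, by simp⟩)
    rcases Nat.eq_zero_or_pos j with rfl | hj
    · exact Submodule.subset_span (Or.inl ⟨i, by omega, by simp⟩)
    obtain ⟨i, rfl⟩ : ∃ i', i = i' + 1 := ⟨i - 1, by omega⟩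
    obtain ⟨j, rfl⟩ : ∃ j', j = j' + 1 := ⟨j - 1, by omega⟩
    have e : u ^ (i + 1) * v ^ (j + 1) =
        α • (u ^ (i + 1) * v ^ j) + β • (u ^ i * v ^ (j + 1)) := by
      calc u ^ (i + 1) * v ^ (j + 1) = u ^ i * v ^ j * (u * v) := by ring
        _ = _ := by rw [h, mul_add, mul_smul_comm, mul_smul_comm]; ring_nf
    rw [e]
    exact Submodule.add_mem _ (Submodule.smul_mem _ _ (ih _ _ (by omega) (by omega)))
      (Submodule.smul_mem _ _ (ih _ _ (by omega) (by omega)))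

/-- The product of two letters is a linear combination of letters of the same alphabet. -/
theorem letterBar_mul_mem_span {K : Type*} [Field K] [CharZero K] {H : Alphabet}
    (l m : Ltr K H) :
    letterBar l.1 * letterBar m.1 ∈ Submodule.span K (Set.range fun k : Ltr K H => letterBar k.1) := by
  classical
  set P : Letter K → K[X] := fun l => C (l.a : K) * X + C (l.b : K) with hP
  set u : Letter K → RatFunc K := fun l => (algebraMap K[X] (RatFunc K) (P l))⁻¹ with hu
  set ε : K → RatAlt K := fun z => if z = 1 then 1 else RatAlt.alt K with hε
  have hbar : ∀ l : Letter K, letterBar l = ε l.z * RatAlt.ofRat K (u l ^ l.c) := by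
    intro l; simp only [letterBar, letterRat, hε, hu, hP, one_div, inv_pow]
  have hne : (-1 : K) ≠ 1 := by norm_num
  have hsign : ε l.1.z * ε m.1.z = ε (l.1.z * m.1.z) := by
    rcases sign_of_mem l with h1 | h1 <;> rcases sign_of_mem m with h2 | h2 <;>
      simp [hε, h1, h2, hne, alt_mul_alt]
  have hPne : ∀ l : Letter K, algebraMap K[X] (RatFunc K) (P l) ≠ 0 := by
    intro l
    have ha : (l.a : K) ≠ 0 := by exact_mod_cast l.a_pos.ne'
    rw [Ne, map_eq_zero_iff _ (RatFunc.algebraMap_injective K)]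
    intro h0
    have := congrArg (fun p => Polynomial.coeff p 1) h0
    simp [hP, ha] at this
  have hz0 : l.1.z * m.1.z ≠ 0 := mul_ne_zero l.1.z_ne_zero m.1.z_ne_zero
  have hpure : ∀ k : Ltr K H, (k = l ∨ k = m) → ∀ c : ℕ, 0 < c →
      ε (l.1.z * m.1.z) * RatAlt.ofRat K (u k.1 ^ c) ∈
        Submodule.span K (Set.range fun k : Ltr K H => letterBar k.1) := by
    intro k hk c hc
    let k' : Letter K := ⟨k.1.a, k.1.b, c, l.1.z * m.1.z, k.1.a_pos, hc, hz0, k.1.b_lt_a,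
      k.1.gcd_eq_one⟩
    have hk' : k' ∈ H.letters K := by
      refine mem_of_mem l m k' ?_ rfl
      rcases hk with rfl | rfl
      · exact Or.inl ⟨rfl, rfl⟩
      · exact Or.inr ⟨rfl, rfl⟩
    refine Submodule.subset_span ⟨⟨k', hk'⟩, ?_⟩
    exact hbar k'
  have hprod : letterBar l.1 * letterBar m.1 =
      ε (l.1.z * m.1.z) * RatAlt.ofRat K (u l.1 ^ l.1.c * u m.1 ^ m.1.c) := by
    rw [hbar, hbar, ← hsign, map_mul]; ring
  rw [hprod]
  by_cases hpole : l.1.a = m.1.a ∧ l.1.b = m.1.b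
  · have e : u m.1 = u l.1 := by simp only [hu, hP, hpole.1, hpole.2]
    rw [e, ← pow_add]
    exact hpure l (Or.inl rfl) _ (Nat.add_pos_left l.1.c_pos _)
  · set Δ : K := (l.1.a : K) * m.1.b - m.1.a * l.1.b with hΔ
    have ha : (l.1.a : K) ≠ 0 := by exact_mod_cast l.1.a_pos.ne'
    have hb : (m.1.a : K) ≠ 0 := by exact_mod_cast m.1.a_pos.ne'
    have hΔ0 : Δ ≠ 0 := by
      intro h0
      refine hpole (ext_of_pole l.1 m.1 ?_)
      rw [div_eq_div_iff ha hb]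
      linear_combination -h0
    have hrel : u l.1 * u m.1 = (Δ⁻¹ * l.1.a) • u l.1 + (-(Δ⁻¹ * m.1.a)) • u m.1 := by
      have hl := hPne l.1
      have hm := hPne m.1
      have hΔ' : algebraMap K (RatFunc K) Δ ≠ 0 := by simpa using hΔ0
      have e : algebraMap K (RatFunc K) Δ =
          algebraMap K (RatFunc K) l.1.a * algebraMap K[X] (RatFunc K) (P m.1) -
          algebraMap K (RatFunc K) m.1.a * algebraMap K[X] (RatFunc K) (P l.1) := by
        have ec : ∀ c : K, algebraMap K (RatFunc K) c = algebraMap K[X] (RatFunc K) (C c) :=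
          fun c => rfl
        rw [ec, ec, ec, ← map_mul, ← map_mul, ← map_sub]
        congr 1
        simp only [hP, hΔ, C_sub, C_mul]
        ring
      simp only [hu, Algebra.smul_def, map_mul, map_neg, map_inv₀]
      field_simp
      rw [e]
      ring
    have hmem := mul_pow_mem_span (K := K) (u l.1) (u m.1) _ _ hrel _ l.1.c m.1.c rfl
      (Nat.add_pos_left l.1.c_pos _)
    let T : RatFunc K →ₗ[K] RatAlt K :=
      { toFun := fun f => ε (l.1.z * m.1.z) * RatAlt.ofRat K f
        map_add' := fun f g => by rw [map_add, mul_add]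
        map_smul' := fun c f => by
          have : algebraMap K (RatAlt K) c = RatAlt.ofRat K (algebraMap K (RatFunc K) c) := rfl
          rw [Algebra.smul_def, map_mul, RingHom.id_apply, Algebra.smul_def, this]; ring }
    change T (u l.1 ^ l.1.c * u m.1 ^ m.1.c) ∈ _
    have hle : Submodule.span K ({y | ∃ c, 0 < c ∧ y = u l.1 ^ c} ∪ {y | ∃ c, 0 < c ∧ y = u m.1 ^ c})
        ≤ (Submodule.span K (Set.range fun k : Ltr K H => letterBar k.1)).comap T := by
      rw [Submodule.span_le]
      rintro y (⟨c, hc, rfl⟩ | ⟨c, hc, rfl⟩)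
      · exact hpure l (Or.inl rfl) c hc
      · exact hpure m (Or.inr rfl) c hc
    exact hle hmem

/-- Formal linear combinations of letters, mapped to `K(n)[x]`. -/
def barLin (K : Type*) [Field K] (H : Alphabet) : (Ltr K H →₀ K) →ₗ[K] RatAlt K :=
  Finsupp.linearCombination K fun l : Ltr K H => letterBar l.1

theorem exists_letterBracket {K : Type*} [Field K] [CharZero K] {H : Alphabet} (l m : Ltr K H) :
    ∃ f : Ltr K H →₀ K, barLin K H f = letterBar l.1 * letterBar m.1 :=
  (Finsupp.mem_span_range_iff_exists_finsupp.1 (letterBar_mul_mem_span l m)).imp fun _ h => h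

/-- The bracket `[l, m]`: the product of the two letters in `K(n)[x]`, written as a linear
combination of letters; by linear independence of the letters, its coefficients are unique. -/
def letterBracket {K : Type*} [Field K] [CharZero K] {H : Alphabet} (l m : Ltr K H) :
    Ltr K H →₀ K :=
  (exists_letterBracket l m).choose

theorem barLin_letterBracket {K : Type*} [Field K] [CharZero K] {H : Alphabet} (l m : Ltr K H) :
    barLin K H (letterBracket l m) = letterBar l.1 * letterBar m.1 :=
  (exists_letterBracket l m).choose_spec

theorem barLin_injective (K : Type*) [Field K] [CharZero K] (H : Alphabet) :
    Function.Injective (barLin K H) :=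
  linearIndependent_letterBar K H

/-! ## The quasi-shuffle algebra -/

section QuasiShuffle

variable {K G : Type*} [CommRing K]

/-- Prefixing a letter to words, `K`-bilinearly: `a ⊗ w ↦ a w`. -/
def consLin : (G →₀ K) →ₗ[K] (List G →₀ K) →ₗ[K] (List G →₀ K) :=
  Finsupp.linearCombination K fun a => Finsupp.lmapDomain K K (List.cons a)

/-- The quasi-shuffle product of two words with respect to a bracket on letters:
`a u * b v = a (u * b v) + b (a u * v) - [a, b] (u * v)`. -/
def qshWord (br : G → G → G →₀ K) : List G → List G → (List G →₀ K)
  | [], v => Finsupp.single v 1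
  | a :: u, [] => Finsupp.single (a :: u) 1
  | a :: u, b :: v =>
      consLin (Finsupp.single a 1) (qshWord br u (b :: v))
        + consLin (Finsupp.single b 1) (qshWord br (a :: u) v)
        - consLin (br a b) (qshWord br u v)
termination_by u v => u.length + v.length

/-- The bilinear extension of the quasi-shuffle product of words. -/
def qshMul (br : G → G → G →₀ K) :
    (List G →₀ K) →ₗ[K] (List G →₀ K) →ₗ[K] (List G →₀ K) :=
  Finsupp.linearCombination K fun u => Finsupp.linearCombination K fun v => qshWord br u v

/-- The bilinear extension of the bracket. -/
def brLin (br : G → G → G →₀ K) : (G →₀ K) →ₗ[K] (G →₀ K) →ₗ[K] (G →₀ K) :=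
  Finsupp.linearCombination K fun a => Finsupp.linearCombination K fun b => br a b

theorem consLin_single (a : G) (w : List G) :
    consLin (Finsupp.single a (1 : K)) (Finsupp.single w 1) = Finsupp.single (a :: w) 1 := by
  simp [consLin]

variable (br : G → G → G →₀ K)

theorem qshMul_single (u v : List G) :
    qshMul br (Finsupp.single u 1) (Finsupp.single v 1) = qshWord br u v := by
  simp [qshMul]

theorem brLin_single (a b : G) :
    brLin br (Finsupp.single a 1) (Finsupp.single b 1) = br a b := by
  simp [brLin]

theorem qshWord_nil (u : List G) : qshWord br u [] = Finsupp.single u 1 := by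
  cases u <;> simp [qshWord]

theorem qshMul_one_left (f : List G →₀ K) : qshMul br (Finsupp.single [] 1) f = f := by
  have : qshMul br (Finsupp.single [] 1) = LinearMap.id := by
    ext v : 2
    simp [qshMul_single, qshWord]
  rw [this]; rfl

theorem qshMul_one_right (f : List G →₀ K) : qshMul br f (Finsupp.single [] 1) = f := by
  have : (qshMul br).flip (Finsupp.single [] 1) = LinearMap.id := by
    ext v : 2
    simp [qshMul_single, qshWord_nil]
  exact LinearMap.congr_fun this f

theorem qshWord_comm (hc : ∀ a b, br a b = br b a) :
    ∀ (N : ℕ) (u v : List G), u.length + v.length = N → qshWord br u v = qshWord br v u := by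
  intro N
  induction N using Nat.strong_induction_on with
  | _ N ih =>
    intro u v hN
    cases u with
    | nil => rw [qshWord_nil]; simp [qshWord]
    | cons a u =>
      cases v with
      | nil => rw [qshWord_nil]; simp [qshWord]
      | cons b v =>
        simp only [List.length_cons] at hN
        rw [qshWord, qshWord, hc a b, ih _ (by simp; omega) u (b :: v) rfl,
          ih _ (by simp; omega) (a :: u) v rfl, ih _ (by omega) u v rfl]
        abel

theorem qshMul_comm (hc : ∀ a b, br a b = br b a) (f g : List G →₀ K) :
    qshMul br f g = qshMul br g f := by
  have : qshMul br = (qshMul br).flip := by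
    ext u v : 4
    simp [qshMul_single, qshWord_comm br hc _ u v rfl]
  exact LinearMap.congr_fun (LinearMap.congr_fun this f) g

/-- The recursion of the quasi-shuffle product, for linear combinations. -/
theorem qshMul_cons_cons (f g : G →₀ K) (U V : List G →₀ K) :
    qshMul br (consLin f U) (consLin g V) =
      consLin f (qshMul br U (consLin g V)) + consLin g (qshMul br (consLin f U) V)
        - consLin (brLin br f g) (qshMul br U V) := by
  induction f using Finsupp.induction_linear with
  | zero => simp
  | add f₁ f₂ h₁ h₂ => simp only [map_add, LinearMap.add_apply, h₁, h₂]; abel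
  | single a r =>
  induction g using Finsupp.induction_linear with
  | zero => simp
  | add f₁ f₂ h₁ h₂ => simp only [map_add, LinearMap.add_apply, h₁, h₂]; abel
  | single b s =>
  induction U using Finsupp.induction_linear with
  | zero => simp
  | add f₁ f₂ h₁ h₂ => simp only [map_add, LinearMap.add_apply, h₁, h₂]; abel
  | single u p =>
  induction V using Finsupp.induction_linear with
  | zero => simp
  | add f₁ f₂ h₁ h₂ => simp only [map_add, h₁, h₂]; abel
  | single v q =>
    have e1 : Finsupp.single a r = r • Finsupp.single a (1 : K) := by simp
    have e2 : Finsupp.single b s = s • Finsupp.single b (1 : K) := by simp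
    have e3 : Finsupp.single u p = p • Finsupp.single u (1 : K) := by simp
    have e4 : Finsupp.single v q = q • Finsupp.single v (1 : K) := by simp
    rw [e1, e2, e3, e4]
    simp only [map_smul, LinearMap.smul_apply, consLin_single, qshMul_single, brLin_single]
    rw [qshWord]
    module

theorem qshMul_assoc_word
    (ha : ∀ f g h, brLin br (brLin br f g) h = brLin br f (brLin br g h)) :
    ∀ (N : ℕ) (u v w : List G), u.length + v.length + w.length = N →
      qshMul br (qshWord br u v) (Finsupp.single w 1) =
        qshMul br (Finsupp.single u 1) (qshWord br v w) := by
  intro N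
  induction N using Nat.strong_induction_on with
  | _ N ih =>
    intro u v w hN
    rcases u with _ | ⟨a, u⟩
    · simp [qshWord, qshMul_one_left, qshMul_single]
    rcases v with _ | ⟨b, v⟩
    · simp [qshWord, qshMul_single]
    rcases w with _ | ⟨c, w⟩
    · simp [qshWord, qshMul_one_right, qshMul_single]
    simp only [List.length_cons] at hN
    have i1 := ih _ (by simp; omega) u (b :: v) (c :: w) rfl
    have i2 := ih _ (by simp; omega) (a :: u) v (c :: w) rfl
    have i3 := ih _ (by simp; omega) (a :: u) (b :: v) w rfl
    have i4 := ih _ (by simp; omega) u v (c :: w) rfl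
    have i5 := ih _ (by simp; omega) u (b :: v) w rfl
    have i6 := ih _ (by simp; omega) (a :: u) v w rfl
    have i7 := ih _ (by omega) u v w rfl
    simp only [← qshMul_single, ← consLin_single] at i1 i2 i3 i4 i5 i6 i7 ⊢
    generalize (Finsupp.single a 1 : G →₀ K) = A at *
    generalize (Finsupp.single b 1 : G →₀ K) = B at *
    generalize (Finsupp.single c 1 : G →₀ K) = C at *
    generalize (Finsupp.single u 1 : List G →₀ K) = U at *
    generalize (Finsupp.single v 1 : List G →₀ K) = V at *
    generalize (Finsupp.single w 1 : List G →₀ K) = W at *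
    have L : qshMul br (qshMul br (consLin A U) (consLin B V)) (consLin C W) =
        consLin A (qshMul br (qshMul br U (consLin B V)) (consLin C W))
        + consLin B (qshMul br (qshMul br (consLin A U) V) (consLin C W))
        - consLin (brLin br A B) (qshMul br (qshMul br U V) (consLin C W))
        + consLin C (qshMul br (qshMul br (consLin A U) (consLin B V)) W)
        - consLin (brLin br A C) (qshMul br (qshMul br U (consLin B V)) W)
        - consLin (brLin br B C) (qshMul br (qshMul br (consLin A U) V) W)
        + consLin (brLin br (brLin br A B) C) (qshMul br (qshMul br U V) W) := by
      rw [qshMul_cons_cons br A B U V]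
      simp only [map_add, map_sub, LinearMap.add_apply, LinearMap.sub_apply]
      rw [qshMul_cons_cons br A C, qshMul_cons_cons br B C, qshMul_cons_cons br _ C]
      abel
    have R : qshMul br (consLin A U) (qshMul br (consLin B V) (consLin C W)) =
        consLin A (qshMul br U (qshMul br (consLin B V) (consLin C W)))
        + consLin B (qshMul br (consLin A U) (qshMul br V (consLin C W)))
        - consLin (brLin br A B) (qshMul br U (qshMul br V (consLin C W)))
        + consLin C (qshMul br (consLin A U) (qshMul br (consLin B V) W))
        - consLin (brLin br A C) (qshMul br U (qshMul br (consLin B V) W))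
        - consLin (brLin br B C) (qshMul br (consLin A U) (qshMul br V W))
        + consLin (brLin br A (brLin br B C)) (qshMul br U (qshMul br V W)) := by
      rw [qshMul_cons_cons br B C V W]
      simp only [map_add, map_sub]
      rw [qshMul_cons_cons br A B, qshMul_cons_cons br A C, qshMul_cons_cons br A _]
      abel
    rw [L, R, i1, i2, i3, i4, i5, i6, i7, ha]

theorem qshMul_assoc
    (ha : ∀ f g h, brLin br (brLin br f g) h = brLin br f (brLin br g h))
    (f g h : List G →₀ K) :
    qshMul br (qshMul br f g) h = qshMul br f (qshMul br g h) := by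
  induction f using Finsupp.induction_linear with
  | zero => simp
  | add f₁ f₂ h₁ h₂ => simp only [map_add, LinearMap.add_apply, h₁, h₂]
  | single u r =>
  induction g using Finsupp.induction_linear with
  | zero => simp
  | add f₁ f₂ h₁ h₂ => simp only [map_add, LinearMap.add_apply, h₁, h₂]
  | single v s =>
  induction h using Finsupp.induction_linear with
  | zero => simp
  | add f₁ f₂ h₁ h₂ => simp only [map_add, h₁, h₂]
  | single w t =>
    have e1 : Finsupp.single u r = r • Finsupp.single u (1 : K) := by simp
    have e2 : Finsupp.single v s = s • Finsupp.single v (1 : K) := by simp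
    have e3 : Finsupp.single w t = t • Finsupp.single w (1 : K) := by simp
    rw [e1, e2, e3]
    simp only [map_smul, LinearMap.smul_apply, qshMul_single,
      qshMul_assoc_word br ha _ u v w rfl]

end QuasiShuffle

section HAlgebra

variable (K : Type*) [Field K] [CharZero K] (H : Alphabet)

theorem letterBracket_comm {K : Type*} [Field K] [CharZero K] {H : Alphabet} (l m : Ltr K H) :
    letterBracket l m = letterBracket m l :=
  barLin_injective K H (by rw [barLin_letterBracket, barLin_letterBracket, mul_comm])

theorem barLin_brLin {K : Type*} [Field K] [CharZero K] {H : Alphabet} (f g : Ltr K H →₀ K) :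
    barLin K H (brLin letterBracket f g) = barLin K H f * barLin K H g := by
  induction f using Finsupp.induction_linear with
  | zero => simp
  | add f₁ f₂ h₁ h₂ => simp only [map_add, LinearMap.add_apply, h₁, h₂, add_mul]
  | single u r =>
  induction g using Finsupp.induction_linear with
  | zero => simp
  | add f₁ f₂ h₁ h₂ => simp only [map_add, h₁, h₂, mul_add]
  | single v s =>
    have e1 : Finsupp.single u r = r • Finsupp.single u (1 : K) := by simp
    have e2 : Finsupp.single v s = s • Finsupp.single v (1 : K) := by simp
    rw [e1, e2]
    simp only [map_smul, LinearMap.smul_apply, brLin_single, barLin_letterBracket]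
    simp [barLin, smul_smul, mul_comm]

theorem brLin_assoc {K : Type*} [Field K] [CharZero K] {H : Alphabet} (f g h : Ltr K H →₀ K) :
    brLin letterBracket (brLin letterBracket f g) h =
      brLin letterBracket f (brLin letterBracket g h) :=
  barLin_injective K H (by simp only [barLin_brLin, mul_assoc])

/-- The quasi-shuffle algebra `K⟨H⟩`: linear combinations of words over `H`, with the
quasi-shuffle product. -/
def QSh : Type _ := Word K H →₀ K

instance : AddCommGroup (QSh K H) := inferInstanceAs (AddCommGroup (Word K H →₀ K))

instance : Module K (QSh K H) := inferInstanceAs (Module K (Word K H →₀ K))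

instance : CommRing (QSh K H) :=
  { (inferInstance : AddCommGroup (QSh K H)) with
    mul := fun f g => qshMul (K := K) letterBracket f g
    one := (Finsupp.single [] 1 : Word K H →₀ K)
    mul_assoc := fun f g h => qshMul_assoc _ brLin_assoc f g h
    one_mul := fun f => qshMul_one_left _ f
    mul_one := fun f => qshMul_one_right _ f
    left_distrib := fun f g h => map_add (qshMul (K := K) letterBracket f) g h
    right_distrib := fun f g h => LinearMap.map_add₂ (qshMul (K := K) letterBracket) f g h
    zero_mul := fun f => LinearMap.map_zero₂ (qshMul (K := K) letterBracket) f
    mul_zero := fun f => map_zero (qshMul (K := K) letterBracket f)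
    mul_comm := fun f g => qshMul_comm _ letterBracket_comm f g }

instance : Algebra K (QSh K H) :=
  Algebra.ofModule
    (fun r f g => LinearMap.map_smul₂ (qshMul (K := K) letterBracket) r f g)
    (fun r f g => map_smul (qshMul (K := K) letterBracket f) r g)

variable {K H}

/-- A word as an element of the quasi-shuffle algebra. -/
def QSh.word (w : Word K H) : QSh K H := (Finsupp.single w 1 : Word K H →₀ K)

/-- The coefficient of a word in an element of the quasi-shuffle algebra. -/
def QSh.coeff (f : QSh K H) (w : Word K H) : K := (show Word K H →₀ K from f) w

open Classical in
/-- The part of weight `d` of an element of the quasi-shuffle algebra. -/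
def QSh.weightPart (d : ℕ) (f : QSh K H) : QSh K H :=
  Finsupp.filter (fun w => weight w = d) (show Word K H →₀ K from f)

/-- Prefixing a linear combination of letters. -/
def QSh.cons (f : Ltr K H →₀ K) (g : QSh K H) : QSh K H :=
  consLin f (show Word K H →₀ K from g)

theorem QSh.word_nil : (QSh.word [] : QSh K H) = 1 := rfl

/-- The defining recursion of the product. -/
theorem QSh.word_mul_word (a b : Ltr K H) (u v : Word K H) :
    QSh.word (a :: u) * QSh.word (b :: v) =
      QSh.cons (Finsupp.single a 1) (QSh.word u * QSh.word (b :: v))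
        + QSh.cons (Finsupp.single b 1) (QSh.word (a :: u) * QSh.word v)
        - QSh.cons (letterBracket a b) (QSh.word u * QSh.word v) := by
  have h := qshMul_cons_cons (K := K) letterBracket (Finsupp.single a 1) (Finsupp.single b 1)
    (Finsupp.single u 1) (Finsupp.single v 1)
  rw [brLin_single, consLin_single, consLin_single] at h
  exact h

end HAlgebra

section Lift

variable {K : Type*} [Field K] [CharZero K] {H : Alphabet} {B : Type*} [CommRing B] [Algebra K B]

/-- The linear extension of a function on words. -/
def QSh.lin (F : Word K H → B) : QSh K H →ₗ[K] B :=
  (Finsupp.linearCombination K F : (Word K H →₀ K) →ₗ[K] B)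

theorem QSh.lin_word (F : Word K H → B) (w : Word K H) : QSh.lin F (QSh.word w) = F w := by
  have : (Finsupp.linearCombination K F : (Word K H →₀ K) →ₗ[K] B) (Finsupp.single w 1) = F w := by
    simp
  exact this

theorem QSh.induction {p : QSh K H → Prop} (f : QSh K H) (h0 : p 0)
    (hadd : ∀ f g, p f → p g → p (f + g)) (hsmul : ∀ (r : K) w, p (r • QSh.word w)) : p f := by
  induction f using Finsupp.induction_linear with
  | zero => exact h0
  | add f g h₁ h₂ => exact hadd _ _ h₁ h₂
  | single w r =>
    have e : Finsupp.single w r = r • Finsupp.single w (1 : K) := by simp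
    rw [e]; exact hsmul r w

/-- A function on words whose linear extension is multiplicative on words is an algebra map. -/
def QSh.liftWord (F : Word K H → B) (h1 : F [] = 1)
    (hmul : ∀ u v, QSh.lin F (QSh.word u * QSh.word v) = F u * F v) : QSh K H →ₐ[K] B :=
  AlgHom.ofLinearMap (QSh.lin F) (by rw [← QSh.word_nil, QSh.lin_word, h1]) (by
    intro f g
    induction f using QSh.induction with
    | h0 => simp
    | hadd f₁ f₂ h₁ h₂ => simp only [add_mul, map_add, h₁, h₂]
    | hsmul r u =>
    induction g using QSh.induction with
    | h0 => simp
    | hadd f₁ f₂ h₁ h₂ => simp only [mul_add, map_add, h₁, h₂]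
    | hsmul s v =>
      simp only [smul_mul_smul_comm, map_smul, hmul, QSh.lin_word])

theorem QSh.liftWord_word (F : Word K H → B) (h1 hmul) (w : Word K H) :
    QSh.liftWord F h1 hmul (QSh.word w) = F w := QSh.lin_word F w

theorem QSh.cons_add (f : Ltr K H →₀ K) (g h : QSh K H) :
    QSh.cons f (g + h) = QSh.cons f g + QSh.cons f h := map_add (consLin f) g h

theorem QSh.cons_smul (f : Ltr K H →₀ K) (r : K) (g : QSh K H) :
    QSh.cons f (r • g) = r • QSh.cons f g := map_smul (consLin f) r g

theorem QSh.add_cons (f f' : Ltr K H →₀ K) (g : QSh K H) :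
    QSh.cons (f + f') g = QSh.cons f g + QSh.cons f' g := LinearMap.map_add₂ consLin f f' g

theorem QSh.smul_cons (f : Ltr K H →₀ K) (r : K) (g : QSh K H) :
    QSh.cons (r • f) g = r • QSh.cons f g := LinearMap.map_smul₂ consLin r f g

theorem QSh.cons_zero (f : Ltr K H →₀ K) : QSh.cons f (0 : QSh K H) = 0 := map_zero (consLin f)

theorem QSh.zero_cons (g : QSh K H) : QSh.cons 0 g = 0 := LinearMap.map_zero₂ consLin g

theorem QSh.cons_single_word (l : Ltr K H) (w : Word K H) :
    QSh.cons (Finsupp.single l 1) (QSh.word w) = QSh.word (l :: w) := consLin_single l w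

theorem QSh.cons_induction {p : (Ltr K H →₀ K) → QSh K H → Prop} (f : Ltr K H →₀ K) (g : QSh K H)
    (h0l : ∀ g, p 0 g) (h0r : ∀ f, p f 0)
    (hl : ∀ f f' g, p f g → p f' g → p (f + f') g)
    (hr : ∀ f g g', p f g → p f g' → p f (g + g'))
    (hs : ∀ (r s : K) l w, p (r • Finsupp.single l 1) (s • QSh.word w)) : p f g := by
  induction f using Finsupp.induction_linear with
  | zero => exact h0l g
  | add f₁ f₂ h₁ h₂ => exact hl _ _ _ h₁ h₂
  | single a r =>
  induction g using QSh.induction with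
  | h0 => exact h0r _
  | hadd f₁ f₂ h₁ h₂ => exact hr _ _ _ h₁ h₂
  | hsmul s w =>
    have e : Finsupp.single a r = r • Finsupp.single a (1 : K) := by simp
    rw [e]
    exact hs r s a w

end Lift

/-! ## The naive and the reduced difference ring -/

section Rings

variable (K : Type*) [Field K] [CharZero K] (H : Alphabet) (d : ℕ)

/-- The variables of the naive ring: one for each nonempty word of weight at most `d`. -/
abbrev SumVar : Type _ := {w : Word K H // w ≠ [] ∧ weight w ≤ d}

/-- The naive ring `A_d`: polynomials over `K(n)[x]` with one variable for each `H`-sum of weight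
at most `d`. -/
abbrev NaiveRing : Type _ := MvPolynomial (SumVar K H d) (RatAlt K)

variable {K H d}

theorem weight_cons (l : Ltr K H) (w : Word K H) : weight (l :: w) = l.1.c + weight w := by
  simp [weight]

theorem weight_tail_le {l : Ltr K H} {w : Word K H} (h : weight (l :: w) ≤ d) : weight w ≤ d := by
  rw [weight_cons] at h; omega

/-- The element of the naive ring that models the sum of a word; `1` for the empty word. -/
def naiveSum : (w : Word K H) → weight w ≤ d → NaiveRing K H d
  | [], _ => 1
  | l :: w, h => MvPolynomial.X ⟨l :: w, by simp, h⟩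

/-- The shifted sum, `σ(S_{l w}) = S_{l w} + σ(λ(l)) σ(S_w)`. -/
def shiftSum : (w : Word K H) → weight w ≤ d → NaiveRing K H d
  | [], _ => 1
  | l :: w, h => MvPolynomial.X ⟨l :: w, by simp, h⟩
      + MvPolynomial.C (shiftRatAlt K (letterBar l.1)) * shiftSum w (weight_tail_le h)

/-- The backward shifted sum, `σ⁻¹(S_{l w}) = S_{l w} - λ(l) S_w`. -/
def unshiftSum : (w : Word K H) → weight w ≤ d → NaiveRing K H d
  | [], _ => 1
  | l :: w, h => MvPolynomial.X ⟨l :: w, by simp, h⟩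
      - MvPolynomial.C (letterBar l.1) * naiveSum w (weight_tail_le h)

variable (K H d)

/-- The forward shift of the naive ring, as a ring homomorphism. -/
def shiftNaiveHom : NaiveRing K H d →+* NaiveRing K H d :=
  MvPolynomial.eval₂Hom (MvPolynomial.C.comp (shiftRatAlt K : RatAlt K →+* RatAlt K))
    fun v => shiftSum v.1 v.2.2

/-- The backward shift of the naive ring, as a ring homomorphism. -/
def unshiftNaiveHom : NaiveRing K H d →+* NaiveRing K H d :=
  MvPolynomial.eval₂Hom (MvPolynomial.C.comp ((shiftRatAlt K).symm : RatAlt K →+* RatAlt K))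
    fun v => unshiftSum v.1 v.2.2

variable {K H d}

theorem shiftNaiveHom_naiveSum (w : Word K H) (h : weight w ≤ d) :
    shiftNaiveHom K H d (naiveSum w h) = shiftSum w h := by
  cases w with
  | nil => simp [naiveSum, shiftSum]
  | cons l w => simp [naiveSum, shiftNaiveHom]

theorem unshiftNaiveHom_shiftSum (w : Word K H) (h : weight w ≤ d) :
    unshiftNaiveHom K H d (shiftSum w h) = naiveSum w h := by
  induction w with
  | nil => simp [naiveSum, shiftSum]
  | cons l w ih =>
    rw [shiftSum, map_add, map_mul, ih]
    simp [unshiftNaiveHom, unshiftSum, naiveSum]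

theorem shiftNaiveHom_unshiftSum (w : Word K H) (h : weight w ≤ d) :
    shiftNaiveHom K H d (unshiftSum w h) = naiveSum w h := by
  cases w with
  | nil => simp [naiveSum, unshiftSum]
  | cons l w =>
    rw [unshiftSum, map_sub, map_mul, shiftNaiveHom_naiveSum]
    simp [shiftNaiveHom, shiftSum, naiveSum]

variable (K H d)

/-- The automorphism `σ` of the naive ring `A_d`. -/
def shiftNaive : NaiveRing K H d ≃+* NaiveRing K H d :=
  RingEquiv.ofRingHom (shiftNaiveHom K H d) (unshiftNaiveHom K H d)
    (by
      refine MvPolynomial.ringHom_ext (fun r => by simp [shiftNaiveHom, unshiftNaiveHom]) ?_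
      rintro ⟨w, hw, h⟩
      have e : unshiftNaiveHom K H d (MvPolynomial.X ⟨w, hw, h⟩) = unshiftSum w h := by
        simp [unshiftNaiveHom]
      rw [RingHom.comp_apply, e, shiftNaiveHom_unshiftSum]
      cases w with
      | nil => exact absurd rfl hw
      | cons l w => rfl)
    (by
      refine MvPolynomial.ringHom_ext (fun r => by simp [shiftNaiveHom, unshiftNaiveHom]) ?_
      rintro ⟨w, hw, h⟩
      have e : shiftNaiveHom K H d (MvPolynomial.X ⟨w, hw, h⟩) = shiftSum w h := by
        simp [shiftNaiveHom]
      rw [RingHom.comp_apply, e, unshiftNaiveHom_shiftSum]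
      cases w with
      | nil => exact absurd rfl hw
      | cons l w => rfl)

/-- The linearization `L`: a product of sums is sent to the quasi-shuffle product of the
corresponding words. Its target is the quasi-shuffle algebra
`K(n)[x]⟨H⟩ = K(n)[x] ⊗ K⟨H⟩` with coefficients in `K(n)[x]`; the empty product is sent to the
empty word, so that `L` is the identity on `K(n)[x]`. -/
def linearize : NaiveRing K H d →ₐ[RatAlt K] RatAlt K ⊗[K] QSh K H :=
  MvPolynomial.aeval fun v : SumVar K H d => (1 : RatAlt K) ⊗ₜ[K] QSh.word v.1

/-- The ideal `I_d` of all elements with `L(f) = 0`. -/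
def relIdeal : Ideal (NaiveRing K H d) := RingHom.ker (linearize K H d)

/-- The reduced ring `E_d = A_d / I_d`. -/
abbrev ReducedRing : Type _ := NaiveRing K H d ⧸ relIdeal K H d

/-- `σ` on `K(n)[x]` as a `K`-algebra map. -/
def shiftRatAltAlg : RatAlt K ≃ₐ[K] RatAlt K :=
  AlgEquiv.ofRingEquiv (f := shiftRatAlt K) shiftRatAlt_algebraMap

variable {K H}

/-- The forward shift on words. -/
def thetaFwd : Word K H → RatAlt K ⊗[K] QSh K H
  | [] => 1
  | l :: w => (1 : RatAlt K) ⊗ₜ QSh.word (l :: w)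
      + (shiftRatAlt K (letterBar l.1) ⊗ₜ (1 : QSh K H)) * thetaFwd w

/-- The backward shift on words. -/
def thetaBwd : Word K H → RatAlt K ⊗[K] QSh K H
  | [] => 1
  | l :: w => (1 : RatAlt K) ⊗ₜ QSh.word (l :: w) - letterBar l.1 ⊗ₜ QSh.word w

theorem lin_thetaBwd_cons (f : Ltr K H →₀ K) (g : QSh K H) :
    QSh.lin thetaBwd (QSh.cons f g) = (1 : RatAlt K) ⊗ₜ QSh.cons f g - barLin K H f ⊗ₜ[K] g := by
  induction f, g using QSh.cons_induction with
  | h0l g => simp [QSh.zero_cons]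
  | h0r f => simp [QSh.cons_zero]
  | hl f f' g h h' =>
    rw [QSh.add_cons, map_add, h, h', TensorProduct.tmul_add, map_add, TensorProduct.add_tmul]
    abel
  | hr f g g' h h' =>
    rw [QSh.cons_add, map_add, h, h', TensorProduct.tmul_add, TensorProduct.tmul_add]
    abel
  | hs r s l w =>
    have e : barLin K H (Finsupp.single l 1) = letterBar l.1 := by simp [barLin]
    rw [QSh.smul_cons, QSh.cons_smul, QSh.cons_single_word, map_smul, map_smul, QSh.lin_word,
      map_smul, e, thetaBwd, TensorProduct.tmul_smul, TensorProduct.tmul_smul,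
      TensorProduct.smul_tmul', TensorProduct.tmul_smul, smul_sub, smul_sub]
    simp only [TensorProduct.smul_tmul', smul_smul, mul_comm]

theorem lin_thetaFwd_cons (f : Ltr K H →₀ K) (g : QSh K H) :
    QSh.lin thetaFwd (QSh.cons f g) = (1 : RatAlt K) ⊗ₜ QSh.cons f g +
      (shiftRatAltAlg K (barLin K H f) ⊗ₜ[K] (1 : QSh K H)) * QSh.lin thetaFwd g := by
  induction f, g using QSh.cons_induction with
  | h0l g => simp [QSh.zero_cons]
  | h0r f => simp [QSh.cons_zero]
  | hl f f' g h h' =>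
    rw [QSh.add_cons, map_add, h, h', TensorProduct.tmul_add, map_add, map_add,
      TensorProduct.add_tmul, add_mul]
    abel
  | hr f g g' h h' =>
    rw [QSh.cons_add, map_add, h, h', TensorProduct.tmul_add, map_add, mul_add]
    abel
  | hs r s l w =>
    have e : barLin K H (Finsupp.single l 1) = letterBar l.1 := by simp [barLin]
    have es : ∀ r : RatAlt K, shiftRatAltAlg K r = shiftRatAlt K r := fun _ => rfl
    rw [QSh.smul_cons, QSh.cons_smul, QSh.cons_single_word, map_smul, map_smul, QSh.lin_word,
      map_smul, e, thetaFwd, map_smul, es, map_smul, QSh.lin_word, TensorProduct.tmul_smul,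
      TensorProduct.tmul_smul, ← TensorProduct.smul_tmul', smul_mul_smul_comm, smul_add, smul_add,
      smul_smul, smul_smul]

/-- The backward shift on the quasi-shuffle algebra. -/
def thetaBwdHom : QSh K H →ₐ[K] RatAlt K ⊗[K] QSh K H :=
  QSh.liftWord thetaBwd rfl (by
    intro u v
    rcases u with _ | ⟨a, u⟩
    · rw [QSh.word_nil, one_mul, QSh.lin_word]; simp [thetaBwd]
    rcases v with _ | ⟨b, v⟩
    · rw [QSh.word_nil, mul_one, QSh.lin_word]; simp [thetaBwd]
    have hw := QSh.word_mul_word a b u v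
    have e : (1 : RatAlt K) ⊗ₜ[K] (QSh.word (a :: u) * QSh.word (b :: v)) = _ :=
      congrArg (fun q => (1 : RatAlt K) ⊗ₜ[K] q) hw
    rw [hw, map_sub, map_add, lin_thetaBwd_cons, lin_thetaBwd_cons, lin_thetaBwd_cons,
      barLin_letterBracket]
    simp only [TensorProduct.tmul_sub, TensorProduct.tmul_add] at e
    have ea : barLin K H (Finsupp.single a 1) = letterBar a.1 := by simp [barLin]
    have eb : barLin K H (Finsupp.single b 1) = letterBar b.1 := by simp [barLin]
    rw [ea, eb]
    simp only [thetaBwd, sub_mul, mul_sub, Algebra.TensorProduct.tmul_mul_tmul, one_mul, mul_one]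
    rw [e]
    abel)

/-- The forward shift on the quasi-shuffle algebra. -/
def thetaFwdHom : QSh K H →ₐ[K] RatAlt K ⊗[K] QSh K H :=
  QSh.liftWord thetaFwd rfl (by
    have key : ∀ (N : ℕ) (u v : Word K H), u.length + v.length = N →
        QSh.lin thetaFwd (QSh.word u * QSh.word v) = thetaFwd u * thetaFwd v := by
      intro N
      induction N using Nat.strong_induction_on with
      | _ N ih =>
        intro u v hN
        rcases u with _ | ⟨a, u⟩
        · rw [QSh.word_nil, one_mul, QSh.lin_word]; simp [thetaFwd]
        rcases v with _ | ⟨b, v⟩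
        · rw [QSh.word_nil, mul_one, QSh.lin_word]; simp [thetaFwd]
        simp only [List.length_cons] at hN
        have i1 := ih _ (by simp; omega) u (b :: v) rfl
        have i2 := ih _ (by simp; omega) (a :: u) v rfl
        have i3 := ih _ (by omega) u v rfl
        have hw := QSh.word_mul_word a b u v
        have e : (1 : RatAlt K) ⊗ₜ[K] (QSh.word (a :: u) * QSh.word (b :: v)) = _ :=
          congrArg (fun q => (1 : RatAlt K) ⊗ₜ[K] q) hw
        have e' : (1 : RatAlt K) ⊗ₜ[K] (QSh.word (a :: u) * QSh.word (b :: v)) =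
            ((1 : RatAlt K) ⊗ₜ[K] QSh.word (a :: u)) * ((1 : RatAlt K) ⊗ₜ[K] QSh.word (b :: v)) := by
          simp
        rw [hw, map_sub, map_add, lin_thetaFwd_cons, lin_thetaFwd_cons, lin_thetaFwd_cons,
          barLin_letterBracket, i1, i2, i3]
        simp only [TensorProduct.tmul_sub, TensorProduct.tmul_add] at e
        have ea : barLin K H (Finsupp.single a 1) = letterBar a.1 := by simp [barLin]
        have eb : barLin K H (Finsupp.single b 1) = letterBar b.1 := by simp [barLin]
        have em : (shiftRatAltAlg K (letterBar a.1 * letterBar b.1)) ⊗ₜ[K] (1 : QSh K H) =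
            (shiftRatAlt K (letterBar a.1) ⊗ₜ[K] 1) * (shiftRatAlt K (letterBar b.1) ⊗ₜ[K] 1) := by
          simp [shiftRatAltAlg]
        have es : ∀ r : RatAlt K, shiftRatAltAlg K r = shiftRatAlt K r := fun _ => rfl
        rw [ea, eb, em, es, es]
        simp only [thetaFwd]
        linear_combination e' - e
    exact fun u v => key _ u v rfl)

/-- The forward shift on the quasi-shuffle algebra over `K(n)[x]`. -/
def shiftTensor : RatAlt K ⊗[K] QSh K H →ₐ[K] RatAlt K ⊗[K] QSh K H :=
  Algebra.TensorProduct.productMap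
    (Algebra.TensorProduct.includeLeft.comp (shiftRatAltAlg K : RatAlt K →ₐ[K] RatAlt K))
    thetaFwdHom

/-- The backward shift on the quasi-shuffle algebra over `K(n)[x]`. -/
def unshiftTensor : RatAlt K ⊗[K] QSh K H →ₐ[K] RatAlt K ⊗[K] QSh K H :=
  Algebra.TensorProduct.productMap
    (Algebra.TensorProduct.includeLeft.comp ((shiftRatAltAlg K).symm : RatAlt K →ₐ[K] RatAlt K))
    thetaBwdHom

variable {d}

theorem linearize_naiveSum (w : Word K H) (h : weight w ≤ d) :
    linearize K H d (naiveSum w h) = 1 ⊗ₜ QSh.word w := by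
  cases w with
  | nil => simp only [naiveSum, map_one]; rfl
  | cons l w => simp [naiveSum, linearize]

theorem linearize_shiftSum (w : Word K H) (h : weight w ≤ d) :
    linearize K H d (shiftSum w h) = thetaFwd w := by
  induction w with
  | nil => simp [shiftSum, thetaFwd]
  | cons l w ih =>
    rw [shiftSum, thetaFwd, map_add, map_mul, ih]
    simp [linearize]

theorem linearize_unshiftSum (w : Word K H) (h : weight w ≤ d) :
    linearize K H d (unshiftSum w h) = thetaBwd w := by
  cases w with
  | nil => simp [unshiftSum, thetaBwd]
  | cons l w =>
    rw [unshiftSum, thetaBwd, map_sub, map_mul, linearize_naiveSum]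
    simp [linearize]

theorem linearize_shiftNaive (f : NaiveRing K H d) :
    linearize K H d (shiftNaive K H d f) = shiftTensor (linearize K H d f) := by
  have : ((linearize K H d : NaiveRing K H d →+* _).comp (shiftNaiveHom K H d)) =
      ((shiftTensor : RatAlt K ⊗[K] QSh K H →ₐ[K] RatAlt K ⊗[K] QSh K H) :
        RatAlt K ⊗[K] QSh K H →+* RatAlt K ⊗[K] QSh K H).comp (linearize K H d : NaiveRing K H d →+* _) := by
    refine MvPolynomial.ringHom_ext (fun r => ?_) fun v => ?_
    · simp [shiftNaiveHom, shiftTensor, linearize, shiftRatAltAlg]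
    · have e : shiftNaiveHom K H d (MvPolynomial.X v) = shiftSum v.1 v.2.2 := by
        simp [shiftNaiveHom]
      rw [RingHom.comp_apply, e]
      have e1 : linearize K H d (MvPolynomial.X v) = 1 ⊗ₜ QSh.word v.1 := by simp [linearize]
      have e2 : thetaFwdHom (QSh.word v.1) = thetaFwd v.1 := QSh.liftWord_word _ _ _ _
      change linearize K H d (shiftSum v.1 v.2.2) = shiftTensor (linearize K H d (MvPolynomial.X v))
      rw [linearize_shiftSum, e1, shiftTensor, Algebra.TensorProduct.productMap_apply_tmul, e2, map_one,
        one_mul]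
  exact RingHom.congr_fun this f

theorem linearize_unshiftNaive (f : NaiveRing K H d) :
    linearize K H d ((shiftNaive K H d).symm f) = unshiftTensor (linearize K H d f) := by
  have : ((linearize K H d : NaiveRing K H d →+* _).comp (unshiftNaiveHom K H d)) =
      ((unshiftTensor : RatAlt K ⊗[K] QSh K H →ₐ[K] RatAlt K ⊗[K] QSh K H) :
        RatAlt K ⊗[K] QSh K H →+* RatAlt K ⊗[K] QSh K H).comp (linearize K H d : NaiveRing K H d →+* _) := by
    refine MvPolynomial.ringHom_ext (fun r => ?_) fun v => ?_
    · simp [unshiftNaiveHom, unshiftTensor, linearize, shiftRatAltAlg]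
    · have e : unshiftNaiveHom K H d (MvPolynomial.X v) = unshiftSum v.1 v.2.2 := by
        simp [unshiftNaiveHom]
      rw [RingHom.comp_apply, e]
      have e1 : linearize K H d (MvPolynomial.X v) = 1 ⊗ₜ QSh.word v.1 := by simp [linearize]
      have e2 : thetaBwdHom (QSh.word v.1) = thetaBwd v.1 := QSh.liftWord_word _ _ _ _
      change linearize K H d (unshiftSum v.1 v.2.2) = unshiftTensor (linearize K H d (MvPolynomial.X v))
      rw [linearize_unshiftSum, e1, unshiftTensor, Algebra.TensorProduct.productMap_apply_tmul, e2, map_one,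
        one_mul]
  exact RingHom.congr_fun this f

variable (K H d)

/-- `I_d` is a reflexive difference ideal. -/
theorem map_relIdeal : relIdeal K H d =
    (relIdeal K H d).map (shiftNaive K H d : NaiveRing K H d →+* NaiveRing K H d) := by
  refine le_antisymm ?_ ?_
  · intro f hf
    have hf0 : linearize K H d f = 0 := hf
    have h : (shiftNaive K H d).symm f ∈ relIdeal K H d := by
      change linearize K H d ((shiftNaive K H d).symm f) = 0
      rw [linearize_unshiftNaive, hf0, map_zero]
    have := Ideal.mem_map_of_mem (shiftNaive K H d : NaiveRing K H d →+* NaiveRing K H d) h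
    simpa using this
  · rw [Ideal.map_le_iff_le_comap]
    intro f hf
    have hf0 : linearize K H d f = 0 := hf
    change linearize K H d (shiftNaive K H d f) = 0
    rw [linearize_shiftNaive, hf0, map_zero]

/-- The automorphism `σ` of the reduced ring, `σ(f + I_d) = σ(f) + I_d`. -/
def shiftReduced : ReducedRing K H d ≃+* ReducedRing K H d :=
  Ideal.quotientEquiv (relIdeal K H d) (relIdeal K H d) (shiftNaive K H d) (map_relIdeal K H d)

/-- The class in the reduced ring of the variable attached to a sum. -/
def reducedSum (v : SumVar K H d) : ReducedRing K H d :=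
  Ideal.Quotient.mk (relIdeal K H d) (MvPolynomial.X v)

end Rings

/-! ## The ring of sequences and the evaluation map -/

/-- The ring of sequences `S(K)`: sequences modulo equality for almost all indices. -/
abbrev SeqRing (K : Type*) : Type _ := Filter.Germ (Filter.atTop : Filter ℕ) K

/-- The class of a sequence in the ring of sequences. -/
def toSeq {K : Type*} (s : ℕ → K) : SeqRing K := (s : Filter.Germ (Filter.atTop : Filter ℕ) K)

theorem toSeq_eq {K : Type*} {s t : ℕ → K} (h : ∀ᶠ k in Filter.atTop, s k = t k) :
    toSeq s = toSeq t := Filter.Germ.coe_eq.2 h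

/-- The shift automorphism `(a_0, a_1, a_2, …) ↦ (a_1, a_2, a_3, …)` of the ring of sequences. -/
def shiftSeq (K : Type*) [CommRing K] : SeqRing K ≃+* SeqRing K where
  toFun s := s.compTendsto (fun k => k + 1) (Filter.tendsto_add_atTop_nat 1)
  invFun s := s.compTendsto (fun k => k - 1) (Filter.tendsto_sub_atTop_nat 1)
  left_inv s := by
    induction s using Filter.Germ.inductionOn with
    | _ f =>
      simp only [Filter.Germ.coe_compTendsto]
      refine toSeq_eq ?_
      filter_upwards [Filter.eventually_ge_atTop 1] with k hk
      simp [Nat.sub_add_cancel hk]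
  right_inv s := by
    induction s using Filter.Germ.inductionOn with
    | _ f =>
      simp only [Filter.Germ.coe_compTendsto]
      exact toSeq_eq (Filter.Eventually.of_forall fun k => by simp)
  map_mul' s t := by
    induction s using Filter.Germ.inductionOn with
    | _ f =>
      induction t using Filter.Germ.inductionOn with
      | _ g => rfl
  map_add' s t := by
    induction s using Filter.Germ.inductionOn with
    | _ f =>
      induction t using Filter.Germ.inductionOn with
      | _ g => rfl

theorem shiftSeq_toSeq {K : Type*} [CommRing K] (s : ℕ → K) :
    shiftSeq K (toSeq s) = toSeq fun k => s (k + 1) := rfl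

section Evaluation

variable {K : Type*} [Field K]

/-- The value of a rational function at `k`; it is `0` at the poles. -/
def evRat (f : RatFunc K) (k : ℕ) : K := RatFunc.eval (RingHom.id K) (k : K) f

/-- The rational functions without a pole at `k`. -/
def regularAt (K : Type*) [Field K] (k : ℕ) : Subring (RatFunc K) where
  carrier := {f | f.denom.eval (k : K) ≠ 0}
  mul_mem' {f g} hf hg h0 := by
    have := Polynomial.eval_eq_zero_of_dvd_of_eval_eq_zero (RatFunc.denom_mul_dvd f g) h0
    rw [eval_mul] at this
    exact (mul_eq_zero.1 this).elim hf hg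
  add_mem' {f g} hf hg h0 := by
    have := Polynomial.eval_eq_zero_of_dvd_of_eval_eq_zero (RatFunc.denom_add_dvd f g) h0
    rw [eval_mul] at this
    exact (mul_eq_zero.1 this).elim hf hg
  one_mem' := by simp
  zero_mem' := by simp
  neg_mem' {f} hf := by
    have h : (-f) = RatFunc.C (-1) * f := by simp
    intro h0
    rw [h] at h0
    have := Polynomial.eval_eq_zero_of_dvd_of_eval_eq_zero (RatFunc.denom_mul_dvd _ f) h0
    rw [eval_mul] at this
    exact (mul_eq_zero.1 this).elim (by rw [RatFunc.denom_C]; simp) hf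

theorem evRat_add {f g : RatFunc K} {k : ℕ} (hf : f ∈ regularAt K k) (hg : g ∈ regularAt K k) :
    evRat (f + g) k = evRat f k + evRat g k := RatFunc.eval_add _ _ hf hg

theorem evRat_mul {f g : RatFunc K} {k : ℕ} (hf : f ∈ regularAt K k) (hg : g ∈ regularAt K k) :
    evRat (f * g) k = evRat f k * evRat g k := RatFunc.eval_mul _ _ hf hg

theorem evRat_C (c : K) (k : ℕ) : evRat (RatFunc.C c) k = c := by simp [evRat]

theorem C_mem_regularAt (c : K) (k : ℕ) : RatFunc.C c ∈ regularAt K k := by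
  change (RatFunc.C c).denom.eval (k : K) ≠ 0
  simp

theorem eventually_regularAt [CharZero K] (f : RatFunc K) :
    ∀ᶠ k in Filter.atTop, f ∈ regularAt K k := by
  classical
  have hfin : {k : ℕ | f.denom.eval (k : K) = 0}.Finite := by
    have h1 := (f.denom.roots.toFinset.finite_toSet).preimage
      (f := fun k : ℕ => (k : K)) (Nat.cast_injective.injOn)
    refine h1.subset fun k hk => ?_
    simpa [RatFunc.denom_ne_zero] using hk
  rw [← Nat.cofinite_eq_atTop]
  filter_upwards [hfin.compl_mem_cofinite] with k hk
  exact hk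

/-- The evaluation homomorphism from `K(n)` to the ring of sequences. -/
def tauRat (K : Type*) [Field K] [CharZero K] : RatFunc K →+* SeqRing K where
  toFun f := toSeq (evRat f)
  map_one' := toSeq_eq (Filter.Eventually.of_forall fun k => by simp [evRat])
  map_zero' := toSeq_eq (Filter.Eventually.of_forall fun k => by simp [evRat])
  map_add' f g := toSeq_eq (by
    filter_upwards [eventually_regularAt f, eventually_regularAt g] with k hf hg
    exact evRat_add hf hg)
  map_mul' f g := toSeq_eq (by
    filter_upwards [eventually_regularAt f, eventually_regularAt g] with k hf hg
    exact evRat_mul hf hg)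

/-- The evaluation homomorphism from `K(n)[x]` to the ring of sequences; `x` is sent to
the sequence `(-1) ^ k`. -/
def tauRatAlt (K : Type*) [Field K] [CharZero K] : RatAlt K →+* SeqRing K :=
  AdjoinRoot.lift (tauRat K) (toSeq fun k => (-1) ^ k) (by
    have h : (toSeq fun k => (-1 : K) ^ k) ^ 2 = 1 :=
      toSeq_eq (s := fun k => ((-1 : K) ^ k) ^ 2) (t := fun _ => 1)
        (Filter.Eventually.of_forall fun k => by simp [← pow_mul, mul_comm k 2])
    rw [eval₂_sub, eval₂_X_pow, eval₂_one, h, sub_self])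

variable [CharZero K] {H : Alphabet}

theorem lin_ne_zero (l : Letter K) {i : ℕ} (hi : 1 ≤ i) : (l.a : K) * i + l.b ≠ 0 := by
  have : 0 < l.a * i + l.b := Nat.add_pos_left (Nat.mul_pos l.a_pos hi) _
  exact_mod_cast this.ne'

theorem letterRat_regular (l : Letter K) {i : ℕ} (hi : 1 ≤ i) :
    letterRat l ∈ regularAt K i ∧ evRat (letterRat l) i = 1 / ((l.a : K) * i + l.b) ^ l.c := by
  set p : K[X] := (C (l.a : K) * X + C (l.b : K)) ^ l.c with hp
  have hpe : p.eval (i : K) ≠ 0 := by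
    simp only [hp, eval_pow, eval_add, eval_mul, eval_C, eval_X]
    exact pow_ne_zero _ (lin_ne_zero l hi)
  have hp0 : p ≠ 0 := by rintro h; simp [h] at hpe
  have e : letterRat l = algebraMap K[X] (RatFunc K) 1 / algebraMap K[X] (RatFunc K) p := by
    rw [letterRat, hp, map_pow, map_one]
  have hreg : letterRat l ∈ regularAt K i := by
    intro h0
    rw [e] at h0
    exact hpe (Polynomial.eval_eq_zero_of_dvd_of_eval_eq_zero (RatFunc.denom_div_dvd 1 p) h0)
  refine ⟨hreg, ?_⟩
  have hpreg : algebraMap K[X] (RatFunc K) p ∈ regularAt K i := by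
    change (algebraMap K[X] (RatFunc K) p).denom.eval (i : K) ≠ 0
    simp
  have hprod : letterRat l * algebraMap K[X] (RatFunc K) p = 1 := by
    rw [e, map_one, one_div, inv_mul_cancel₀]
    rwa [Ne, map_eq_zero_iff _ (RatFunc.algebraMap_injective K)]
  have := evRat_mul hreg hpreg
  rw [hprod] at this
  have e1 : evRat (1 : RatFunc K) i = 1 := by simp [evRat]
  have e2 : evRat (algebraMap K[X] (RatFunc K) p) i = p.eval (i : K) := by
    simp [evRat, RatFunc.eval]
  rw [e1, e2] at this
  have e3 : p.eval (i : K) = ((l.a : K) * i + l.b) ^ l.c := by simp [hp]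
  rw [← e3, eq_div_iff hpe, this]

theorem projRat_letterBar (l : Ltr K H) {i : ℕ} (hi : 1 ≤ i) :
    projRat K i (letterBar l.1) ∈ regularAt K i ∧
      evRat (projRat K i (letterBar l.1)) i = letterVal l.1 i := by
  obtain ⟨h1, h2⟩ := letterRat_regular l.1 hi
  have e : projRat K i (letterBar l.1) = RatFunc.C (l.1.z ^ i) * letterRat l.1 := by
    have hne : (-1 : K) ≠ 1 := by norm_num
    rw [letterBar, map_mul, projRat_ofRat]
    rcases sign_of_mem l with h | h
    · simp [h]
    · simp [h, hne, projRat_alt]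
  rw [e]
  refine ⟨mul_mem (C_mem_regularAt _ _) h1, ?_⟩
  rw [evRat_mul (C_mem_regularAt _ _) h1, evRat_C, h2, letterVal]
  ring

/-- The value at `i` of a linear combination of letters. -/
def valLin (i : ℕ) : (Ltr K H →₀ K) →ₗ[K] K :=
  Finsupp.linearCombination K fun l : Ltr K H => letterVal l.1 i

theorem projRat_barLin (f : Ltr K H →₀ K) {i : ℕ} (hi : 1 ≤ i) :
    projRat K i (barLin K H f) ∈ regularAt K i ∧
      evRat (projRat K i (barLin K H f)) i = valLin i f := by
  induction f using Finsupp.induction_linear with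
  | zero => simp [evRat]
  | add f g hf hg =>
    rw [map_add, map_add, map_add]
    exact ⟨add_mem hf.1 hg.1, by rw [evRat_add hf.1 hg.1, hf.2, hg.2]⟩
  | single l r =>
    have e : projRat K i (barLin K H (Finsupp.single l r)) =
        RatFunc.C r * projRat K i (letterBar l.1) := by
      have h : barLin K H (Finsupp.single l r) = RatAlt.ofRat K (RatFunc.C r) * letterBar l.1 := by
        simp only [barLin, Finsupp.linearCombination_single, Algebra.smul_def]
        rfl
      rw [h, map_mul, projRat_ofRat]
    obtain ⟨h1, h2⟩ := projRat_letterBar l hi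
    rw [e]
    refine ⟨mul_mem (C_mem_regularAt _ _) h1, ?_⟩
    rw [evRat_mul (C_mem_regularAt _ _) h1, evRat_C, h2]
    simp [valLin]

theorem valLin_letterBracket (l m : Ltr K H) {i : ℕ} (hi : 1 ≤ i) :
    valLin i (letterBracket l m) = letterVal l.1 i * letterVal m.1 i := by
  obtain ⟨h1, h2⟩ := projRat_letterBar l hi
  obtain ⟨h3, h4⟩ := projRat_letterBar m hi
  rw [← (projRat_barLin _ hi).2, barLin_letterBracket, map_mul, evRat_mul h1 h3, h2, h4]

theorem lin_nestedSum_cons (f : Ltr K H →₀ K) (g : QSh K H) (n : ℕ) :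
    QSh.lin (B := ℕ → K) nestedSum (QSh.cons f g) n =
      ∑ i ∈ Finset.Icc 1 n, valLin i f * QSh.lin (B := ℕ → K) nestedSum g i := by
  induction f, g using QSh.cons_induction with
  | h0l g => simp [QSh.zero_cons]
  | h0r f => simp [QSh.cons_zero]
  | hl f f' g h h' =>
    rw [QSh.add_cons, map_add, Pi.add_apply, h, h', ← Finset.sum_add_distrib]
    exact Finset.sum_congr rfl fun i _ => by rw [map_add]; ring
  | hr f g g' h h' =>
    rw [QSh.cons_add, map_add, Pi.add_apply, h, h', ← Finset.sum_add_distrib]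
    exact Finset.sum_congr rfl fun i _ => by rw [map_add, Pi.add_apply]; ring
  | hs r s l w =>
    rw [QSh.smul_cons, QSh.cons_smul, QSh.cons_single_word, map_smul, map_smul, QSh.lin_word,
      Pi.smul_apply, Pi.smul_apply, nestedSum, smul_smul, smul_eq_mul, Finset.mul_sum]
    refine Finset.sum_congr rfl fun i _ => ?_
    rw [map_smul, map_smul, Pi.smul_apply, QSh.lin_word]
    simp [valLin]
    ring

/-- The evaluation of words at nested sums turns quasi-shuffle products into products. -/
def sumHom (K : Type*) [Field K] [CharZero K] (H : Alphabet) : QSh K H →ₐ[K] (ℕ → K) :=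
  QSh.liftWord nestedSum rfl (by
    have key : ∀ (N : ℕ) (u v : Word K H), u.length + v.length = N →
        QSh.lin (B := ℕ → K) nestedSum (QSh.word u * QSh.word v) = nestedSum u * nestedSum v := by
      intro N
      induction N using Nat.strong_induction_on with
      | _ N ih =>
        intro u v hN
        have hnil : (nestedSum ([] : Word K H) : ℕ → K) = 1 := rfl
        rcases u with _ | ⟨a, u⟩
        · rw [QSh.word_nil, one_mul, QSh.lin_word, hnil, one_mul]
        rcases v with _ | ⟨b, v⟩
        · rw [QSh.word_nil, mul_one, QSh.lin_word, hnil, mul_one]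
        simp only [List.length_cons] at hN
        have i1 := ih _ (by simp; omega) u (b :: v) rfl
        have i2 := ih _ (by simp; omega) (a :: u) v rfl
        have i3 := ih _ (by omega) u v rfl
        funext n
        rw [QSh.word_mul_word, map_sub, map_add, Pi.sub_apply, Pi.add_apply, lin_nestedSum_cons,
          lin_nestedSum_cons, lin_nestedSum_cons, i1, i2, i3]
        induction n with
        | zero => simp [nestedSum]
        | succ n ihn =>
          rw [Finset.sum_Icc_succ_top (by omega), Finset.sum_Icc_succ_top (by omega),
            Finset.sum_Icc_succ_top (by omega), valLin_letterBracket a b (by omega : 1 ≤ n + 1)]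
          have ha : valLin (n + 1) (Finsupp.single a (1 : K)) = letterVal a.1 (n + 1) := by
            simp [valLin]
          have hb : valLin (n + 1) (Finsupp.single b (1 : K)) = letterVal b.1 (n + 1) := by
            simp [valLin]
          have sa : nestedSum (a :: u) (n + 1) =
              nestedSum (a :: u) n + letterVal a.1 (n + 1) * nestedSum u (n + 1) := by
            rw [nestedSum, nestedSum, Finset.sum_Icc_succ_top (by omega)]
          have sb : nestedSum (b :: v) (n + 1) =
              nestedSum (b :: v) n + letterVal b.1 (n + 1) * nestedSum v (n + 1) := by
            rw [nestedSum, nestedSum, Finset.sum_Icc_succ_top (by omega)]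
          simp only [Pi.mul_apply] at ihn ⊢
          rw [ha, hb, sa, sb]
          linear_combination ihn
    exact fun u v => key _ u v rfl)

instance : Algebra K (SeqRing K) :=
  Algebra.ofModule
    (fun r s t => by
      induction s using Filter.Germ.inductionOn with
      | _ f =>
        induction t using Filter.Germ.inductionOn with
        | _ g => exact toSeq_eq (Filter.Eventually.of_forall fun k => smul_mul_assoc r (f k) (g k)))
    (fun r s t => by
      induction s using Filter.Germ.inductionOn with
      | _ f =>
        induction t using Filter.Germ.inductionOn with
        | _ g => exact toSeq_eq (Filter.Eventually.of_forall fun k => mul_smul_comm r (f k) (g k)))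

theorem algebraMap_seq (c : K) : algebraMap K (SeqRing K) c = toSeq fun _ => c := by
  rw [Algebra.algebraMap_eq_smul_one]
  exact toSeq_eq (s := fun _ => c • (1 : K))
    (Filter.Eventually.of_forall fun k => by simp)

/-- Evaluation of the quasi-shuffle algebra over `K(n)[x]` in the ring of sequences. -/
def tauTensor (K : Type*) [Field K] [CharZero K] (H : Alphabet) :
    RatAlt K ⊗[K] QSh K H →ₐ[K] SeqRing K :=
  Algebra.TensorProduct.productMap
    { tauRatAlt K with
      commutes' := fun c => by
        have : algebraMap K (RatAlt K) c = RatAlt.ofRat K (RatFunc.C c) := rfl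
        change tauRatAlt K _ = _
        rw [this, tauRatAlt, AdjoinRoot.lift_of, algebraMap_seq]
        exact toSeq_eq (Filter.Eventually.of_forall fun k => evRat_C c k) }
    { toFun := fun q => toSeq (sumHom K H q)
      map_one' := by rw [map_one]; rfl
      map_zero' := by rw [map_zero]; rfl
      map_mul' := fun f g => by rw [map_mul]; rfl
      map_add' := fun f g => by rw [map_add]; rfl
      commutes' := fun c => by
        rw [AlgHom.commutes, algebraMap_seq]
        rfl }

/-- The evaluation of the naive ring: elements of `K(n)[x]` are evaluated at the natural numbers
and the variables are replaced by the corresponding nested sums. -/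
def tauNaive (K : Type*) [Field K] [CharZero K] (H : Alphabet) (d : ℕ) :
    NaiveRing K H d →+* SeqRing K :=
  MvPolynomial.eval₂Hom (tauRatAlt K) fun v => toSeq (nestedSum v.1)

theorem tauNaive_eq (d : ℕ) (f : NaiveRing K H d) :
    tauNaive K H d f = tauTensor K H (linearize K H d f) := by
  have : tauNaive K H d =
      ((tauTensor K H : RatAlt K ⊗[K] QSh K H →ₐ[K] SeqRing K) :
        RatAlt K ⊗[K] QSh K H →+* SeqRing K).comp
        (linearize K H d : NaiveRing K H d →+* RatAlt K ⊗[K] QSh K H) := by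
    refine MvPolynomial.ringHom_ext (fun r => ?_) fun v => ?_
    · have e1 : linearize K H d (MvPolynomial.C r) = r ⊗ₜ 1 := by simp [linearize]
      change _ = tauTensor K H (linearize K H d (MvPolynomial.C r))
      rw [e1, tauTensor, Algebra.TensorProduct.productMap_apply_tmul, map_one, mul_one]
      simp [tauNaive]
    · have e1 : linearize K H d (MvPolynomial.X v) = 1 ⊗ₜ QSh.word v.1 := by simp [linearize]
      have e2 : sumHom K H (QSh.word v.1) = nestedSum v.1 := QSh.liftWord_word _ _ _ _
      change _ = tauTensor K H (linearize K H d (MvPolynomial.X v))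
      rw [e1, tauTensor, Algebra.TensorProduct.productMap_apply_tmul, map_one, one_mul]
      change _ = toSeq (sumHom K H (QSh.word v.1))
      rw [e2]
      simp [tauNaive]
  exact RingHom.congr_fun this f

/-- The evaluation map `τ` from the reduced ring `E_d` to the ring of sequences. -/
def tau (K : Type*) [Field K] [CharZero K] (H : Alphabet) (d : ℕ) :
    ReducedRing K H d →+* SeqRing K :=
  Ideal.Quotient.lift (relIdeal K H d) (tauNaive K H d) fun f hf => by
    have hf0 : linearize K H d f = 0 := hf
    rw [tauNaive_eq, hf0, map_zero]

end Evaluation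

/-! ## Basis sums and `Σ*`-extensions -/

section Basis

variable (K : Type*) [Field K] [CharZero K] (H : Alphabet)

/-- The linear relations among the sums of weight `d` modulo sums of smaller weight and products:
the span of the weight `d` parts of `L(p)`, where `p` runs through the products of at least two sums
whose weights add up to `d`. -/
def relSpace (d : ℕ) : Submodule K (QSh K H) :=
  Submodule.span K {f | ∃ p : List (Word K H), 2 ≤ p.length ∧ (∀ w ∈ p, w ≠ []) ∧
    (p.map weight).sum = d ∧ f = QSh.weightPart d (p.map QSh.word).prod}

variable {K H}

/-- A word `w` is reducible with respect to an ordering `r` of the words if it is the position of a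
corner of the reduced row echelon form of the relations of its weight, the columns being ordered
by `r`: there is a relation whose first word with nonzero coefficient is `w`. -/
def IsReducible (r : Word K H → Word K H → Prop) (w : Word K H) : Prop :=
  ∃ f ∈ relSpace K H (weight w), f.coeff w ≠ 0 ∧ ∀ v, f.coeff v ≠ 0 → v = w ∨ r w v

/-- The basis sums of weight at most `d` with respect to `r`: the sums that are not reducible. -/
def basisSums (r : Word K H → Word K H → Prop) (d : ℕ) : Set (SumVar K H d) :=
  {v | ¬ IsReducible r v.1}

end Basis

/-- The difference ring `(E, σ)` is a (nested) `Σ*`-extension of the difference ring `(A, σA)` by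
the generators `t 0, …, t (m - 1)`: it is a difference ring extension by means of `ι`,
`E = A[t 0]…[t (m - 1)]`, and, with `A_i = A[t 0]…[t (i - 1)]`, for every `i` the element `t i` is
transcendental over `A_i`, `σ (t i) - t i` lies in `A_i`, and the constants of `A_i[t i]` are those
of `A_i`. -/
structure IsSigmaStarExtension {A E : Type*} [CommRing A] [CommRing E]
    (σA : A ≃+* A) (σ : E ≃+* E) (ι : A →+* E) {m : ℕ} (t : Fin m → E) : Prop where
  injective : Function.Injective ι
  comm : ∀ a, σ (ι a) = ι (σA a)
  generates : Subring.closure (Set.range ι ∪ Set.range t) = ⊤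
  transcendental : ∀ i, Transcendental (Subring.closure (Set.range ι ∪ t '' Set.Iio i)) (t i)
  shift_sub : ∀ i, σ (t i) - t i ∈ Subring.closure (Set.range ι ∪ t '' Set.Iio i)
  const : ∀ i, {c | c ∈ Subring.closure (Set.range ι ∪ t '' Set.Iic i) ∧ σ c = c} =
    {c | c ∈ Subring.closure (Set.range ι ∪ t '' Set.Iio i) ∧ σ c = c}

end HarmonicSums

end

open HarmonicSums

noncomputable section

open Polynomial TensorProduct

namespace HarmonicSums

/-! ## Rational functions: poles, constants and telescoping -/

section Poles

variable {K : Type*} [Field K]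

/-! By the choice of I_d, the linearization embeds E_d into T = K(n)[x] ⊗ K⟨H⟩, on which shift and
evaluation are given by `shiftTensor` and `tauTensor`. All assertions are proved in T and pulled
back; they rest on two independent facts.

Constants. The shift of a word w is w plus multiples of proper suffixes. If f is invariant, its
coefficients at the longest words are invariant in K(n)[x], hence in K; comparing coefficients one
length lower shows that a K-combination of letters telescopes in K(n)[x]. This is impossible for a
nonzero combination (`eq_zero_of_barLin_telescopes`): the poles -b/a lie in (-1, 0] and so are
pairwise incongruent modulo the integers, whereas a telescoping difference with a pole has at least
two poles in one class. Hence the constants of T are K (`eq_smul_one_of_shiftTensor_eq`), and no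
generator can add a constant. Normalizing a leading coefficient and subtracting the shift then shows
that a nonzero shift-closed ideal of T contains 1 (`one_mem_of_shift_closed`). The kernel of the
evaluation is shift-closed and proper, so it is zero.

Structure. K⟨H⟩ is a polynomial ring in the irreducible words. They generate, because a relation
with pivot w expresses w by later words of the same weight, products and lighter words
(`word_mem_irreducibleAdjoin`). They are independent for the following reason. To an irreducible
word belongs a functional φ that vanishes on products and on the other irreducible words. The map D
sending w to the sum of φ(v) u over all splittings w = u v with v nonempty is a derivation up to
lower weight, and acts on the top weight part of a polynomial in the words as a partial derivative.
In characteristic 0 repeated differentiation excludes a relation (`algebraicIndependent_word`).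
Lower weight terms cannot be avoided: a partial fraction decomposition of a product of letters
lowers degrees, so the weight only filters K⟨H⟩.

Base change from K to K(n)[x] gives transcendence of the generators, and listing them by weight puts
σ(t) - t into the ring generated by the earlier ones. -/

theorem shiftRat_algebraMap (p : K[X]) :
    shiftRat K (algebraMap K[X] (RatFunc K) p) = algebraMap K[X] (RatFunc K) (p.comp (X + C 1)) := by
  rw [shiftRat, IsFractionRing.ringEquivOfRingEquiv_algebraMap]
  simp [Polynomial.aeval_def, Polynomial.comp]

/-- The rational functions without a pole at the element `α` of the coefficient field. -/
def regularSubring (α : K) : Subring (RatFunc K) where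
  carrier := {f | ∃ p q : K[X], q.eval α ≠ 0 ∧
    f * algebraMap K[X] (RatFunc K) q = algebraMap K[X] (RatFunc K) p}
  mul_mem' := by
    rintro f g ⟨p, q, h, e⟩ ⟨p', q', h', e'⟩
    refine ⟨p * p', q * q', by simp [h, h'], ?_⟩
    rw [map_mul, map_mul, ← e, ← e']
    ring
  add_mem' := by
    rintro f g ⟨p, q, h, e⟩ ⟨p', q', h', e'⟩
    refine ⟨p * q' + p' * q, q * q', by simp [h, h'], ?_⟩
    rw [map_mul, map_add, map_mul, map_mul, ← e, ← e']
    ring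
  one_mem' := ⟨1, 1, by simp, by simp⟩
  zero_mem' := ⟨0, 1, by simp, by simp⟩
  neg_mem' := by
    rintro f ⟨p, q, h, e⟩
    exact ⟨-p, q, h, by rw [map_neg, ← e, neg_mul]⟩

theorem algebraMap_mem_regularSubring (α : K) (p : K[X]) :
    algebraMap K[X] (RatFunc K) p ∈ regularSubring α := ⟨p, 1, by simp, by simp⟩

theorem smul_mem_regularSubring {α : K} (c : K) {f : RatFunc K} (hf : f ∈ regularSubring α) :
    c • f ∈ regularSubring α := by
  rw [Algebra.smul_def]
  exact mul_mem (algebraMap_mem_regularSubring α (C c)) hf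

/-- Substituting n + 1 for n moves every pole one step to the left. -/
theorem shiftRat_mem_regularSubring {α : K} {f : RatFunc K} :
    shiftRat K f ∈ regularSubring α ↔ f ∈ regularSubring (α + 1) := by
  constructor
  · rintro ⟨p, q, h, e⟩
    have inv : ∀ p : K[X], (p.comp (X - C 1)).comp (X + C 1) = p := fun p => by
      simp [comp_assoc]
    refine ⟨p.comp (X - C 1), q.comp (X - C 1), by simpa using h, (shiftRat K).injective ?_⟩
    rw [map_mul, shiftRat_algebraMap, shiftRat_algebraMap, inv, inv, e]
  · rintro ⟨p, q, h, e⟩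
    refine ⟨p.comp (X + C 1), q.comp (X + C 1), by simpa using h, ?_⟩
    rw [← shiftRat_algebraMap, ← map_mul, e, shiftRat_algebraMap]

theorem mul_denom_eq_num (g : RatFunc K) : g * algebraMap K[X] (RatFunc K) g.denom =
    algebraMap K[X] (RatFunc K) g.num := by
  have h0 : algebraMap K[X] (RatFunc K) g.denom ≠ 0 := by
    simpa using RatFunc.denom_ne_zero g
  rw [← eq_div_iff h0, RatFunc.num_div_denom]

/-- The poles are roots of the denominator, and in characteristic 0 the points α + k are distinct.
Finiteness allows the first and the last pole in a class modulo the integers to be chosen. -/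
theorem finite_poles [CharZero K] (g : RatFunc K) (α : K) :
    {k : ℤ | g ∉ regularSubring (α + k)}.Finite := by
  classical
  have h1 := (g.denom.roots.toFinset.finite_toSet).preimage (f := fun k : ℤ => α + (k : K))
    (fun a _ b _ h => by simpa using h)
  refine h1.subset fun k hk => ?_
  by_contra h
  refine hk ⟨g.num, g.denom, ?_, ?_⟩
  · simpa [RatFunc.denom_ne_zero] using h
  · exact mul_denom_eq_num g

/-- A polynomial in `1 / (n - α)` without a pole at `α` is constant. -/
theorem natDegree_eq_zero_of_regular {α : K} {u : RatFunc K}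
    (hu : u * algebraMap K[X] (RatFunc K) (X - C α) = 1) (P : K[X])
    (h : aeval u P ∈ regularSubring α) : P.natDegree = 0 := by
  obtain ⟨p, q, hq, e⟩ := h
  by_contra hN
  set N := P.natDegree with hNdef
  set y := algebraMap K[X] (RatFunc K) (X - C α) with hy
  let _ : Invertible y := ⟨u, hu, by rw [mul_comm, hu]⟩
  -- Multiplying P(1/y) by y ^ N reverses the coefficients. At y = 0, that is at n = α, the reversed
  -- polynomial yields the leading coefficient of P, while regularity makes the product vanish for N
  -- > 0.
  have hrefl : aeval u P * y ^ N = aeval y (reflect N P) := by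
    have := eval₂_reflect_mul_pow (algebraMap K (RatFunc K)) y N (reflect N P) (by
      rw [natDegree_le_iff_coeff_eq_zero]
      intro m hm
      rw [coeff_reflect, revAt_eq_self_of_lt hm]
      exact coeff_eq_zero_of_natDegree_lt hm)
    have hr : reflect N (reflect N P) = P := by
      ext i; rw [coeff_reflect, coeff_reflect, revAt_invol]
    rw [hr] at this
    exact this
  have e1 : algebraMap K[X] (RatFunc K) (p * (X - C α) ^ N) =
      algebraMap K[X] (RatFunc K) ((reflect N P).comp (X - C α) * q) := by
    have e2 : algebraMap K[X] (RatFunc K) ((reflect N P).comp (X - C α)) =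
        aeval y (reflect N P) := by
      rw [comp_eq_aeval, hy]
      exact (aeval_algebraMap_apply (RatFunc K) (X - C α) (reflect N P)).symm
    rw [map_mul, map_mul, e2, ← hrefl, ← e, map_pow]
    ring
  have e3 := congrArg (eval α) (RatFunc.algebraMap_injective K e1)
  have hlc : (reflect N P).coeff 0 = P.leadingCoeff := by
    rw [coeff_reflect, revAt_le (Nat.zero_le _)]; rw [Nat.sub_zero]; rfl
  have hP : P ≠ 0 := by rintro rfl; simp [hNdef] at hN
  simp only [eval_mul, eval_pow, eval_sub, eval_X, eval_C, sub_self, eval_comp, zero_pow hN,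
    mul_zero, ← coeff_zero_eq_eval_zero, hlc] at e3
  rcases mul_eq_zero.1 e3.symm with h0 | h0
  · exact hP (leadingCoeff_eq_zero.1 h0)
  · exact hq h0

theorem evRat_algebraMap (p : K[X]) (k : ℕ) :
    evRat (algebraMap K[X] (RatFunc K) p) k = p.eval (k : K) := by
  simp [evRat, RatFunc.eval]

theorem evRat_mul_eval {f : RatFunc K} {p q : K[X]} {k : ℕ} (hf : f ∈ regularAt K k)
    (e : f * algebraMap K[X] (RatFunc K) q = algebraMap K[X] (RatFunc K) p) :
    evRat f k * q.eval (k : K) = p.eval (k : K) := by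
  have hq : algebraMap K[X] (RatFunc K) q ∈ regularAt K k := by
    change (algebraMap K[X] (RatFunc K) q).denom.eval (k : K) ≠ 0
    simp
  rw [← evRat_algebraMap q, ← evRat_mul hf hq, e, evRat_algebraMap]

/-- Values are defined through reduced fractions, and the shifted numerator and denominator of f
need not be the chosen ones for the shifted function. Both values are therefore compared with that
one fraction, whose denominator is cancelled where it does not vanish. -/
theorem eventually_evRat_shiftRat [CharZero K] (f : RatFunc K) :
    ∀ᶠ k in Filter.atTop, evRat (shiftRat K f) k = evRat f (k + 1) := by
  filter_upwards [eventually_regularAt (shiftRat K f),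
    (Filter.tendsto_add_atTop_nat 1).eventually (eventually_regularAt f)] with k h1 h2
  have e := congrArg (shiftRat K) (mul_denom_eq_num f)
  rw [map_mul, shiftRat_algebraMap, shiftRat_algebraMap] at e
  have e1 := evRat_mul_eval h1 e
  have e2 := evRat_mul_eval h2 (mul_denom_eq_num f)
  simp only [eval_comp, eval_add, eval_X, eval_C] at e1
  have h3 : f.denom.eval ((k : K) + 1) ≠ 0 := by
    have : f.denom.eval ((k + 1 : ℕ) : K) ≠ 0 := h2
    simpa using this
  push_cast at e2
  exact mul_right_cancel₀ h3 (e1.trans e2.symm)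

theorem tauRat_shiftRat [CharZero K] (f : RatFunc K) :
    tauRat K (shiftRat K f) = shiftSeq K (tauRat K f) :=
  toSeq_eq (eventually_evRat_shiftRat f)

/-- A rational function `g` with `g(n + 1) = ε g(n)` and `ε ^ 2 = 1` is a constant. -/
theorem eq_C_of_shiftRat_eq [CharZero K] {ε : K} (hε : ε ^ 2 = 1) {g : RatFunc K}
    (h : shiftRat K g = RatFunc.C ε * g) : ∃ c : K, g = RatFunc.C c := by
  obtain ⟨k₀, hk₀⟩ := Filter.eventually_atTop.1
    ((eventually_evRat_shiftRat g).and (eventually_regularAt g))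
  have h1 : ∀ k, k₀ ≤ k → evRat g (k + 1) = ε * evRat g k := fun k hk => by
    rw [← (hk₀ k hk).1, h, evRat_mul (C_mem_regularAt _ _) (hk₀ k hk).2, evRat_C]
  have h2 : ∀ j, evRat g (k₀ + 2 * j) = evRat g k₀ := by
    intro j
    induction j with
    | zero => rfl
    | succ j ih =>
      rw [show k₀ + 2 * (j + 1) = k₀ + 2 * j + 1 + 1 by ring, h1 _ (by omega), h1 _ (by omega), ih,
        ← mul_assoc, ← pow_two, hε, one_mul]
  refine ⟨evRat g k₀, ?_⟩
  have h3 : g.num - C (evRat g k₀) * g.denom = 0 := by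
    refine eq_zero_of_infinite_isRoot _ (Set.infinite_of_injective_forall_mem
      (f := fun j : ℕ => ((k₀ + 2 * j : ℕ) : K)) (fun a b hab => ?_) fun j => ?_)
    · have : k₀ + 2 * a = k₀ + 2 * b := Nat.cast_injective (R := K) hab
      omega
    · have := evRat_mul_eval (hk₀ (k₀ + 2 * j) (by omega)).2 (mul_denom_eq_num g)
      rw [h2] at this
      change eval _ _ = 0
      rw [eval_sub, eval_mul, eval_C, this, sub_self]
  have h0 : algebraMap K[X] (RatFunc K) g.denom ≠ 0 := by
    simpa using RatFunc.denom_ne_zero g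
  refine mul_right_cancel₀ h0 ?_
  rw [mul_denom_eq_num, sub_eq_zero.1 h3, map_mul]
  rfl

end Poles

/-! ### Combinations of letters do not telescope over K(n) -/

section Telescoping

variable {K : Type*} [Field K] [CharZero K] {H : Alphabet}

/-- The pole of a letter. -/
def Letter.pole (l : Letter K) : K := -((l.b : K) / l.a)

theorem Letter.inv_mul_pole (l : Letter K) :
    (algebraMap K[X] (RatFunc K) (X + C ((l.b : K) / l.a)))⁻¹ *
      algebraMap K[X] (RatFunc K) (X - C l.pole) = 1 := by
  rw [Letter.pole, C_neg, sub_neg_eq_add]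
  refine inv_mul_cancel₀ ?_
  rw [Ne, map_eq_zero_iff _ (RatFunc.algebraMap_injective K)]
  exact (monic_X_add_C _).ne_zero

theorem letterRat_mem_regularSubring (l : Letter K) {α : K} (h : α ≠ l.pole) :
    letterRat l ∈ regularSubring α := by
  rw [letterRat_eq]
  refine smul_mem_regularSubring _ (pow_mem ?_ _)
  exact ⟨1, X - C l.pole, by simpa [sub_eq_zero] using h, by rw [l.inv_mul_pole, map_one]⟩

/-- The poles of the letters are pairwise incongruent modulo the integers. -/
theorem Letter.eq_zero_of_pole_add_eq (l m : Letter K) {k : ℤ} (h : l.pole + k = m.pole) :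
    k = 0 := by
  have ha : (l.a : K) ≠ 0 := by exact_mod_cast l.a_pos.ne'
  have hb : (m.a : K) ≠ 0 := by exact_mod_cast m.a_pos.ne'
  rw [Letter.pole, Letter.pole] at h
  field_simp at h
  have e : ((-l.b + l.a * k) * m.a : ℤ) = -(l.a * m.b : ℤ) := by
    have : (((-l.b + l.a * k) * m.a : ℤ) : K) = ((-(l.a * m.b : ℤ) : ℤ) : K) := by
      push_cast
      linear_combination h
    exact_mod_cast this
  have l1 : (l.b : ℤ) < l.a := by exact_mod_cast l.b_lt_a
  have l2 : (m.b : ℤ) < m.a := by exact_mod_cast m.b_lt_a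
  have l3 : (0 : ℤ) ≤ l.b := by positivity
  have l4 : (0 : ℤ) ≤ m.b := by positivity
  have hlm : (0 : ℤ) < l.a * m.a := mul_pos (by linarith) (by linarith)
  -- Here k is a difference of two fractions in [0, 1), so it lies strictly between -1 and 1; both
  -- bounds are stated after multiplication by the denominators.
  have u1 : (l.a * m.a : ℤ) * k < l.a * m.a * 1 := by nlinarith
  have u2 : (l.a * m.a : ℤ) * (-1) < l.a * m.a * k := by nlinarith
  have := lt_of_mul_lt_mul_left u1 hlm.le
  have := lt_of_mul_lt_mul_left u2 hlm.le
  omega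

/-- A linear combination of letters with fixed `z` that telescopes has no poles. -/
theorem sum_mem_regularSubring_of_telescoping {ε : K} (hε : ε ≠ 0) (s : Finset (Ltr K H))
    (c : Ltr K H → K) (g : RatFunc K)
    (h : shiftRat K (∑ l ∈ s, c l • letterRat l.1) = g - RatFunc.C ε * shiftRat K g)
    (m : Letter K) : ∑ l ∈ s, c l • letterRat l.1 ∈ regularSubring m.pole := by
  classical
  set q := ∑ l ∈ s, c l • letterRat l.1 with hq
  by_contra hm
  have hreg : ∀ k : ℤ, q ∉ regularSubring (m.pole + k) → k = 0 := by
    intro k hk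
    by_contra h0
    refine hk (sum_mem fun l _ => smul_mem_regularSubring _ (letterRat_mem_regularSubring _ ?_))
    exact fun e => h0 (Letter.eq_zero_of_pole_add_eq _ _ e)
  have hC : ∀ {α : K} (δ : K) {f : RatFunc K}, f ∈ regularSubring α →
      RatFunc.C δ * f ∈ regularSubring α := fun δ f hf =>
    mul_mem (algebraMap_mem_regularSubring _ (C δ)) hf
  have hs : ∀ (k : ℤ) (f : RatFunc K), shiftRat K f ∈ regularSubring (m.pole + k) ↔
      f ∈ regularSubring (m.pole + (k + 1 : ℤ)) := fun k f => by
    rw [shiftRat_mem_regularSubring]; push_cast; rw [add_assoc]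
  set T := (finite_poles g m.pole).toFinset with hT
  have memT : ∀ k : ℤ, k ∈ T ↔ g ∉ regularSubring (m.pole + k) := fun k => by simp [hT]
  -- Without poles of g in the class of the letter m, the equation would make q regular at the pole
  -- of m.
  have hne : T.Nonempty := by
    by_contra hempty
    rw [Finset.not_nonempty_iff_eq_empty] at hempty
    have hall : ∀ k : ℤ, g ∈ regularSubring (m.pole + k) := fun k => by
      by_contra hk; rw [← memT, hempty] at hk; simp at hk
    refine hm ?_
    have := (hs (-1) q).1 (by
      rw [h]; exact sub_mem (hall _) (hC ε ((hs _ _).2 (hall _))))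
    simpa using this
  have hmax := T.max'_mem hne
  have hmin := T.min'_mem hne
  -- At the last pole of g the term g(n + 1) is regular, so q(n + 1) has a pole there. This is a
  -- pole of q at max + 1, and within this class q can only have one at 0.
  have e1 : T.max' hne + 1 = 0 := by
    refine hreg _ fun hreg' => (memT _).1 hmax ?_
    have h2 : g ∈ regularSubring (m.pole + (T.max' hne + 1 : ℤ)) := by
      by_contra hk
      have := T.le_max' _ ((memT _).2 hk)
      omega
    have : g = shiftRat K q + RatFunc.C ε * shiftRat K g := by rw [h]; ring
    rw [this]
    exact add_mem ((hs _ _).2 hreg') (hC ε ((hs _ _).2 h2))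
  -- One step before the first pole of g only g(n + 1) has a pole, so q has a pole at min. Then min
  -- = 0, against max = -1.
  have e2 : T.min' hne = 0 := by
    refine hreg _ fun hreg' => (memT _).1 hmin ?_
    have h2 : g ∈ regularSubring (m.pole + (T.min' hne - 1 : ℤ)) := by
      by_contra hk
      have := T.min'_le _ ((memT _).2 hk)
      omega
    have hsh : ∀ f : RatFunc K, shiftRat K f ∈ regularSubring (m.pole + (T.min' hne - 1 : ℤ)) ↔
      f ∈ regularSubring (m.pole + T.min' hne) := fun f => by
        rw [hs, sub_add_cancel]
    rw [← hsh]
    have : shiftRat K g = RatFunc.C ε⁻¹ * (g - shiftRat K q) := by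
      rw [h, sub_sub_cancel, ← mul_assoc, ← map_mul, inv_mul_cancel₀ hε, map_one, one_mul]
    rw [this]
    exact hC _ (sub_mem h2 ((hsh _).2 hreg'))
  have := T.min'_le_max' hne
  omega

/-- Since z is fixed, the letters with the pole α of a given m differ only in their degree. Their
sum is a polynomial without constant term in 1 / (n - α), and all other letters are regular at α;
absence of a pole thus forces the coefficients to vanish. -/
theorem coeff_eq_zero_of_telescoping {ε : K} (hε : ε ≠ 0) (s : Finset (Ltr K H))
    (c : Ltr K H → K) (g : RatFunc K) {z : K} (hz : ∀ l ∈ s, l.1.z = z)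
    (h : shiftRat K (∑ l ∈ s, c l • letterRat l.1) = g - RatFunc.C ε * shiftRat K g) :
    ∀ l ∈ s, c l = 0 := by
  classical
  intro m hm
  have hreg := sum_mem_regularSubring_of_telescoping hε s c g h m.1
  rw [← Finset.sum_filter_add_sum_filter_not s (fun l => l.1.a = m.1.a ∧ l.1.b = m.1.b)] at hreg
  have hreg2 : ∑ l ∈ s.filter (fun l => ¬ (l.1.a = m.1.a ∧ l.1.b = m.1.b)), c l • letterRat l.1 ∈
      regularSubring m.1.pole := by
    refine sum_mem fun l hl => smul_mem_regularSubring _ (letterRat_mem_regularSubring _ fun e => ?_)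
    exact (Finset.mem_filter.1 hl).2 (ext_of_pole l.1 m.1 (neg_injective e.symm))
  have hreg3 := sub_mem hreg hreg2
  rw [add_sub_cancel_right] at hreg3
  set P : K[X] := ∑ l ∈ s.filter (fun l => l.1.a = m.1.a ∧ l.1.b = m.1.b),
    monomial l.1.c (c l * ((l.1.a : K) ^ l.1.c)⁻¹) with hP
  have hPe : aeval ((algebraMap K[X] (RatFunc K) (X + C ((m.1.b : K) / m.1.a)))⁻¹) P =
      ∑ l ∈ s.filter (fun l => l.1.a = m.1.a ∧ l.1.b = m.1.b), c l • letterRat l.1 := by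
    rw [hP, map_sum]
    refine Finset.sum_congr rfl fun l hl => ?_
    obtain ⟨h1, h2⟩ := (Finset.mem_filter.1 hl).2
    rw [letterRat_eq, aeval_monomial, Nat.sub_add_cancel l.1.c_pos, ← Algebra.smul_def, smul_smul,
      h1, h2]
  rw [← hPe] at hreg3
  have hdeg := natDegree_eq_zero_of_regular m.1.inv_mul_pole P hreg3
  have hco : P.coeff m.1.c = c m * ((m.1.a : K) ^ m.1.c)⁻¹ := by
    rw [hP, finsetSum_coeff, Finset.sum_eq_single m]
    · simp
    · intro l hl hlm
      rw [coeff_monomial, if_neg]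
      intro hc
      obtain ⟨h1, h2⟩ := (Finset.mem_filter.1 hl).2
      exact hlm (Subtype.ext (Letter.ext h1 h2 hc
        ((hz l (Finset.mem_filter.1 hl).1).trans (hz m hm).symm)))
    · intro hm'
      exact absurd (Finset.mem_filter.2 ⟨hm, rfl, rfl⟩) hm'
  rw [coeff_eq_zero_of_natDegree_lt (by rw [hdeg]; exact m.1.c_pos)] at hco
  have ha : (m.1.a : K) ≠ 0 := by exact_mod_cast m.1.a_pos.ne'
  exact (mul_eq_zero.1 hco.symm).resolve_right (inv_ne_zero (pow_ne_zero _ ha))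

end Telescoping

/-! ### The shift on K(n)[x] through its two components -/

section RatAltShift

variable {K : Type*} [Field K]

theorem RatAlt.exists_eq (f : RatAlt K) :
    ∃ a b : RatFunc K, f = RatAlt.ofRat K a + RatAlt.ofRat K b * RatAlt.alt K := by
  induction f using AdjoinRoot.induction_on with
  | ih p =>
    induction p using Polynomial.induction_on' with
    | add p q hp hq =>
      obtain ⟨a, b, e⟩ := hp
      obtain ⟨a', b', e'⟩ := hq
      exact ⟨a + a', b + b', by rw [map_add, e, e', map_add, map_add]; ring⟩
    | monomial n a =>
      have e : AdjoinRoot.mk (X ^ 2 - 1 : (RatFunc K)[X]) (monomial n a) =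
          RatAlt.ofRat K a * RatAlt.alt K ^ n := by
        rw [← C_mul_X_pow_eq_monomial, map_mul, map_pow]
        rfl
      have h2 : RatAlt.alt K ^ 2 = 1 := by rw [pow_two, alt_mul_alt]
      rcases Nat.even_or_odd' n with ⟨k, rfl | rfl⟩
      · exact ⟨a, 0, by rw [e, pow_mul, h2]; simp⟩
      · exact ⟨0, a, by rw [e, pow_succ (RatAlt.alt K), pow_mul, h2]; simp⟩

theorem shiftRatAlt_ofRat (a : RatFunc K) :
    shiftRatAlt K (RatAlt.ofRat K a) = RatAlt.ofRat K (shiftRat K a) := by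
  simp [shiftRatAlt]

theorem shiftRatAlt_alt : shiftRatAlt K (RatAlt.alt K) = -RatAlt.alt K := by
  simp [shiftRatAlt, RatAlt.alt]

/-- The components at x = 1 and x = -1 identify K(n)[x] with K(n) × K(n). As σ(x) = -x, the shift
interchanges them while shifting each. -/
theorem projRat_shiftRatAlt (k : ℕ) (f : RatAlt K) :
    projRat K k (shiftRatAlt K f) = shiftRat K (projRat K (k + 1) f) := by
  obtain ⟨a, b, rfl⟩ := f.exists_eq
  simp only [map_add, map_mul, shiftRatAlt_ofRat, shiftRatAlt_alt, projRat_ofRat, map_neg,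
    projRat_alt, map_pow, map_one]
  ring

theorem projRat_two (f : RatAlt K) : projRat K 2 f = projRat K 0 f := by
  obtain ⟨a, b, rfl⟩ := f.exists_eq
  simp [projRat_ofRat, projRat_alt]

variable [CharZero K]

theorem two_ne_zero_ratFunc : (2 : RatFunc K) ≠ 0 := by
  have : (2 : RatFunc K) = RatFunc.C 2 := (map_ofNat RatFunc.C 2).symm
  rw [this, _root_.map_ne_zero]; norm_num

theorem RatAlt.ext_projRat {f g : RatAlt K} (h0 : projRat K 0 f = projRat K 0 g)
    (h1 : projRat K 1 f = projRat K 1 g) : f = g := by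
  obtain ⟨a, b, rfl⟩ := f.exists_eq
  obtain ⟨c, d, rfl⟩ := g.exists_eq
  simp only [map_add, map_mul, projRat_ofRat, projRat_alt, pow_zero, pow_one, mul_one] at h0 h1
  have e1 : a = c := mul_left_cancel₀ two_ne_zero_ratFunc (by linear_combination h0 + h1)
  have e2 : b = d := by linear_combination h0 - e1
  rw [e1, e2]

/-- The idempotents (1 + x) / 2 and (1 - x) / 2 realize any pair of components; together with
`RatAlt.ext_projRat` this gives the splitting. -/
theorem RatAlt.exists_projRat_eq (u v : RatFunc K) :
    ∃ f : RatAlt K, projRat K 0 f = u ∧ projRat K 1 f = v := by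
  refine ⟨RatAlt.ofRat K ((u + v) / 2) + RatAlt.ofRat K ((u - v) / 2) * RatAlt.alt K, ?_, ?_⟩ <;>
  · simp only [map_add, map_mul, projRat_ofRat, projRat_alt, pow_zero, pow_one, mul_one]
    have := two_ne_zero_ratFunc (K := K)
    field_simp
    ring

/-- The constants of `K(n)[x]` are the elements of `K`. -/
theorem RatAlt.eq_algebraMap_of_shift_eq {f : RatAlt K} (h : shiftRatAlt K f = f) :
    ∃ c : K, f = algebraMap K (RatAlt K) c := by
  have h0 := projRat_shiftRatAlt 0 f
  have h1 := projRat_shiftRatAlt 1 f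
  rw [h] at h0 h1
  rw [projRat_two] at h1
  simp only [zero_add] at h0
  -- The shift interchanges the components of an invariant element, so their sum is invariant and
  -- their difference changes sign; both lie in K. An element of K that changes sign is zero, hence
  -- the components agree.
  obtain ⟨c, hc⟩ := eq_C_of_shiftRat_eq (K := K) (ε := 1) (by norm_num)
    (g := projRat K 0 f + projRat K 1 f) (by rw [map_add, ← h0, ← h1]; simp [add_comm])
  obtain ⟨d, hd⟩ := eq_C_of_shiftRat_eq (K := K) (ε := -1) (by norm_num)
    (g := projRat K 0 f - projRat K 1 f) (by rw [map_sub, ← h0, ← h1]; simp)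
  have e : RatFunc.C d = -RatFunc.C d := by
    conv_lhs => rw [← shiftRat_C, ← hd, map_sub, ← h0, ← h1]
    rw [← hd]; ring
  have hd0 : RatFunc.C d = 0 :=
    mul_left_cancel₀ two_ne_zero_ratFunc (by linear_combination e)
  have hC : ∀ k c, projRat K k (algebraMap K (RatAlt K) c) = RatFunc.C c := fun k c =>
    projRat_ofRat k (RatFunc.C c)
  have h2 : (RatFunc.C (c / 2) : RatFunc K) * 2 = RatFunc.C c := by
    rw [← map_ofNat (RatFunc.C : K →+* RatFunc K) 2, ← map_mul]
    congr 1
    field_simp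
  refine ⟨c / 2, RatAlt.ext_projRat ?_ ?_⟩ <;> rw [hC] <;>
    refine mul_left_cancel₀ two_ne_zero_ratFunc ?_
  · linear_combination hc + hd + hd0 - h2
  · linear_combination hc - hd - hd0 - h2

/-- `K(n)[x]` has no nontrivial ideals closed under the shift. -/
theorem RatAlt.exists_mul_add_mul_shift_eq_one {r : RatAlt K} (hr : r ≠ 0) :
    ∃ a b : RatAlt K, a * r + b * shiftRatAlt K r = 1 := by
  -- One nonzero component suffices: the shift carries it into the other place, so r is inverted in
  -- one component and σ(r) in the other.
  by_cases h0 : projRat K 0 r = 0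
  · have h1 : projRat K 1 r ≠ 0 := fun h1 =>
      hr (RatAlt.ext_projRat (by rw [h0, map_zero]) (by rw [h1, map_zero]))
    obtain ⟨a, ha, ha'⟩ := RatAlt.exists_projRat_eq (0 : RatFunc K) (projRat K 1 r)⁻¹
    obtain ⟨b, hb, hb'⟩ := RatAlt.exists_projRat_eq (shiftRat K (projRat K 1 r))⁻¹ (0 : RatFunc K)
    have h2 : shiftRat K (projRat K 1 r) ≠ 0 := by simpa using h1
    refine ⟨a, b, RatAlt.ext_projRat ?_ ?_⟩
    · rw [map_add, map_mul, map_mul, ha, hb, projRat_shiftRatAlt, map_one, zero_mul, zero_add,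
        inv_mul_cancel₀ h2]
    · rw [map_add, map_mul, map_mul, ha', hb', map_one, zero_mul, add_zero, inv_mul_cancel₀ h1]
  · obtain ⟨a, ha, ha'⟩ := RatAlt.exists_projRat_eq (projRat K 0 r)⁻¹ (0 : RatFunc K)
    obtain ⟨b, hb, hb'⟩ := RatAlt.exists_projRat_eq (0 : RatFunc K) (shiftRat K (projRat K 0 r))⁻¹
    have h2 : shiftRat K (projRat K 0 r) ≠ 0 := by simpa using h0
    refine ⟨a, b, RatAlt.ext_projRat ?_ ?_⟩
    · rw [map_add, map_mul, map_mul, ha, hb, map_one, zero_mul, add_zero, inv_mul_cancel₀ h0]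
    · rw [map_add, map_mul, map_mul, ha', hb', projRat_shiftRatAlt, projRat_two, map_one, zero_mul,
        zero_add, inv_mul_cancel₀ h2]

theorem projRat_barLin_eq_sum (H : Alphabet) (i : ℕ) (k : Ltr K H →₀ K) :
    projRat K i (barLin K H k) =
      ∑ l ∈ k.support, RatFunc.C (k l * l.1.z ^ i) * letterRat l.1 := by
  rw [barLin, Finsupp.linearCombination_apply, Finsupp.sum, map_sum]
  refine Finset.sum_congr rfl fun l _ => ?_
  have hs : k l • letterBar l.1 = RatAlt.ofRat K (RatFunc.C (k l)) * letterBar l.1 :=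
    Algebra.smul_def _ _
  have hne : (-1 : K) ≠ 1 := by norm_num
  rw [hs, map_mul, projRat_ofRat, letterBar, map_mul, projRat_ofRat, map_mul, mul_assoc]
  rcases sign_of_mem l with h | h
  · simp [h]
  · simp [h, hne, projRat_alt]

/-- No nontrivial linear combination of letters telescopes in `K(n)[x]`. -/
theorem eq_zero_of_barLin_telescopes (H : Alphabet) (k : Ltr K H →₀ K) (g : RatAlt K)
    (h : g = shiftRatAlt K g + shiftRatAlt K (barLin K H k)) : k = 0 := by
  classical
  have h0 := congrArg (projRat K 0) h
  have h1 := congrArg (projRat K 1) h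
  rw [map_add, projRat_shiftRatAlt, projRat_shiftRatAlt] at h0 h1
  rw [show 1 + 1 = 2 from rfl, projRat_two, projRat_two] at h1
  rw [zero_add] at h0
  set S : K → RatFunc K := fun z => ∑ l ∈ k.support.filter (fun l => l.1.z = z), k l • letterRat l.1
    with hS
  have hsplit : ∀ i : ℕ, projRat K i (barLin K H k) = S 1 + (-1) ^ i * S (-1) := by
    intro i
    have hne : ∀ z : K, (z = 1 ∨ z = -1) → (¬ z = 1 ↔ z = -1) := by
      have : (-1 : K) ≠ 1 := by norm_num
      rintro z (rfl | rfl) <;> simp [this, this.symm]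
    rw [projRat_barLin_eq_sum, ← Finset.sum_filter_add_sum_filter_not _ (fun l => l.1.z = 1)]
    congr 1
    · refine Finset.sum_congr rfl fun l hl => ?_
      rw [(Finset.mem_filter.1 hl).2, one_pow, mul_one, Algebra.smul_def]
      rfl
    · rw [Finset.mul_sum]
      refine Finset.sum_congr (Finset.filter_congr fun l _ => hne _ (sign_of_mem l)) fun l hl => ?_
      rw [(Finset.mem_filter.1 hl).2, Algebra.smul_def, map_mul, map_pow, map_neg, map_one]
      change _ = _ * (RatFunc.C (k l) * _)
      ring
  rw [hsplit] at h0 h1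
  simp only [pow_zero, pow_one, one_mul, neg_mul] at h0 h1
  rw [map_add] at h0 h1
  rw [map_neg] at h0
  have hmul : ∀ (c : K) (z : K), ∑ l ∈ k.support.filter (fun l => l.1.z = z),
      (c * k l) • letterRat l.1 = RatFunc.C c * S z := fun c z => by
    rw [hS, Finset.mul_sum]
    refine Finset.sum_congr rfl fun l _ => ?_
    rw [mul_smul, Algebra.smul_def]
    rfl
  -- Adding the two component equations leaves 2 S(1) with ε = 1; subtracting them leaves -2 S(-1)
  -- with ε = -1. This separates the letters by their sign.
  have r1 := coeff_eq_zero_of_telescoping (K := K) (ε := 1) one_ne_zero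
    (k.support.filter (fun l => l.1.z = 1)) (fun l => 2 * k l) (projRat K 0 g + projRat K 1 g)
    (fun l hl => (Finset.mem_filter.1 hl).2) (by
      rw [hmul, map_mul, shiftRat_C, map_add, map_ofNat, map_one]
      linear_combination -h0 - h1)
  have r2 := coeff_eq_zero_of_telescoping (K := K) (ε := -1) (by norm_num)
    (k.support.filter (fun l => l.1.z = -1)) (fun l => -2 * k l) (projRat K 0 g - projRat K 1 g)
    (fun l hl => (Finset.mem_filter.1 hl).2) (by
      rw [hmul, map_mul, shiftRat_C, map_sub, map_neg, map_ofNat, map_neg, map_one]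
      linear_combination h1 - h0)
  ext l
  by_contra hl
  have hl' := Finsupp.mem_support_iff.2 hl
  rcases sign_of_mem l with hz | hz
  · exact hl (by simpa using r1 l (Finset.mem_filter.2 ⟨hl', hz⟩))
  · exact hl (by simpa using r2 l (Finset.mem_filter.2 ⟨hl', hz⟩))

theorem tauRatAlt_shiftRatAlt (f : RatAlt K) :
    tauRatAlt K (shiftRatAlt K f) = shiftSeq K (tauRatAlt K f) := by
  obtain ⟨a, b, rfl⟩ := f.exists_eq
  have e1 : ∀ a, tauRatAlt K (RatAlt.ofRat K a) = tauRat K a := fun a => by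
    simp [tauRatAlt]
  have e2 : tauRatAlt K (RatAlt.alt K) = toSeq fun k => (-1) ^ k := by
    simp [tauRatAlt, RatAlt.alt]
  have e3 : shiftSeq K (toSeq fun k => (-1) ^ k) = -toSeq fun k => (-1) ^ k := by
    rw [shiftSeq_toSeq]
    exact toSeq_eq (t := fun k => -(-1) ^ k) (Filter.Eventually.of_forall fun k => by ring)
  simp only [map_add, map_mul, shiftRatAlt_ofRat, shiftRatAlt_alt, map_neg, e1, e2, e3,
    tauRat_shiftRat]

end RatAltShift

/-! ## Coordinates and constants of the quasi-shuffle algebra over `K(n)[x]` -/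

section Constants

variable {K : Type*} [Field K] [CharZero K] {H : Alphabet}

instance : Nontrivial (RatAlt K) := (projRat K 0).domain_nontrivial

theorem cons_left_injective {α : Type*} (u : List α) : Function.Injective fun l => l :: u :=
  fun _ _ h => (List.cons.inj h).1

theorem smul_eq_tmul_one_mul (r : RatAlt K) (f : RatAlt K ⊗[K] QSh K H) :
    r • f = (r ⊗ₜ 1) * f := by
  induction f using TensorProduct.induction_on with
  | zero => rw [smul_zero, mul_zero]
  | tmul a q => rw [TensorProduct.smul_tmul', Algebra.TensorProduct.tmul_mul_tmul, one_mul]; rfl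
  | add f g hf hg => rw [smul_add, hf, hg, mul_add]

/-- The basis of words of the quasi-shuffle algebra. -/
def wordBasis (K : Type*) [Field K] [CharZero K] (H : Alphabet) :
    Module.Basis (Word K H) K (QSh K H) :=
  Module.Basis.ofRepr (LinearEquiv.refl K (Word K H →₀ K) : QSh K H ≃ₗ[K] (Word K H →₀ K))

theorem wordBasis_apply (w : Word K H) : wordBasis K H w = QSh.word w := rfl

/-- The basis of words of the quasi-shuffle algebra over `K(n)[x]`. -/
def wordBasisRat (K : Type*) [Field K] [CharZero K] (H : Alphabet) :
    Module.Basis (Word K H) (RatAlt K) (RatAlt K ⊗[K] QSh K H) :=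
  Algebra.TensorProduct.basis (RatAlt K) (wordBasis K H)

theorem wordBasisRat_apply (w : Word K H) : wordBasisRat K H w = 1 ⊗ₜ QSh.word w := by
  rw [wordBasisRat, Algebra.TensorProduct.basis_apply, wordBasis_apply]

theorem wordBasisRat_nil : wordBasisRat K H [] = 1 := wordBasisRat_apply _

/-- The elements supported on words of length less than `N`. -/
def lengthLT (K : Type*) [Field K] [CharZero K] (H : Alphabet) (N : ℕ) :
    Submodule (RatAlt K) (RatAlt K ⊗[K] QSh K H) where
  carrier := {f | ∀ w, N ≤ w.length → (wordBasisRat K H).repr f w = 0}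
  add_mem' hf hg w hw := by rw [map_add, Finsupp.add_apply, hf w hw, hg w hw, add_zero]
  zero_mem' w _ := by simp
  smul_mem' r f hf w hw := by rw [map_smul, Finsupp.smul_apply, hf w hw, smul_zero]

theorem exists_mem_lengthLT (f : RatAlt K ⊗[K] QSh K H) : ∃ N, f ∈ lengthLT K H (N + 1) := by
  refine ⟨((wordBasisRat K H).repr f).support.sup List.length, fun w hw => ?_⟩
  by_contra h
  have := Finset.le_sup (f := List.length) (Finsupp.mem_support_iff.2 h)
  omega

theorem thetaFwd_cons (l : Ltr K H) (w : Word K H) :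
    thetaFwd (l :: w) = wordBasisRat K H (l :: w) + shiftRatAlt K (letterBar l.1) • thetaFwd w := by
  rw [thetaFwd, wordBasisRat_apply, smul_eq_tmul_one_mul]

/-- The shift of w is w plus multiples of proper suffixes, all of which are shorter than u. -/
theorem repr_thetaFwd (w u : Word K H) (h : w.length ≤ u.length) :
    (wordBasisRat K H).repr (thetaFwd w) u = Finsupp.single w 1 u := by
  induction w with
  | nil => rw [thetaFwd, ← wordBasisRat_nil, Module.Basis.repr_self]
  | cons l w ih =>
    simp only [List.length_cons] at h
    have h0 : Finsupp.single w (1 : RatAlt K) u = 0 :=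
      Finsupp.single_eq_of_ne (by rintro rfl; omega)
    rw [thetaFwd_cons, map_add, map_smul, Finsupp.add_apply, Module.Basis.repr_self,
      Finsupp.smul_apply, ih (by omega), h0, smul_zero, add_zero]

theorem shiftTensor_smul (r : RatAlt K) (f : RatAlt K ⊗[K] QSh K H) :
    shiftTensor (r • f) = shiftRatAlt K r • shiftTensor f := by
  rw [smul_eq_tmul_one_mul, map_mul, smul_eq_tmul_one_mul]
  congr 1
  simp [shiftTensor, shiftRatAltAlg]

theorem shiftTensor_wordBasisRat (w : Word K H) :
    shiftTensor (wordBasisRat K H w) = thetaFwd w := by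
  rw [wordBasisRat_apply, shiftTensor, Algebra.TensorProduct.productMap_apply_tmul, map_one, one_mul]
  exact QSh.liftWord_word _ _ _ _

theorem repr_shiftTensor (f : RatAlt K ⊗[K] QSh K H) (u : Word K H) :
    (wordBasisRat K H).repr (shiftTensor f) u = ∑ w ∈ ((wordBasisRat K H).repr f).support,
      shiftRatAlt K ((wordBasisRat K H).repr f w) * (wordBasisRat K H).repr (thetaFwd w) u := by
  conv_lhs => rw [← (wordBasisRat K H).linearCombination_repr f]
  rw [Finsupp.linearCombination_apply, Finsupp.sum, map_sum, map_sum, Finsupp.finsetSum_apply]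
  refine Finset.sum_congr rfl fun w _ => ?_
  rw [shiftTensor_smul, shiftTensor_wordBasisRat, map_smul, Finsupp.smul_apply, smul_eq_mul]

theorem sum_repr_mul_single (f : RatAlt K ⊗[K] QSh K H) (u : Word K H) :
    ∑ w ∈ ((wordBasisRat K H).repr f).support,
      shiftRatAlt K ((wordBasisRat K H).repr f w) * Finsupp.single w 1 u =
      shiftRatAlt K ((wordBasisRat K H).repr f u) := by
  classical
  rw [Finset.sum_eq_single u]
  · simp
  · intro w _ hw
    rw [Finsupp.single_eq_of_ne hw.symm, mul_zero]
  · intro hu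
    rw [Finsupp.notMem_support_iff.1 hu, map_zero, zero_mul]

/-- The shift acts on the coefficients of the longest words by the shift of `K(n)[x]`. -/
theorem repr_shiftTensor_top {N : ℕ} {f : RatAlt K ⊗[K] QSh K H} (hf : f ∈ lengthLT K H (N + 1))
    {u : Word K H} (hu : N ≤ u.length) :
    (wordBasisRat K H).repr (shiftTensor f) u = shiftRatAlt K ((wordBasisRat K H).repr f u) := by
  rw [repr_shiftTensor, ← sum_repr_mul_single]
  refine Finset.sum_congr rfl fun w hw => ?_
  rw [repr_thetaFwd]
  by_contra h
  exact Finsupp.mem_support_iff.1 hw (hf w (by omega))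

theorem shiftTensor_mem_lengthLT {N : ℕ} {f : RatAlt K ⊗[K] QSh K H}
    (hf : f ∈ lengthLT K H (N + 1)) : shiftTensor f ∈ lengthLT K H (N + 1) := fun w hw => by
  rw [repr_shiftTensor_top hf (by omega), hf w hw, map_zero]

/-- The action of the shift on the coefficients of the words of second largest length. -/
theorem repr_shiftTensor_next {N : ℕ} {f : RatAlt K ⊗[K] QSh K H}
    (hf : f ∈ lengthLT K H (N + 2)) {u : Word K H} (hu : u.length = N) :
    (wordBasisRat K H).repr (shiftTensor f) u = shiftRatAlt K ((wordBasisRat K H).repr f u) +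
      shiftRatAlt K ((((wordBasisRat K H).repr f).comapDomain (fun l : Ltr K H => l :: u)
        (cons_left_injective u).injOn).sum fun l r => r * letterBar l.1) := by
  classical
  have hinj : Set.InjOn (fun l : Ltr K H => l :: u)
    ((fun l : Ltr K H => l :: u) ⁻¹' ↑((wordBasisRat K H).repr f).support) :=
    (cons_left_injective u).injOn
  -- Removing w from its shift leaves proper suffixes. For w of length at most N + 1 the word u of
  -- length N is among them only if w = l :: u, so the sum runs over letters.
  have key := Finset.sum_preimage (fun l : Ltr K H => l :: u)
    ((wordBasisRat K H).repr f).support hinj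
    (fun w => shiftRatAlt K ((wordBasisRat K H).repr f w) *
      ((wordBasisRat K H).repr (thetaFwd w) u - Finsupp.single w 1 u)) (by
      intro w hw hr
      have hlen : w.length ≤ N + 1 := by
        by_contra h
        exact Finsupp.mem_support_iff.1 hw (hf w (by omega))
      rcases Nat.lt_or_ge N w.length with h | h
      · obtain _ | ⟨l, w⟩ := w
        · simp at h
        simp only [List.length_cons] at h hlen
        have hne : w ≠ u := fun e => hr ⟨l, by rw [e]⟩
        rw [thetaFwd_cons, map_add, map_smul, Finsupp.add_apply, Module.Basis.repr_self,
          Finsupp.smul_apply, repr_thetaFwd w u (by omega), Finsupp.single_eq_of_ne hne.symm,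
          smul_zero, add_zero, sub_self, mul_zero]
      · rw [repr_thetaFwd w u (by omega), sub_self, mul_zero])
  have e : ∀ l : Ltr K H, (wordBasisRat K H).repr (thetaFwd (l :: u)) u -
      Finsupp.single (l :: u) 1 u = shiftRatAlt K (letterBar l.1) := by
    intro l
    rw [thetaFwd_cons, map_add, map_smul, Finsupp.add_apply, Module.Basis.repr_self,
      Finsupp.smul_apply, repr_thetaFwd u u le_rfl, Finsupp.single_eq_same, smul_eq_mul, mul_one,
      add_sub_cancel_left]
  simp only [e, mul_sub, Finset.sum_sub_distrib] at key
  rw [sum_repr_mul_single, ← repr_shiftTensor] at key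
  rw [← sub_eq_iff_eq_add', ← key, Finsupp.sum, map_sum]
  refine Finset.sum_congr rfl fun l _ => ?_
  rw [map_mul]
  rfl

/-- The constants of the quasi-shuffle algebra over `K(n)[x]` are the elements of `K`. -/
theorem eq_smul_one_of_shiftTensor_eq {f : RatAlt K ⊗[K] QSh K H} (h : shiftTensor f = f) :
    ∃ c : K, f = algebraMap K (RatAlt K) c • 1 := by
  obtain ⟨N, hN⟩ := exists_mem_lengthLT f
  induction N with
  | zero =>
    have e : f = (wordBasisRat K H).repr f [] • 1 := by
      refine (wordBasisRat K H).repr.injective (Finsupp.ext fun w => ?_)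
      rw [map_smul, ← wordBasisRat_nil, Module.Basis.repr_self, Finsupp.smul_apply]
      obtain _ | ⟨l, w⟩ := w
      · simp
      · rw [hN _ (by simp), Finsupp.single_eq_of_ne (by simp), smul_zero]
    obtain ⟨c, hc⟩ := RatAlt.eq_algebraMap_of_shift_eq
      ((repr_shiftTensor_top hN (u := []) le_rfl).symm.trans (by rw [h]))
    exact ⟨c, by rw [← hc, ← e]⟩
  | succ N ih =>
    refine ih fun w hw => ?_
    rcases Nat.lt_or_ge (N + 1) w.length with hlt | hge
    · exact hN w (by omega)
    obtain _ | ⟨l, u⟩ := w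
    · simp at hw
    simp only [List.length_cons] at hw hge
    have hu : u.length = N := by omega
    -- The coefficients k l of the longest words l :: u are invariant, hence in K. The equation at u
    -- then says that their combination of letters telescopes, with the coefficient of u as witness.
    have hnext := repr_shiftTensor_next hN hu
    set k := ((wordBasisRat K H).repr f).comapDomain (fun l : Ltr K H => l :: u)
        (cons_left_injective u).injOn with hk
    set inv := Function.invFun (algebraMap K (RatAlt K)) with hinv
    have hleft : ∀ c, inv (algebraMap K (RatAlt K) c) = c :=
      Function.leftInverse_invFun (algebraMap K (RatAlt K)).injective
    have hright : ∀ l, algebraMap K (RatAlt K) (inv (k l)) = k l := by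
      intro l
      obtain ⟨c, hc⟩ := RatAlt.eq_algebraMap_of_shift_eq
        ((repr_shiftTensor_top hN (u := l :: u) (by simp [hu])).symm.trans (by rw [h]))
      have : k l = algebraMap K (RatAlt K) c := hc
      rw [this, hleft]
    have h0 : inv 0 = 0 := by
      have := hleft 0
      rwa [map_zero] at this
    have hbar : k.sum (fun l r => r * letterBar l.1) = barLin K H (k.mapRange inv h0) := by
      rw [barLin, Finsupp.linearCombination_apply, Finsupp.sum_mapRange_index (by simp)]
      exact Finset.sum_congr rfl fun l _ => by
        change _ = inv (k l) • _
        rw [Algebra.smul_def, hright]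
    rw [h, hbar] at hnext
    have hz := DFunLike.congr_fun (eq_zero_of_barLin_telescopes H _ _ hnext) l
    rw [Finsupp.mapRange_apply, Finsupp.zero_apply] at hz
    have := hright l
    rw [hz, map_zero] at this
    exact this.symm

/-- An ideal of the quasi-shuffle algebra over `K(n)[x]` that is closed under the shift and
contains a nonzero element is the whole ring. -/
theorem one_mem_of_shift_closed (J : Ideal (RatAlt K ⊗[K] QSh K H))
    (hJ : ∀ f ∈ J, shiftTensor f ∈ J) {f : RatAlt K ⊗[K] QSh K H} (hf : f ∈ J) (h0 : f ≠ 0) :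
    1 ∈ J := by
  classical
  have hsmul : ∀ (r : RatAlt K) {f}, f ∈ J → r • f ∈ J := fun r f hf => by
    rw [smul_eq_tmul_one_mul]; exact J.mul_mem_left _ hf
  have key : ∀ N, ∀ f ∈ J, f ≠ 0 → f ∈ lengthLT K H N → 1 ∈ J := by
    intro N
    induction N with
    | zero =>
      intro f _ h0 hN
      refine absurd ((wordBasisRat K H).repr.injective (Finsupp.ext fun w => ?_)) h0
      rw [hN w (Nat.zero_le _), map_zero, Finsupp.zero_apply]
    | succ N ihN =>
      -- Inner induction on the number of words of length N in the support; when none is left, the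
      -- outer induction applies.
      have inner : ∀ n, ∀ f ∈ J, f ≠ 0 → f ∈ lengthLT K H (N + 1) →
          (((wordBasisRat K H).repr f).support.filter fun w => w.length = N).card ≤ n → 1 ∈ J := by
        intro n
        induction n with
        | zero =>
          intro f hf h0 hN hcard
          refine ihN f hf h0 fun w hw => ?_
          rcases Nat.lt_or_ge N w.length with h | h
          · exact hN w h
          · by_contra hne
            have hmem : w ∈ ((wordBasisRat K H).repr f).support.filter fun w => w.length = N :=
              Finset.mem_filter.2 ⟨Finsupp.mem_support_iff.2 hne, le_antisymm h hw⟩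
            rw [Finset.card_eq_zero.1 (Nat.le_zero.1 hcard)] at hmem
            simp at hmem
        | succ n ihn =>
          intro f hf h0 hN hcard
          by_cases hex : ∃ w : Word K H, w.length = N ∧ (wordBasisRat K H).repr f w ≠ 0
          swap
          · refine ihn f hf h0 hN ?_
            rw [Finset.filter_eq_empty_iff.2 (fun w hw hl =>
              hex ⟨w, hl, Finsupp.mem_support_iff.1 hw⟩)]
            simp
          obtain ⟨w, hwN, hw⟩ := hex
          obtain ⟨a, b, hab⟩ := RatAlt.exists_mul_add_mul_shift_eq_one hw
          -- The coefficient of g at w is 1. If g is constant, it is a nonzero element of K in J.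
          -- Otherwise σ(g) - g is a nonzero element of J that has lost the word w and gained no
          -- word of length N.
          set g := a • f + b • shiftTensor f with hg
          have hgJ : g ∈ J := add_mem (hsmul a hf) (hsmul b (hJ f hf))
          have hgN : g ∈ lengthLT K H (N + 1) :=
            add_mem (Submodule.smul_mem _ _ hN)
              (Submodule.smul_mem _ _ (shiftTensor_mem_lengthLT hN))
          have hgr : ∀ u : Word K H, u.length = N → (wordBasisRat K H).repr g u =
              a * (wordBasisRat K H).repr f u +
                b * shiftRatAlt K ((wordBasisRat K H).repr f u) := fun u hu => by
            rw [hg, map_add, map_smul, map_smul, Finsupp.add_apply, Finsupp.smul_apply,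
              Finsupp.smul_apply, repr_shiftTensor_top hN hu.ge, smul_eq_mul, smul_eq_mul]
          by_cases hconst : shiftTensor g = g
          · obtain ⟨c, hc⟩ := eq_smul_one_of_shiftTensor_eq hconst
            have hc0 : c ≠ 0 := by
              rintro rfl
              have := hgr w hwN
              rw [hab, hc, map_zero, zero_smul, map_zero, Finsupp.zero_apply] at this
              exact zero_ne_one this
            have := hsmul (algebraMap K (RatAlt K) c⁻¹) hgJ
            rwa [hc, smul_smul, ← map_mul, inv_mul_cancel₀ hc0, map_one, one_smul] at this
          · refine ihn (shiftTensor g - g) (sub_mem (hJ g hgJ) hgJ) (sub_ne_zero.2 hconst)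
              (sub_mem (shiftTensor_mem_lengthLT hgN) hgN) ?_
            have hdr : ∀ u : Word K H, u.length = N →
                (wordBasisRat K H).repr (shiftTensor g - g) u =
                shiftRatAlt K ((wordBasisRat K H).repr g u) - (wordBasisRat K H).repr g u :=
              fun u hu => by
                rw [map_sub, Finsupp.sub_apply, repr_shiftTensor_top hgN hu.ge]
            refine Nat.le_of_lt_succ (lt_of_lt_of_le (Finset.card_lt_card ?_) hcard)
            refine (Finset.ssubset_iff_of_subset fun u hu => ?_).2 ⟨w, ?_, fun hw' => ?_⟩
            · obtain ⟨h1, h2⟩ := Finset.mem_filter.1 hu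
              refine Finset.mem_filter.2 ⟨Finsupp.mem_support_iff.2 fun hz => ?_, h2⟩
              refine Finsupp.mem_support_iff.1 h1 ?_
              rw [hdr u h2, hgr u h2, hz]
              simp
            · exact Finset.mem_filter.2 ⟨Finsupp.mem_support_iff.2 hw, hwN⟩
            · refine Finsupp.mem_support_iff.1 (Finset.mem_filter.1 hw').1 ?_
              rw [hdr w hwN, hgr w hwN, hab, map_one, sub_self]
      exact fun f hf h0 hN => inner _ f hf h0 hN le_rfl
  obtain ⟨N, hN⟩ := exists_mem_lengthLT f
  exact key _ f hf h0 hN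

end Constants

/-! ## Evaluation -/

section EvaluationShift

variable {K : Type*} [Field K] [CharZero K] {H : Alphabet}

open Classical in
theorem tauRatAlt_letterBar (l : Ltr K H) : tauRatAlt K (letterBar l.1) = toSeq (letterVal l.1) := by
  have e1 : tauRatAlt K (RatAlt.ofRat K (letterRat l.1)) = toSeq (evRat (letterRat l.1)) := by
    rw [tauRatAlt, AdjoinRoot.lift_of]
    rfl
  have e2 : tauRatAlt K (RatAlt.alt K) = toSeq fun k => (-1) ^ k := by
    simp [tauRatAlt, RatAlt.alt]
  have e3 : tauRatAlt K (if l.1.z = 1 then 1 else RatAlt.alt K) = toSeq fun k => l.1.z ^ k := by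
    have hne : (-1 : K) ≠ 1 := by norm_num
    rcases sign_of_mem l with h | h
    · rw [h, if_pos rfl, map_one]
      exact toSeq_eq (s := fun _ => 1) (Filter.Eventually.of_forall fun k => by simp)
    · rw [h, if_neg hne, e2]
  rw [letterBar, map_mul, e1, e3]
  refine toSeq_eq (s := fun k => l.1.z ^ k * evRat (letterRat l.1) k) ?_
  -- The index 0 is left out because a letter with b = 0 has its pole there.
  filter_upwards [Filter.eventually_ge_atTop 1] with k hk
  rw [(letterRat_regular l.1 hk).2, letterVal, mul_one_div]

theorem tauTensor_smul (r : RatAlt K) (f : RatAlt K ⊗[K] QSh K H) :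
    tauTensor K H (r • f) = tauRatAlt K r * tauTensor K H f := by
  rw [smul_eq_tmul_one_mul, map_mul, tauTensor,
    Algebra.TensorProduct.productMap_apply_tmul, map_one, mul_one]
  rfl

theorem tauTensor_wordBasisRat (w : Word K H) :
    tauTensor K H (wordBasisRat K H w) = toSeq (nestedSum w) := by
  have e : sumHom K H (QSh.word w) = nestedSum w := QSh.liftWord_word _ _ _ _
  rw [wordBasisRat_apply, tauTensor, Algebra.TensorProduct.productMap_apply_tmul, map_one, one_mul]
  change toSeq (sumHom K H (QSh.word w)) = _
  rw [e]

/-- The shift on words mirrors splitting off the last summand: S_{l w}(k + 1) = S_{l w}(k) + λ(l, k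
+ 1) S_w(k + 1). -/
theorem tauTensor_thetaFwd (w : Word K H) :
    tauTensor K H (thetaFwd w) = shiftSeq K (toSeq (nestedSum w)) := by
  induction w with
  | nil => rw [thetaFwd, map_one]; rfl
  | cons l w ih =>
    rw [thetaFwd_cons, map_add, tauTensor_smul, tauTensor_wordBasisRat, ih, tauRatAlt_shiftRatAlt,
      tauRatAlt_letterBar, shiftSeq_toSeq, shiftSeq_toSeq, shiftSeq_toSeq]
    refine toSeq_eq (s := fun k => nestedSum (l :: w) k + letterVal l.1 (k + 1) * nestedSum w (k + 1))
      (Filter.Eventually.of_forall fun k => ?_)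
    simp only [nestedSum]
    rw [Finset.sum_Icc_succ_top (by omega)]

theorem tauTensor_shiftTensor (f : RatAlt K ⊗[K] QSh K H) :
    tauTensor K H (shiftTensor f) = shiftSeq K (tauTensor K H f) := by
  rw [← (wordBasisRat K H).linearCombination_repr f, Finsupp.linearCombination_apply, Finsupp.sum]
  simp only [map_sum]
  refine Finset.sum_congr rfl fun w _ => ?_
  rw [shiftTensor_smul, shiftTensor_wordBasisRat, tauTensor_smul, tauTensor_smul,
    tauTensor_thetaFwd, tauTensor_wordBasisRat, map_mul, tauRatAlt_shiftRatAlt]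

/-- Evaluation commutes with the shift, so its kernel is a shift-closed ideal; as it does not
contain 1, it is zero by `one_mem_of_shift_closed`. -/
theorem tauTensor_injective : Function.Injective (tauTensor K H) := by
  rw [injective_iff_map_eq_zero]
  intro f hf
  by_contra h0
  have h1 := one_mem_of_shift_closed (RingHom.ker (tauTensor K H))
    (fun g hg => by
      rw [RingHom.mem_ker] at hg ⊢
      rw [tauTensor_shiftTensor, hg, map_zero]) (RingHom.mem_ker.2 hf) h0
  rw [RingHom.mem_ker, map_one] at h1
  exact one_ne_zero h1

variable {d : ℕ}

theorem tau_mk (f : NaiveRing K H d) :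
    tau K H d (Ideal.Quotient.mk _ f) = tauTensor K H (linearize K H d f) := tauNaive_eq d f

theorem tau_injective : Function.Injective (tau K H d) := by
  rw [injective_iff_map_eq_zero]
  intro f hf
  obtain ⟨f, rfl⟩ := Ideal.Quotient.mk_surjective f
  rw [tau_mk] at hf
  exact Ideal.Quotient.eq_zero_iff_mem.2
    (tauTensor_injective (hf.trans (map_zero _).symm))

theorem shiftReduced_mk (f : NaiveRing K H d) :
    shiftReduced K H d (Ideal.Quotient.mk _ f) = Ideal.Quotient.mk _ (shiftNaive K H d f) := rfl

theorem tau_shiftReduced (f : ReducedRing K H d) :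
    tau K H d (shiftReduced K H d f) = shiftSeq K (tau K H d f) := by
  obtain ⟨f, rfl⟩ := Ideal.Quotient.mk_surjective f
  rw [shiftReduced_mk, tau_mk, tau_mk, linearize_shiftNaive, tauTensor_shiftTensor]

end EvaluationShift

/-! ## Degrees of products of letters -/

/-- If `u v` is a linear combination of `u` and `v`, then `u ^ i v ^ j` is one of pure powers
with exponents at most `i + j`. -/
theorem mul_pow_mem_span_le {K R : Type*} [Field K] [CommRing R] [Algebra K R] (u v : R) (α β : K)
    (h : u * v = α • u + β • v) : ∀ N i j : ℕ, i + j = N → 0 < i + j →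
    u ^ i * v ^ j ∈ Submodule.span K
      ({y | ∃ c, 0 < c ∧ c ≤ N ∧ y = u ^ c} ∪ {y | ∃ c, 0 < c ∧ c ≤ N ∧ y = v ^ c}) := by
  intro N
  induction N with
  | zero => intro i j h1 h2; omega
  | succ N ih =>
    intro i j h1 h2
    rcases Nat.eq_zero_or_pos i with rfl | hi
    · exact Submodule.subset_span (Or.inr ⟨j, by omega, by omega, by simp⟩)
    rcases Nat.eq_zero_or_pos j with rfl | hj
    · exact Submodule.subset_span (Or.inl ⟨i, by omega, by omega, by simp⟩)
    obtain ⟨i, rfl⟩ : ∃ i', i = i' + 1 := ⟨i - 1, by omega⟩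
    obtain ⟨j, rfl⟩ : ∃ j', j = j' + 1 := ⟨j - 1, by omega⟩
    have e : u ^ (i + 1) * v ^ (j + 1) =
        α • (u ^ (i + 1) * v ^ j) + β • (u ^ i * v ^ (j + 1)) := by
      calc u ^ (i + 1) * v ^ (j + 1) = u ^ i * v ^ j * (u * v) := by ring
        _ = _ := by rw [h, mul_add, mul_smul_comm, mul_smul_comm]; ring_nf
    have hmono : Submodule.span K
        ({y | ∃ c, 0 < c ∧ c ≤ N ∧ y = u ^ c} ∪ {y | ∃ c, 0 < c ∧ c ≤ N ∧ y = v ^ c}) ≤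
        Submodule.span K
        ({y | ∃ c, 0 < c ∧ c ≤ N + 1 ∧ y = u ^ c} ∪ {y | ∃ c, 0 < c ∧ c ≤ N + 1 ∧ y = v ^ c}) :=
      Submodule.span_mono (Set.union_subset_union
        (fun y ⟨c, h, h', hy⟩ => ⟨c, h, by omega, hy⟩) (fun y ⟨c, h, h', hy⟩ => ⟨c, h, by omega, hy⟩))
    rw [e]
    exact Submodule.add_mem _ (Submodule.smul_mem _ _ (hmono (ih _ _ (by omega) (by omega))))
      (Submodule.smul_mem _ _ (hmono (ih _ _ (by omega) (by omega))))

/-- The product of two letters is a linear combination of letters whose degree is at most the sum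
of the degrees. -/
theorem letterBar_mul_mem_span_le {K : Type*} [Field K] [CharZero K] {H : Alphabet}
    (l m : Ltr K H) :
    letterBar l.1 * letterBar m.1 ∈ Submodule.span K ((fun k : Ltr K H => letterBar k.1) ''
      {k | k.1.c ≤ l.1.c + m.1.c}) := by
  classical
  set P : Letter K → K[X] := fun l => C (l.a : K) * X + C (l.b : K) with hP
  set u : Letter K → RatFunc K := fun l => (algebraMap K[X] (RatFunc K) (P l))⁻¹ with hu
  set ε : K → RatAlt K := fun z => if z = 1 then 1 else RatAlt.alt K with hε
  have hbar : ∀ l : Letter K, letterBar l = ε l.z * RatAlt.ofRat K (u l ^ l.c) := by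
    intro l; simp only [letterBar, letterRat, hε, hu, hP, one_div, inv_pow]
  have hne : (-1 : K) ≠ 1 := by norm_num
  have hsign : ε l.1.z * ε m.1.z = ε (l.1.z * m.1.z) := by
    rcases sign_of_mem l with h1 | h1 <;> rcases sign_of_mem m with h2 | h2 <;>
      simp [hε, h1, h2, hne, alt_mul_alt]
  have hPne : ∀ l : Letter K, algebraMap K[X] (RatFunc K) (P l) ≠ 0 := by
    intro l
    have ha : (l.a : K) ≠ 0 := by exact_mod_cast l.a_pos.ne'
    rw [Ne, map_eq_zero_iff _ (RatFunc.algebraMap_injective K)]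
    intro h0
    have := congrArg (fun p => Polynomial.coeff p 1) h0
    simp [hP, ha] at this
  have hz0 : l.1.z * m.1.z ≠ 0 := mul_ne_zero l.1.z_ne_zero m.1.z_ne_zero
  have hpure : ∀ k : Ltr K H, (k = l ∨ k = m) → ∀ c : ℕ, 0 < c → c ≤ l.1.c + m.1.c →
      ε (l.1.z * m.1.z) * RatAlt.ofRat K (u k.1 ^ c) ∈
        Submodule.span K ((fun k : Ltr K H => letterBar k.1) '' {k | k.1.c ≤ l.1.c + m.1.c}) := by
    intro k hk c hc hcle
    let k' : Letter K := ⟨k.1.a, k.1.b, c, l.1.z * m.1.z, k.1.a_pos, hc, hz0, k.1.b_lt_a,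
      k.1.gcd_eq_one⟩
    have hk' : k' ∈ H.letters K := by
      refine mem_of_mem l m k' ?_ rfl
      rcases hk with rfl | rfl
      · exact Or.inl ⟨rfl, rfl⟩
      · exact Or.inr ⟨rfl, rfl⟩
    refine Submodule.subset_span ⟨⟨k', hk'⟩, hcle, ?_⟩
    exact hbar k'
  have hprod : letterBar l.1 * letterBar m.1 =
      ε (l.1.z * m.1.z) * RatAlt.ofRat K (u l.1 ^ l.1.c * u m.1 ^ m.1.c) := by
    rw [hbar, hbar, ← hsign, map_mul]; ring
  rw [hprod]
  by_cases hpole : l.1.a = m.1.a ∧ l.1.b = m.1.b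
  · have e : u m.1 = u l.1 := by simp only [hu, hP, hpole.1, hpole.2]
    rw [e, ← pow_add]
    exact hpure l (Or.inl rfl) _ (Nat.add_pos_left l.1.c_pos _) le_rfl
  · set Δ : K := (l.1.a : K) * m.1.b - m.1.a * l.1.b with hΔ
    have ha : (l.1.a : K) ≠ 0 := by exact_mod_cast l.1.a_pos.ne'
    have hb : (m.1.a : K) ≠ 0 := by exact_mod_cast m.1.a_pos.ne'
    have hΔ0 : Δ ≠ 0 := by
      intro h0
      refine hpole (ext_of_pole l.1 m.1 ?_)
      rw [div_eq_div_iff ha hb]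
      linear_combination -h0
    have hrel : u l.1 * u m.1 = (Δ⁻¹ * l.1.a) • u l.1 + (-(Δ⁻¹ * m.1.a)) • u m.1 := by
      have hl := hPne l.1
      have hm := hPne m.1
      have hΔ' : algebraMap K (RatFunc K) Δ ≠ 0 := by simpa using hΔ0
      have e : algebraMap K (RatFunc K) Δ =
          algebraMap K (RatFunc K) l.1.a * algebraMap K[X] (RatFunc K) (P m.1) -
          algebraMap K (RatFunc K) m.1.a * algebraMap K[X] (RatFunc K) (P l.1) := by
        have ec : ∀ c : K, algebraMap K (RatFunc K) c = algebraMap K[X] (RatFunc K) (C c) :=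
          fun c => rfl
        rw [ec, ec, ec, ← map_mul, ← map_mul, ← map_sub]
        congr 1
        simp only [hP, hΔ, C_sub, C_mul]
        ring
      simp only [hu, Algebra.smul_def, map_mul, map_neg, map_inv₀]
      field_simp
      rw [e]
      ring
    have hmem := mul_pow_mem_span_le (K := K) (u l.1) (u m.1) _ _ hrel _ l.1.c m.1.c rfl
      (Nat.add_pos_left l.1.c_pos _)
    let T : RatFunc K →ₗ[K] RatAlt K :=
      { toFun := fun f => ε (l.1.z * m.1.z) * RatAlt.ofRat K f
        map_add' := fun f g => by rw [map_add, mul_add]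
        map_smul' := fun c f => by
          have : algebraMap K (RatAlt K) c = RatAlt.ofRat K (algebraMap K (RatFunc K) c) := rfl
          rw [Algebra.smul_def, map_mul, RingHom.id_apply, Algebra.smul_def, this]; ring }
    change T (u l.1 ^ l.1.c * u m.1 ^ m.1.c) ∈ _
    refine (Submodule.span_le (p := (Submodule.span K ((fun k : Ltr K H => letterBar k.1) ''
      {k | k.1.c ≤ l.1.c + m.1.c})).comap T)).2 ?_ hmem
    rintro y (⟨c, hc, hcle, rfl⟩ | ⟨c, hc, hcle, rfl⟩)
    · exact hpure l (Or.inl rfl) c hc hcle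
    · exact hpure m (Or.inr rfl) c hc hcle

/-- The bracket of two letters only contains letters whose degree is at most the sum of the
degrees. -/
theorem degree_le_of_letterBracket_ne_zero {K : Type*} [Field K] [CharZero K] {H : Alphabet}
    (l m k : Ltr K H) (hk : letterBracket l m k ≠ 0) : k.1.c ≤ l.1.c + m.1.c := by
  obtain ⟨f, hf, e⟩ := (Finsupp.mem_span_image_iff_linearCombination K).1
    (letterBar_mul_mem_span_le l m)
  -- Coefficients of letters are unique, so the combination with bounded degrees is the bracket
  -- itself.
  have : f = letterBracket l m := barLin_injective K H (e.trans (barLin_letterBracket l m).symm)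
  rw [← this] at hk
  exact hf (Finsupp.mem_support_iff.2 hk)

/-! ## The weight filtration and derivations -/

section Filtration

variable {K : Type*} [Field K] [CharZero K] {H : Alphabet}

/-- The elements of the quasi-shuffle algebra supported on words of weight at most `n`. -/
def weightLE (K : Type*) [Field K] [CharZero K] (H : Alphabet) (n : ℤ) : Submodule K (QSh K H) :=
  Submodule.span K (QSh.word '' {w | (weight w : ℤ) ≤ n})

theorem mem_weightLE {n : ℤ} {f : QSh K H} :
    f ∈ weightLE K H n ↔ ∀ w, f.coeff w ≠ 0 → (weight w : ℤ) ≤ n := by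
  have h := (wordBasis K H).mem_span_image (m := f) (s := {w | (weight w : ℤ) ≤ n})
  rw [show (wordBasis K H : Word K H → QSh K H) = QSh.word from rfl] at h
  rw [weightLE, h]
  exact ⟨fun h w hw => h (Finsupp.mem_support_iff.2 hw),
    fun h w hw => h w (Finsupp.mem_support_iff.1 hw)⟩

theorem word_mem_weightLE {n : ℤ} {w : Word K H} (h : (weight w : ℤ) ≤ n) :
    QSh.word w ∈ weightLE K H n := Submodule.subset_span ⟨w, h, rfl⟩

theorem one_mem_weightLE {n : ℤ} (h : 0 ≤ n) : (1 : QSh K H) ∈ weightLE K H n :=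
  word_mem_weightLE (w := []) (by simpa [weight] using h)

theorem weightLE_mono {m n : ℤ} (h : m ≤ n) : weightLE K H m ≤ weightLE K H n :=
  Submodule.span_mono (Set.image_mono fun _ hw => le_trans hw h)

/-- Levels are indexed by integers so that weights can be subtracted freely; the descents below end
in a negative level. -/
theorem eq_zero_of_mem_weightLE {n : ℤ} (hn : n < 0) {f : QSh K H} (hf : f ∈ weightLE K H n) :
    f = 0 := by
  have : weightLE K H n = ⊥ := by
    rw [weightLE, Submodule.span_eq_bot]
    rintro _ ⟨w, hw, rfl⟩
    have : (weight w : ℤ) ≤ n := hw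
    omega
  rw [this] at hf
  exact hf

theorem cons_mem_weightLE {c : ℕ} {n : ℤ} {f : Ltr K H →₀ K} {g : QSh K H}
    (hf : ∀ l, f l ≠ 0 → l.1.c ≤ c) (hg : g ∈ weightLE K H n) :
    QSh.cons f g ∈ weightLE K H (c + n) := by
  have key : ∀ l, f l ≠ 0 → QSh.cons (Finsupp.single l 1) g ∈ weightLE K H (c + n) := by
    intro l hl
    induction hg using Submodule.span_induction with
    | mem x hx =>
      obtain ⟨w, hw, rfl⟩ := hx
      have hw' : (weight w : ℤ) ≤ n := hw
      have := hf l hl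
      rw [QSh.cons_single_word]
      exact word_mem_weightLE (by rw [weight_cons]; push_cast; omega)
    | zero => rw [QSh.cons_zero]; exact zero_mem _
    | add x y _ _ hx hy => rw [QSh.cons_add]; exact add_mem hx hy
    | smul r x _ hx => rw [QSh.cons_smul]; exact Submodule.smul_mem _ _ hx
  have e : QSh.cons f g = ∑ l ∈ f.support, f l • QSh.cons (Finsupp.single l 1) g := by
    have h := congrArg (fun f => QSh.cons f g) f.sum_single.symm
    simp only [Finsupp.sum] at h
    rw [h]
    have hs : ∀ s : Finset (Ltr K H), QSh.cons (∑ l ∈ s, Finsupp.single l (f l)) g =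
        ∑ l ∈ s, QSh.cons (Finsupp.single l (f l)) g := fun s =>
      map_sum ((consLin (K := K)).flip (show Word K H →₀ K from g)) _ s
    rw [hs]
    refine Finset.sum_congr rfl fun l _ => ?_
    rw [← QSh.smul_cons, Finsupp.smul_single_one]
  rw [e]
  exact sum_mem fun l hl => Submodule.smul_mem _ _ (key l (Finsupp.mem_support_iff.1 hl))

theorem cons_single_mem_weightLE {n : ℤ} (l : Ltr K H) {g : QSh K H} (hg : g ∈ weightLE K H n) :
    QSh.cons (Finsupp.single l 1) g ∈ weightLE K H (l.1.c + n) :=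
  cons_mem_weightLE (fun m hm => by
    have : m = l := by
      by_contra h
      exact hm (Finsupp.single_eq_of_ne h)
    rw [this]) hg

/-- In the recursion the two prefixing terms keep the total weight and the bracket does not raise
it. For letters with different poles the bracket has terms of lower degree, so equality of weights
fails in general. -/
theorem word_mul_word_mem_weightLE : ∀ (N : ℕ) (u v : Word K H), u.length + v.length = N →
    QSh.word u * QSh.word v ∈ weightLE K H (weight u + weight v) := by
  intro N
  induction N using Nat.strong_induction_on with
  | _ N ih =>
    intro u v hN
    rcases u with _ | ⟨a, u⟩
    · rw [QSh.word_nil, one_mul]; exact word_mem_weightLE (by simp [weight])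
    rcases v with _ | ⟨b, v⟩
    · rw [QSh.word_nil, mul_one]; exact word_mem_weightLE (by simp [weight])
    simp only [List.length_cons] at hN
    have i1 := cons_single_mem_weightLE a (ih _ (by simp; omega) u (b :: v) rfl)
    have i2 := cons_single_mem_weightLE b (ih _ (by simp; omega) (a :: u) v rfl)
    have i3 := cons_mem_weightLE (degree_le_of_letterBracket_ne_zero a b)
      (ih _ (by omega) u v rfl)
    rw [QSh.word_mul_word]
    refine sub_mem (add_mem ?_ ?_) ?_
    · refine weightLE_mono ?_ i1; simp only [weight_cons]; push_cast; omega
    · refine weightLE_mono ?_ i2; simp only [weight_cons]; push_cast; omega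
    · refine weightLE_mono ?_ i3; simp only [weight_cons]; push_cast; omega

theorem mul_mem_weightLE {m n : ℤ} {f g : QSh K H} (hf : f ∈ weightLE K H m)
    (hg : g ∈ weightLE K H n) : f * g ∈ weightLE K H (m + n) := by
  refine Submodule.mul_le.1 ?_ f hf g hg
  rw [weightLE, weightLE, Submodule.span_mul_span, Submodule.span_le]
  rintro _ ⟨_, ⟨u, hu, rfl⟩, _, ⟨v, hv, rfl⟩, rfl⟩
  exact weightLE_mono (add_le_add hu hv) (word_mul_word_mem_weightLE _ u v rfl)

/-! ### Deconcatenation with a functional -/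

theorem QSh.cons_mul_cons (f g : Ltr K H →₀ K) (U V : QSh K H) :
    QSh.cons f U * QSh.cons g V = QSh.cons f (U * QSh.cons g V) + QSh.cons g (QSh.cons f U * V)
      - QSh.cons (brLin letterBracket f g) (U * V) :=
  qshMul_cons_cons (K := K) letterBracket f g U V

/-- The values on words of the linear map attached to a functional `φ`: `φ` is applied to the
second factor of the deconcatenation coproduct. -/
def deconcWord (φ : QSh K H →ₗ[K] K) : Word K H → QSh K H
  | [] => 0
  | l :: w => QSh.cons (Finsupp.single l 1) (deconcWord φ w) + φ (QSh.word (l :: w)) • 1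

/-- Deconcatenation followed by a functional on the second factor. -/
def deconc (φ : QSh K H →ₗ[K] K) : QSh K H →ₗ[K] QSh K H := QSh.lin (deconcWord φ)

theorem deconc_word (φ : QSh K H →ₗ[K] K) (w : Word K H) :
    deconc φ (QSh.word w) = deconcWord φ w := QSh.lin_word _ _

theorem deconc_one (φ : QSh K H →ₗ[K] K) : deconc φ 1 = 0 := by
  rw [← QSh.word_nil, deconc_word, deconcWord]

theorem deconc_cons (φ : QSh K H →ₗ[K] K) (f : Ltr K H →₀ K) (g : QSh K H) :
    deconc φ (QSh.cons f g) = QSh.cons f (deconc φ g) + φ (QSh.cons f g) • 1 := by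
  induction f, g using QSh.cons_induction with
  | h0l g => simp [QSh.zero_cons]
  | h0r f => simp [QSh.cons_zero]
  | hl f f' g h h' => rw [QSh.add_cons, map_add, h, h', QSh.add_cons, map_add, add_smul]; abel
  | hr f g g' h h' =>
    rw [QSh.cons_add, map_add, h, h', map_add, QSh.cons_add, map_add, add_smul]; abel
  | hs r s l w =>
    rw [QSh.smul_cons, QSh.cons_smul, QSh.cons_single_word, map_smul, map_smul, deconc_word,
      deconcWord, map_smul, deconc_word, QSh.smul_cons, QSh.cons_smul, map_smul, map_smul]
    simp only [smul_add, smul_smul, smul_eq_mul]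

variable {φ : QSh K H →ₗ[K] K} {e : ℕ}

/-- Unfolded, `deconcWord φ w` is the sum of φ(v) u over the splittings w = u v with v nonempty.
Only suffixes v of weight e survive, and each leaves a prefix of weight `weight w - e`. -/
theorem deconcWord_mem_weightLE (hφ : ∀ w, weight w ≠ e → φ (QSh.word w) = 0) (w : Word K H) :
    deconcWord φ w ∈ weightLE K H (weight w - e) := by
  induction w with
  | nil => exact zero_mem _
  | cons l w ih =>
    rw [deconcWord]
    refine add_mem (weightLE_mono ?_ (cons_single_mem_weightLE l ih)) ?_
    · rw [weight_cons]; push_cast; omega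
    · by_cases h : weight (l :: w) = e
      · exact Submodule.smul_mem _ _ (one_mem_weightLE (by omega))
      · rw [hφ _ h, zero_smul]; exact zero_mem _

theorem deconc_mem_weightLE (hφ : ∀ w, weight w ≠ e → φ (QSh.word w) = 0) {n : ℤ} {f : QSh K H}
    (hf : f ∈ weightLE K H n) : deconc φ f ∈ weightLE K H (n - e) := by
  have hle : weightLE K H n ≤ (weightLE K H (n - e)).comap (deconc φ) := Submodule.span_le.2 ?_
  · exact hle hf
  rintro _ ⟨w, hw, rfl⟩
  change deconc φ (QSh.word w) ∈ weightLE K H (n - e)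
  rw [deconc_word]
  exact weightLE_mono (sub_le_sub_right hw _) (deconcWord_mem_weightLE hφ w)

theorem functional_eq_zero_of_mem_weightLE (hφ : ∀ w, weight w ≠ e → φ (QSh.word w) = 0) {n : ℤ}
    (hn : n < e) {f : QSh K H} (hf : f ∈ weightLE K H n) : φ f = 0 := by
  have hle : weightLE K H n ≤ LinearMap.ker φ := Submodule.span_le.2 ?_
  · exact hle hf
  rintro _ ⟨w, hw, rfl⟩
  have hw' : (weight w : ℤ) ≤ n := hw
  exact hφ w (by omega)

/-- If `φ` has weight `e` and vanishes on products of weight `e`, then deconcatenation followed by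
`φ` is a derivation up to terms of smaller weight. -/
theorem deconc_word_mul_word (hφ : ∀ w, weight w ≠ e → φ (QSh.word w) = 0)
    (hmul : ∀ u v : Word K H, u ≠ [] → v ≠ [] → weight u + weight v = e →
      φ (QSh.word u * QSh.word v) = 0) :
    ∀ (N : ℕ) (u v : Word K H), u.length + v.length = N →
    deconc φ (QSh.word u * QSh.word v) - deconc φ (QSh.word u) * QSh.word v
      - QSh.word u * deconc φ (QSh.word v) ∈ weightLE K H (weight u + weight v - e - 1) := by
  intro N
  induction N using Nat.strong_induction_on with
  | _ N ih =>
    intro u v hN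
    rcases u with _ | ⟨a, u⟩
    · rw [QSh.word_nil, one_mul, one_mul, deconc_one, zero_mul, sub_zero, sub_self]
      exact zero_mem _
    rcases v with _ | ⟨b, v⟩
    · rw [QSh.word_nil, mul_one, mul_one, deconc_one, mul_zero, sub_zero, sub_self]
      exact zero_mem _
    simp only [List.length_cons] at hN
    have i1 := cons_single_mem_weightLE a (ih _ (by simp; omega) u (b :: v) rfl)
    have i2 := cons_single_mem_weightLE b (ih _ (by simp; omega) (a :: u) v rfl)
    have i3 := cons_mem_weightLE (degree_le_of_letterBracket_ne_zero a b)
      (ih _ (by omega) u v rfl)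
    -- Below weight e the filtration makes φ vanish on the product, at weight e the assumption on
    -- products does, and above e the empty word is light enough.
    have hscal : φ (QSh.word (a :: u) * QSh.word (b :: v)) • (1 : QSh K H) ∈
        weightLE K H (weight (a :: u) + weight (b :: v) - e - 1) := by
      rcases lt_trichotomy (weight (a :: u) + weight (b :: v)) e with h | h | h
      · rw [functional_eq_zero_of_mem_weightLE hφ (by exact_mod_cast h)
          (word_mul_word_mem_weightLE _ (a :: u) (b :: v) rfl), zero_smul]
        exact zero_mem _
      · rw [hmul _ _ (by simp) (by simp) h, zero_smul]
        exact zero_mem _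
      · exact Submodule.smul_mem _ _ (one_mem_weightLE (by omega))
    -- The defect of the product rule obeys the quasi-shuffle recursion up to one scalar term. The
    -- multiples φ(a u) b v and φ(b v) a u occur both in the outer products and under the prefixed
    -- letters, and cancel.
    have key : deconc φ (QSh.word (a :: u) * QSh.word (b :: v))
        - deconc φ (QSh.word (a :: u)) * QSh.word (b :: v)
        - QSh.word (a :: u) * deconc φ (QSh.word (b :: v)) =
      QSh.cons (Finsupp.single a 1) (deconc φ (QSh.word u * QSh.word (b :: v))
        - deconc φ (QSh.word u) * QSh.word (b :: v) - QSh.word u * deconc φ (QSh.word (b :: v)))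
      + QSh.cons (Finsupp.single b 1) (deconc φ (QSh.word (a :: u) * QSh.word v)
        - deconc φ (QSh.word (a :: u)) * QSh.word v - QSh.word (a :: u) * deconc φ (QSh.word v))
      - QSh.cons (letterBracket a b) (deconc φ (QSh.word u * QSh.word v)
        - deconc φ (QSh.word u) * QSh.word v - QSh.word u * deconc φ (QSh.word v))
      + φ (QSh.word (a :: u) * QSh.word (b :: v)) • 1 := by
      have csub : ∀ (f : Ltr K H →₀ K) (g h : QSh K H),
          QSh.cons f (g - h) = QSh.cons f g - QSh.cons f h := fun f g h => map_sub (consLin f) g h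
      have ea : deconc φ (QSh.word (a :: u)) =
          QSh.cons (Finsupp.single a 1) (deconc φ (QSh.word u)) + φ (QSh.word (a :: u)) • 1 := by
        rw [← QSh.cons_single_word, deconc_cons]
      have eb : deconc φ (QSh.word (b :: v)) =
          QSh.cons (Finsupp.single b 1) (deconc φ (QSh.word v)) + φ (QSh.word (b :: v)) • 1 := by
        rw [← QSh.cons_single_word, deconc_cons]
      have m1 := QSh.cons_mul_cons (Finsupp.single a 1) (Finsupp.single b 1)
        (deconc φ (QSh.word u)) (QSh.word v)
      have m2 := QSh.cons_mul_cons (Finsupp.single a 1) (Finsupp.single b 1)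
        (QSh.word u) (deconc φ (QSh.word v))
      rw [brLin_single, QSh.cons_single_word] at m1 m2
      have mul := congrArg (deconc φ) (QSh.word_mul_word a b u v)
      have hφe := congrArg φ (QSh.word_mul_word a b u v)
      rw [map_sub, map_add, deconc_cons, deconc_cons, deconc_cons] at mul
      rw [map_sub, map_add] at hφe
      have t1 : deconc φ (QSh.word (a :: u)) * QSh.word (b :: v) =
          QSh.cons (Finsupp.single a 1) (deconc φ (QSh.word u)) * QSh.word (b :: v) +
            φ (QSh.word (a :: u)) • QSh.word (b :: v) := by
        rw [ea, add_mul, smul_mul_assoc, one_mul]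
      have t2 : QSh.word (a :: u) * deconc φ (QSh.word (b :: v)) =
          QSh.word (a :: u) * QSh.cons (Finsupp.single b 1) (deconc φ (QSh.word v)) +
            φ (QSh.word (b :: v)) • QSh.word (a :: u) := by
        rw [eb, mul_add, mul_smul_comm, mul_one]
      have t3 : QSh.cons (Finsupp.single a 1) (QSh.word u * deconc φ (QSh.word (b :: v))) =
          QSh.cons (Finsupp.single a 1)
            (QSh.word u * QSh.cons (Finsupp.single b 1) (deconc φ (QSh.word v))) +
            φ (QSh.word (b :: v)) • QSh.word (a :: u) := by
        rw [eb, mul_add, mul_smul_comm, mul_one, QSh.cons_add, QSh.cons_smul, QSh.cons_single_word]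
      have t4 : QSh.cons (Finsupp.single b 1) (deconc φ (QSh.word (a :: u)) * QSh.word v) =
          QSh.cons (Finsupp.single b 1)
            (QSh.cons (Finsupp.single a 1) (deconc φ (QSh.word u)) * QSh.word v) +
            φ (QSh.word (a :: u)) • QSh.word (b :: v) := by
        rw [ea, add_mul, smul_mul_assoc, one_mul, QSh.cons_add, QSh.cons_smul, QSh.cons_single_word]
      rw [mul, t1, t2, m1, m2, hφe]
      simp only [csub]
      rw [t3, t4]
      simp only [add_smul, sub_smul]
      abel
    rw [key]
    refine add_mem (sub_mem (add_mem ?_ ?_) ?_) hscal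
    · refine weightLE_mono ?_ i1; simp only [weight_cons]; push_cast; omega
    · refine weightLE_mono ?_ i2; simp only [weight_cons]; push_cast; omega
    · refine weightLE_mono ?_ i3; simp only [weight_cons]; push_cast; omega

theorem deconc_mul (hφ : ∀ w, weight w ≠ e → φ (QSh.word w) = 0)
    (hmul : ∀ u v : Word K H, u ≠ [] → v ≠ [] → weight u + weight v = e →
      φ (QSh.word u * QSh.word v) = 0) {m n : ℤ} {f g : QSh K H} (hf : f ∈ weightLE K H m)
    (hg : g ∈ weightLE K H n) :
    deconc φ (f * g) - deconc φ f * g - f * deconc φ g ∈ weightLE K H (m + n - e - 1) := by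
  induction hf using Submodule.span_induction with
  | zero => simp
  | add x y _ _ hx hy =>
    have := add_mem hx hy
    convert this using 1
    simp only [add_mul, map_add]; abel
  | smul r x _ hx =>
    have := Submodule.smul_mem _ r hx
    convert this using 1
    simp only [smul_mul_assoc, map_smul, smul_sub]
  | mem x hx =>
    obtain ⟨u, hu, rfl⟩ := hx
    induction hg using Submodule.span_induction with
    | zero => simp
    | add x y _ _ hx hy =>
      have := add_mem hx hy
      convert this using 1
      simp only [mul_add, map_add]; abel
    | smul r x _ hx =>
      have := Submodule.smul_mem _ r hx
      convert this using 1
      simp only [mul_smul_comm, map_smul, smul_sub]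
    | mem x hx =>
      obtain ⟨v, hv, rfl⟩ := hx
      have hu' : (weight u : ℤ) ≤ m := hu
      have hv' : (weight v : ℤ) ≤ n := hv
      exact weightLE_mono (by omega) (deconc_word_mul_word hφ hmul _ u v rfl)

end Filtration

/-! ## Algebraic independence of the basis sums -/

section Independence

variable {K : Type*} [Field K] [CharZero K] {H : Alphabet} {ι : Type*} (t : ι → Word K H)

/-- The evaluation of polynomials at words. -/
def evalWords : MvPolynomial ι K →ₐ[K] QSh K H := MvPolynomial.aeval fun i => QSh.word (t i)

variable {t}

theorem evalWords_monomial_mem (s : ι →₀ ℕ) (c : K) :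
    evalWords t (MvPolynomial.monomial s c) ∈
      weightLE K H (Finsupp.weight (fun i => weight (t i)) s : ℕ) := by
  suffices h : evalWords t (MvPolynomial.monomial s 1) ∈
      weightLE K H (Finsupp.weight (fun i => weight (t i)) s : ℕ) by
    have := Submodule.smul_mem _ c h
    rwa [← map_smul, MvPolynomial.smul_monomial, smul_eq_mul, mul_one] at this
  have hone : evalWords t (MvPolynomial.monomial 0 1) ∈
      weightLE K H (Finsupp.weight (fun i => weight (t i)) (0 : ι →₀ ℕ) : ℕ) := by
    rw [show MvPolynomial.monomial (0 : ι →₀ ℕ) (1 : K) = 1 from rfl, map_one, map_zero]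
    exact one_mem_weightLE le_rfl
  induction s using Finsupp.induction_linear with
  | zero => exact hone
  | add s s' h h' =>
    have := mul_mem_weightLE h h'
    rw [← map_mul, MvPolynomial.monomial_mul, mul_one] at this
    rw [map_add]
    exact_mod_cast this
  | single i n =>
    induction n with
    | zero => rw [Finsupp.single_zero]; exact hone
    | succ n ih =>
      have hX : evalWords t (MvPolynomial.X i) ∈ weightLE K H (weight (t i) : ℕ) := by
        rw [evalWords, MvPolynomial.aeval_X]
        exact word_mem_weightLE le_rfl
      have := mul_mem_weightLE ih hX
      rw [← map_mul, MvPolynomial.X, MvPolynomial.monomial_mul, mul_one, ← Finsupp.single_add] at this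
      refine weightLE_mono (le_of_eq ?_) this
      simp only [Finsupp.weight_single, smul_eq_mul]
      push_cast; ring

theorem evalWords_mem_weightLE {n : ℤ} {P : MvPolynomial ι K}
    (hP : ∀ s ∈ P.support, (Finsupp.weight (fun i => weight (t i)) s : ℤ) ≤ n) :
    evalWords t P ∈ weightLE K H n := by
  rw [P.as_sum, map_sum]
  exact sum_mem fun s hs => weightLE_mono (hP s hs) (evalWords_monomial_mem s _)

variable {φ : QSh K H →ₗ[K] K} {e : ℕ}

/-- Up to terms of smaller weight, deconcatenation followed by a functional that is dual to one of
the words acts on monomials in the words as the partial derivative. -/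
theorem deconc_evalWords_monomial (ht : ∀ i, t i ≠ [])
    (hφ : ∀ w, weight w ≠ e → φ (QSh.word w) = 0)
    (hmul : ∀ u v : Word K H, u ≠ [] → v ≠ [] → weight u + weight v = e →
      φ (QSh.word u * QSh.word v) = 0) {j : ι} (hj : φ (QSh.word (t j)) = 1)
    (hdual : ∀ i, i ≠ j → φ (QSh.word (t i)) = 0) (s : ι →₀ ℕ)
    (hs : ∀ i ∈ s.support, weight (t i) ≤ e) (c : K) :
    deconc φ (evalWords t (MvPolynomial.monomial s c)) -
      evalWords t (MvPolynomial.pderiv j (MvPolynomial.monomial s c)) ∈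
        weightLE K H ((Finsupp.weight (fun i => weight (t i)) s : ℕ) - e - 1) := by
  classical
  suffices h : deconc φ (evalWords t (MvPolynomial.monomial s 1)) -
      evalWords t (MvPolynomial.pderiv j (MvPolynomial.monomial s 1)) ∈
        weightLE K H ((Finsupp.weight (fun i => weight (t i)) s : ℕ) - e - 1) by
    have hc : MvPolynomial.monomial s c = c • MvPolynomial.monomial s (1 : K) := by
      rw [MvPolynomial.smul_monomial, smul_eq_mul, mul_one]
    rw [hc, map_smul, map_smul, Derivation.map_smul, map_smul, ← smul_sub]
    exact Submodule.smul_mem _ c h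
  -- Both operations obey the product rule, one of them up to lower weight. The claim therefore
  -- passes to products and only has to be checked on variables.
  have prod : ∀ (P Q : MvPolynomial ι K) (m n : ℤ), evalWords t P ∈ weightLE K H m →
      evalWords t Q ∈ weightLE K H n →
      deconc φ (evalWords t P) - evalWords t (MvPolynomial.pderiv j P) ∈ weightLE K H (m - e - 1) →
      deconc φ (evalWords t Q) - evalWords t (MvPolynomial.pderiv j Q) ∈ weightLE K H (n - e - 1) →
      deconc φ (evalWords t (P * Q)) - evalWords t (MvPolynomial.pderiv j (P * Q)) ∈
        weightLE K H (m + n - e - 1) := by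
    intro P Q m n hP hQ h h'
    have h1 := mul_mem_weightLE h hQ
    have h2 := mul_mem_weightLE hP h'
    have h3 := deconc_mul hφ hmul hP hQ
    have := add_mem (add_mem h3 (weightLE_mono (by omega) h1)) (weightLE_mono (by omega) h2)
    convert this using 1
    rw [MvPolynomial.pderiv_mul, map_mul (evalWords t) P Q, map_add, map_mul (evalWords t),
      map_mul (evalWords t)]
    ring
  have honep : deconc φ (evalWords t (MvPolynomial.monomial (0 : ι →₀ ℕ) (1 : K))) -
      evalWords t (MvPolynomial.pderiv j (MvPolynomial.monomial (0 : ι →₀ ℕ) (1 : K))) = 0 := by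
    change deconc φ (evalWords t 1) - evalWords t (MvPolynomial.pderiv j 1) = 0
    rw [MvPolynomial.pderiv_one, map_one, deconc_one, map_zero, sub_zero]
  -- Proper suffixes of t i weigh less than e and are killed by φ. Only the whole word can be cut
  -- off, which leaves the scalar φ(t i).
  have hXp : ∀ i, weight (t i) ≤ e →
      deconc φ (evalWords t (MvPolynomial.X i)) -
        evalWords t (MvPolynomial.pderiv j (MvPolynomial.X i)) = 0 := by
    intro i hi
    have hφi : deconcWord φ (t i) = φ (QSh.word (t i)) • 1 := by
      rcases hti : t i with _ | ⟨l, w⟩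
      · exact absurd hti (ht i)
      · rw [deconcWord]
        have := deconcWord_mem_weightLE hφ w
        have hc := l.1.c_pos
        have hw : weight (t i) = l.1.c + weight w := by rw [hti, weight_cons]
        rw [eq_zero_of_mem_weightLE (by omega) this, QSh.cons_zero, zero_add]
    rw [evalWords, MvPolynomial.aeval_X, deconc_word, hφi, MvPolynomial.pderiv_X]
    rcases eq_or_ne i j with rfl | hij
    · rw [hj, Pi.single_eq_same, map_one, one_smul, sub_self]
    · rw [hdual i hij, Pi.single_eq_of_ne hij, map_zero, zero_smul, sub_zero]
  induction s using Finsupp.induction_linear with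
  | zero => rw [honep]; exact zero_mem _
  | add s s' h h' =>
    have hsub : ∀ i, i ∈ s.support ∨ i ∈ s'.support → i ∈ (s + s').support := fun i hi => by
      simp only [Finsupp.mem_support_iff, Finsupp.add_apply] at hi ⊢; omega
    have := prod _ _ _ _ (evalWords_monomial_mem s 1) (evalWords_monomial_mem s' 1)
      (h fun i hi => hs i (hsub i (Or.inl hi))) (h' fun i hi => hs i (hsub i (Or.inr hi)))
    rw [MvPolynomial.monomial_mul, mul_one] at this
    rw [map_add]
    exact_mod_cast this
  | single i n =>
    induction n with
    | zero => rw [Finsupp.single_zero, honep]; exact zero_mem _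
    | succ n ih =>
      have hi : weight (t i) ≤ e := hs i (by simp)
      have hX : evalWords t (MvPolynomial.X i) ∈ weightLE K H (weight (t i) : ℕ) := by
        rw [evalWords, MvPolynomial.aeval_X]
        exact word_mem_weightLE le_rfl
      have := prod _ _ _ _ (evalWords_monomial_mem (Finsupp.single i n) 1) hX
        (ih fun k hk => by
          have : k = i := by
            by_contra hki
            exact Finsupp.mem_support_iff.1 hk (Finsupp.single_eq_of_ne hki)
          rw [this]; exact hi)
        (by rw [hXp i hi]; exact zero_mem _)
      rw [MvPolynomial.X, MvPolynomial.monomial_mul, mul_one, ← Finsupp.single_add] at this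
      refine weightLE_mono (le_of_eq ?_) this
      simp only [Finsupp.weight_single, smul_eq_mul]
      push_cast; ring

theorem weight_pos {w : Word K H} (hw : w ≠ []) : 0 < weight w := by
  obtain _ | ⟨l, w⟩ := w
  · exact absurd rfl hw
  · rw [weight_cons]; exact Nat.add_pos_left l.1.c_pos _

/-- A family of words is called separated if for each of its members there is a functional of the
same weight that vanishes on products and on all other members of the family, and does not vanish on
the member. -/
def IsSeparated (t : ι → Word K H) : Prop :=
  ∀ j, ∃ φ : QSh K H →ₗ[K] K, (∀ w, weight w ≠ weight (t j) → φ (QSh.word w) = 0) ∧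
    (∀ u v : Word K H, u ≠ [] → v ≠ [] → weight u + weight v = weight (t j) →
      φ (QSh.word u * QSh.word v) = 0) ∧ φ (QSh.word (t j)) = 1 ∧
    ∀ i, i ≠ j → φ (QSh.word (t i)) = 0

/-- Descent on n. For a variable j of P let e be the weight of `t j`. Deconcatenation with its dual
functional lowers the level n - 1 by e and agrees with the partial derivative of P up to level n - e
- 1. So this derivative satisfies the hypothesis for n - e and vanishes, which in characteristic 0
contradicts the occurrence of j in P. -/
theorem eq_zero_of_evalWords_mem_weightLE (ht : ∀ i, t i ≠ []) (hsep : IsSeparated t) (n : ℕ) :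
    ∀ P : MvPolynomial ι K, MvPolynomial.IsWeightedHomogeneous (fun i => weight (t i)) P n →
      evalWords t P ∈ weightLE K H (n - 1) → P = 0 := by
  classical
  induction n using Nat.strong_induction_on with
  | _ n ih =>
    intro P hP hmem
    rcases P.vars.eq_empty_or_nonempty with hv | hv
    · rw [MvPolynomial.vars_eq_empty_iff_eq_C] at hv
      by_contra h0
      have hc : P.coeff 0 ≠ 0 := fun h => h0 (by rw [hv, h, map_zero])
      have hn := hP hc
      rw [map_zero] at hn
      rw [hv, evalWords, MvPolynomial.aeval_C, Algebra.algebraMap_eq_smul_one] at hmem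
      have h1 := eq_zero_of_mem_weightLE (by omega) hmem
      have hw : (QSh.word [] : QSh K H) ≠ 0 := (wordBasis K H).ne_zero []
      exact (smul_ne_zero hc hw) h1
    -- Maximal weight is required because the comparison with the partial derivative only covers
    -- words at most as heavy as `t j`.
    obtain ⟨j, hj, hmax⟩ := Finset.exists_max_image P.vars (fun i => weight (t i)) hv
    obtain ⟨φ, hφ, hmul, hφj, hdual⟩ := hsep j
    obtain ⟨s, hs, hsj⟩ := (MvPolynomial.mem_vars_iff_mem_support j).1 hj
    have hsj' := Finsupp.mem_support_iff.1 hsj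
    have hsn := hP (MvPolynomial.mem_support_iff.1 hs)
    have hjn : weight (t j) ≤ n := hsn ▸ Finsupp.le_weight_of_ne_zero' (fun i => weight (t i)) hsj'
    have hj0 := weight_pos (ht j)
    have h1 := deconc_mem_weightLE hφ hmem
    have h2 : deconc φ (evalWords t P) - evalWords t (MvPolynomial.pderiv j P) ∈
        weightLE K H (n - weight (t j) - 1) := by
      conv in (evalWords t P) => rw [P.as_sum]
      conv in (MvPolynomial.pderiv j P) => rw [P.as_sum]
      rw [map_sum, map_sum, map_sum, map_sum, ← Finset.sum_sub_distrib]
      refine sum_mem fun s hs => ?_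
      have := deconc_evalWords_monomial ht hφ hmul hφj hdual s
        (fun i hi => hmax i ((MvPolynomial.mem_vars_iff_mem_support i).2 ⟨s, hs, hi⟩)) (P.coeff s)
      rwa [hP (MvPolynomial.mem_support_iff.1 hs)] at this
    have h3 := sub_mem (weightLE_mono (by omega) h1) h2
    rw [sub_sub_cancel] at h3
    have h4 := ih (n - weight (t j)) (by omega) (MvPolynomial.pderiv j P)
      (hP.pderiv (by omega)) (weightLE_mono (by omega) h3)
    have h5 := MvPolynomial.coeff_pderiv (i := j) P (s - Finsupp.single j 1)
    rw [h4, MvPolynomial.coeff_zero, tsub_add_cancel_of_le (by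
      rw [Finsupp.single_le_iff]; omega)] at h5
    rcases mul_eq_zero.1 h5.symm with h6 | h6
    · exact absurd h6 (MvPolynomial.mem_support_iff.1 hs)
    · exact absurd h6 (Nat.cast_add_one_ne_zero _)

/-- Separated families of nonempty words are algebraically independent. -/
theorem algebraicIndependent_word (ht : ∀ i, t i ≠ []) (hsep : IsSeparated t) :
    AlgebraicIndependent K fun i => QSh.word (t i) := by
  classical
  rw [algebraicIndependent_iff]
  intro P hP
  by_contra h0
  obtain ⟨s, hs, hmax⟩ := Finset.exists_max_image P.support
    (Finsupp.weight fun i => weight (t i)) (MvPolynomial.support_nonempty.2 h0)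
  set n := Finsupp.weight (fun i => weight (t i)) s with hn
  -- Q is the part of P of highest weight. All other monomials are lighter, so a relation P puts the
  -- value of Q into level n - 1.
  set Q := MvPolynomial.weightedHomogeneousComponent (fun i => weight (t i)) n P with hQ
  have hco : ∀ m, Q.coeff m = if Finsupp.weight (fun i => weight (t i)) m = n then P.coeff m else 0 :=
    fun m => MvPolynomial.coeff_weightedHomogeneousComponent _ _ _
  have hlow : evalWords t (P - Q) ∈ weightLE K H (n - 1) := by
    refine evalWords_mem_weightLE fun m hm => ?_
    rw [MvPolynomial.mem_support_iff, MvPolynomial.coeff_sub, hco] at hm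
    have hmP : m ∈ P.support := by
      rw [MvPolynomial.mem_support_iff]
      intro h
      rw [h] at hm
      simp at hm
    have h1 := hmax m hmP
    have h2 : Finsupp.weight (fun i => weight (t i)) m ≠ n := fun h => by
      rw [if_pos h, sub_self] at hm
      exact hm rfl
    have h3 := lt_of_le_of_ne h1 h2
    omega
  have hQ0 : Q = 0 := by
    refine eq_zero_of_evalWords_mem_weightLE ht hsep n Q
      (MvPolynomial.weightedHomogeneousComponent_isWeightedHomogeneous _ _) ?_
    have : evalWords t P = 0 := hP
    rw [map_sub, this, zero_sub] at hlow
    simpa using neg_mem hlow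
  have := hco s
  rw [hQ0, if_pos rfl, MvPolynomial.coeff_zero] at this
  exact MvPolynomial.mem_support_iff.1 hs this.symm

end Independence

/-! ## Basis sums -/

section BasisWords

variable {K : Type*} [Field K] [CharZero K] {H : Alphabet}

theorem finite_letters_le (K : Type*) [Field K] (H : Alphabet) (n : ℕ) :
    {l : Ltr K H | l.1.c ≤ n}.Finite := by
  classical
  let M : Finset ℕ := match H with
    | .harmonic => {1}
    | .alternating => {1}
    | .cyclotomic M => M
  have hM : ∀ l : Ltr K H, l.1.a ∈ M := by
    rintro ⟨l, hl⟩
    cases H with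
    | harmonic => exact Finset.mem_singleton.2 hl.1
    | alternating => exact Finset.mem_singleton.2 hl.1
    | cyclotomic M => exact hl.1
  refine Set.Finite.of_finite_image (f := fun l : Ltr K H => (l.1.a, l.1.b, l.1.c, l.1.z)) ?_ ?_
  · refine (((M : Set ℕ).toFinite.prod ((Finset.range (M.sup id + 1) : Set ℕ).toFinite.prod
      ((Finset.range (n + 1) : Set ℕ).toFinite.prod ({1, -1} : Set K).toFinite)))).subset ?_
    rintro _ ⟨l, hl, rfl⟩
    refine ⟨hM l, ?_, ?_, ?_⟩
    · have h1 := l.1.b_lt_a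
      have h2 : l.1.a ≤ M.sup id := Finset.le_sup (f := id) (hM l)
      exact Finset.mem_coe.2 (Finset.mem_range.2 (show l.1.b < M.sup id + 1 by omega))
    · exact Finset.mem_coe.2 (Finset.mem_range.2 (Nat.lt_succ_of_le hl))
    · exact sign_of_mem l
  · intro l _ m _ h
    simp only [Prod.mk.injEq] at h
    exact Subtype.ext (Letter.ext h.1 h.2.1 h.2.2.1 h.2.2.2)

theorem finite_words_le (K : Type*) [Field K] [CharZero K] (H : Alphabet) (n : ℕ) :
    {w : Word K H | weight w ≤ n}.Finite := by
  induction n with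
  | zero =>
    refine (Set.finite_singleton []).subset fun w hw => ?_
    by_contra h
    have := weight_pos (w := w) h
    have : weight w ≤ 0 := hw
    omega
  | succ n ih =>
    refine ((Set.finite_singleton []).union
      ((finite_letters_le K H (n + 1)).image2 List.cons ih)).subset fun w hw => ?_
    have hw' : weight w ≤ n + 1 := hw
    obtain _ | ⟨l, w⟩ := w
    · exact Or.inl rfl
    · rw [weight_cons] at hw'
      have := l.1.c_pos
      exact Or.inr ⟨l, show l.1.c ≤ n + 1 by omega, w, show weight w ≤ n by omega, rfl⟩

theorem coeff_weightPart_of_eq {n : ℕ} (f : QSh K H) {w : Word K H} (h : weight w = n) :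
    (QSh.weightPart n f).coeff w = f.coeff w := by
  classical
  exact Finsupp.filter_apply_pos (fun w : Word K H => weight w = n) _ h

theorem coeff_weightPart_of_ne {n : ℕ} (f : QSh K H) {w : Word K H} (h : weight w ≠ n) :
    (QSh.weightPart n f).coeff w = 0 := by
  classical
  exact Finsupp.filter_apply_neg (fun w : Word K H => weight w = n) _ h

theorem QSh.coeff_add (f g : QSh K H) (w : Word K H) :
    (f + g).coeff w = f.coeff w + g.coeff w := Finsupp.add_apply _ _ _

theorem QSh.coeff_sub (f g : QSh K H) (w : Word K H) :
    (f - g).coeff w = f.coeff w - g.coeff w := Finsupp.sub_apply _ _ _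

theorem QSh.coeff_smul (c : K) (f : QSh K H) (w : Word K H) :
    (c • f).coeff w = c * f.coeff w := Finsupp.smul_apply _ _ _

theorem QSh.coeff_word_self (w : Word K H) : (QSh.word w : QSh K H).coeff w = 1 :=
  Finsupp.single_eq_same

theorem QSh.coeff_word_of_ne {v w : Word K H} (h : v ≠ w) : (QSh.word w : QSh K H).coeff v = 0 :=
  Finsupp.single_eq_of_ne h

theorem mem_span_word {S : Set (Word K H)} {f : QSh K H} :
    f ∈ Submodule.span K (QSh.word '' S) ↔ ∀ w, f.coeff w ≠ 0 → w ∈ S := by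
  have h := (wordBasis K H).mem_span_image (m := f) (s := S)
  rw [show (wordBasis K H : Word K H → QSh K H) = QSh.word from rfl] at h
  rw [h]
  exact ⟨fun h w hw => h (Finsupp.mem_support_iff.2 hw),
    fun h w hw => h w (Finsupp.mem_support_iff.1 hw)⟩

theorem weight_eq_of_mem_relSpace {n : ℕ} {f : QSh K H} (hf : f ∈ relSpace K H n) {w : Word K H}
    (hw : f.coeff w ≠ 0) : weight w = n := by
  have hle : relSpace K H n ≤ Submodule.span K (QSh.word '' {w | weight w = n}) := by
    refine Submodule.span_le.2 ?_
    rintro _ ⟨p, -, -, -, rfl⟩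
    refine mem_span_word.2 fun w hw => ?_
    by_contra h
    exact hw (coeff_weightPart_of_ne _ h)
  exact mem_span_word.1 (hle hf) w hw

/-- A nonempty finite set of words has a first word. -/
theorem exists_first_word (r : Word K H → Word K H → Prop) [IsStrictTotalOrder (Word K H) r]
    (s : Finset (Word K H)) (hs : s.Nonempty) : ∃ m ∈ s, ∀ v ∈ s, v = m ∨ r m v := by
  classical
  let _ := linearOrderOfSTO r
  obtain ⟨m, hm, h⟩ := Finset.exists_min_image s id hs
  exact ⟨m, hm, fun v hv => (h v hv).eq_or_lt.imp Eq.symm id⟩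

/-- A nonzero relation has a reducible first word. -/
theorem exists_isReducible (r : Word K H → Word K H → Prop) [IsStrictTotalOrder (Word K H) r]
    {n : ℕ} {f : QSh K H} (hf : f ∈ relSpace K H n) (h0 : ∃ w, f.coeff w ≠ 0) :
    ∃ w, f.coeff w ≠ 0 ∧ IsReducible r w := by
  obtain ⟨w, hw⟩ := h0
  obtain ⟨m, hm, h⟩ := exists_first_word r (Finsupp.support (show Word K H →₀ K from f))
    ⟨w, Finsupp.mem_support_iff.2 hw⟩
  have hm' : f.coeff m ≠ 0 := Finsupp.mem_support_iff.1 hm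
  refine ⟨m, hm', f, ?_, hm', fun v hv => h v (Finsupp.mem_support_iff.2 hv)⟩
  rwa [weight_eq_of_mem_relSpace hf hm']

theorem weightPart_mul_mem_relSpace {u v : Word K H} (hu : u ≠ []) (hv : v ≠ []) :
    QSh.weightPart (weight u + weight v) (QSh.word u * QSh.word v) ∈
      relSpace K H (weight u + weight v) :=
  Submodule.subset_span ⟨[u, v], by simp, by simp [hu, hv], by simp, by simp⟩

/-- The irreducible words form a separated family. -/
theorem isSeparated_irreducible (r : Word K H → Word K H → Prop)
    [IsStrictTotalOrder (Word K H) r] :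
    IsSeparated (fun w : {w : Word K H // w ≠ [] ∧ ¬ IsReducible r w} => w.1) := by
  rintro ⟨w, hw, hirr⟩
  set n := weight w with hn
  -- The functional is to vanish on relations and on S: the first alternative makes it homogeneous
  -- of weight n, the second makes it dual to w among the irreducible words.
  set S : Set (Word K H) := {v | weight v ≠ n ∨ (v ≠ w ∧ ¬ IsReducible r v)} with hS
  have hnot : QSh.word w ∉ relSpace K H n ⊔ Submodule.span K (QSh.word '' S) := by
    intro hmem
    obtain ⟨ρ, hρ, α, hα, e⟩ := Submodule.mem_sup.1 hmem
    have hco : ∀ v, ρ.coeff v + α.coeff v = (QSh.word w : QSh K H).coeff v := fun v => by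
      rw [← e, QSh.coeff_add]
    have hαw : α.coeff w = 0 := by
      by_contra h
      rcases mem_span_word.1 hα w h with h | h
      · exact h rfl
      · exact h.1 rfl
    -- In w = ρ + α the relation ρ has coefficient 1 at w. Its reducible first word m differs from w
    -- and would have to cancel against α, which contains no reducible word of weight n.
    obtain ⟨m, hm, hred⟩ := exists_isReducible r hρ ⟨w, by
      have := hco w
      rw [hαw, add_zero, QSh.coeff_word_self] at this
      rw [this]
      exact one_ne_zero⟩
    rcases eq_or_ne m w with rfl | hmw
    · exact hirr hred
    · have h1 := hco m
      rw [QSh.coeff_word_of_ne hmw] at h1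
      have h2 : α.coeff m ≠ 0 := fun h => hm (by rwa [h, add_zero] at h1)
      rcases mem_span_word.1 hα m h2 with h | h
      · exact h (weight_eq_of_mem_relSpace hρ hm)
      · exact h.2 hred
  obtain ⟨ψ, hψ, hψU⟩ := Submodule.exists_dual_map_eq_bot_of_notMem hnot inferInstance
  have hzero : ∀ f ∈ relSpace K H n ⊔ Submodule.span K (QSh.word '' S), ψ f = 0 := fun f hf => by
    have : ψ f ∈ (relSpace K H n ⊔ Submodule.span K (QSh.word '' S)).map ψ :=
      Submodule.mem_map_of_mem hf
    rw [hψU] at this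
    exact this
  have hzS : ∀ v ∈ S, ψ (QSh.word v) = 0 := fun v hv =>
    hzero _ (Submodule.mem_sup_right (Submodule.subset_span ⟨v, hv, rfl⟩))
  refine ⟨(ψ (QSh.word w))⁻¹ • ψ, fun v hv => ?_, fun u v hu hv huv => ?_, ?_, ?_⟩
  · rw [LinearMap.smul_apply, hzS v (Or.inl hv), smul_zero]
  · have h1 := weightPart_mul_mem_relSpace hu hv
    have huv' : weight u + weight v = n := huv
    rw [huv'] at h1
    -- Only the weight n part of the product is a relation; the rest is supported on other weights
    -- and thus lies in the span of S.
    have h2 : QSh.word u * QSh.word v - QSh.weightPart n (QSh.word u * QSh.word v) ∈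
        Submodule.span K (QSh.word '' S) := by
      refine mem_span_word.2 fun x hx => Or.inl fun hxn => hx ?_
      rw [QSh.coeff_sub, coeff_weightPart_of_eq _ hxn, sub_self]
    have h3 := hzero _ (add_mem (Submodule.mem_sup_left h1) (Submodule.mem_sup_right h2))
    rw [add_sub_cancel] at h3
    rw [LinearMap.smul_apply, h3, smul_zero]
  · rw [LinearMap.smul_apply, smul_eq_mul, inv_mul_cancel₀ hψ]
  · rintro ⟨v, hv, hvirr⟩ hne
    rw [LinearMap.smul_apply, hzS v (Or.inr ⟨fun h => hne (Subtype.ext h), hvirr⟩), smul_zero]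

/-- The subalgebra generated by the irreducible words of weight at most `n`. -/
def irreducibleAdjoin (r : Word K H → Word K H → Prop) (n : ℕ) : Subalgebra K (QSh K H) :=
  Algebra.adjoin K (QSh.word '' {w | (w ≠ [] ∧ ¬ IsReducible r w) ∧ weight w ≤ n})

theorem irreducibleAdjoin_mono (r : Word K H → Word K H → Prop) {m n : ℕ} (h : m ≤ n) :
    irreducibleAdjoin r m ≤ irreducibleAdjoin r n :=
  Algebra.adjoin_mono (Set.image_mono fun _ hw => ⟨hw.1, hw.2.trans h⟩)

/-- A further factor exists and has positive weight. This makes the induction on the weight apply to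
the factors of a relation. -/
theorem weight_lt_sum {p : List (Word K H)} (hp : 2 ≤ p.length) (hne : ∀ w ∈ p, w ≠ [])
    {w : Word K H} (hw : w ∈ p) : weight w < (p.map weight).sum := by
  classical
  have h1 := ((List.perm_cons_erase hw).map weight).sum_eq
  rw [h1, List.map_cons, List.sum_cons]
  rcases hq : p.erase w with _ | ⟨x, q⟩
  · have := List.length_erase_of_mem hw
    rw [hq, List.length_nil] at this
    omega
  · have hx : x ∈ p := List.mem_of_mem_erase (hq ▸ List.mem_cons_self : x ∈ p.erase w)
    have := weight_pos (hne x hx)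
    rw [List.map_cons, List.sum_cons]
    omega

theorem prod_word_mem_weightLE (p : List (Word K H)) :
    (p.map QSh.word).prod ∈ weightLE K H (p.map weight).sum := by
  induction p with
  | nil => exact one_mem_weightLE le_rfl
  | cons w p ih =>
    have := mul_mem_weightLE (word_mem_weightLE (K := K) (w := w) le_rfl) ih
    simpa using this

/-- The irreducible words of weight at most `n` generate all words of weight at most `n`. -/
theorem word_mem_irreducibleAdjoin (r : Word K H → Word K H → Prop)
    [IsStrictTotalOrder (Word K H) r] (n : ℕ) :
    ∀ w : Word K H, weight w ≤ n → QSh.word w ∈ irreducibleAdjoin r n := by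
  classical
  induction n using Nat.strong_induction_on with
  | _ n ih =>
    have hlt : ∀ w : Word K H, weight w < n → QSh.word w ∈ irreducibleAdjoin r n := fun w hw =>
      irreducibleAdjoin_mono r hw.le (ih _ hw w le_rfl)
    have hfil : ∀ f ∈ weightLE K H (n - 1), f ∈ irreducibleAdjoin r n := by
      intro f hf
      have hle : weightLE K H (n - 1) ≤ Subalgebra.toSubmodule (irreducibleAdjoin r n) := by
        refine Submodule.span_le.2 ?_
        rintro _ ⟨w, hw, rfl⟩
        have hw' : (weight w : ℤ) ≤ n - 1 := hw
        exact hlt w (by omega)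
      exact hle hf
    have hrel : ∀ f ∈ relSpace K H n, f ∈ irreducibleAdjoin r n := by
      intro f hf
      have hle : relSpace K H n ≤ Subalgebra.toSubmodule (irreducibleAdjoin r n) := by
        refine Submodule.span_le.2 ?_
        rintro _ ⟨p, hp, hne, hsum, rfl⟩
        have h1 : (p.map QSh.word).prod ∈ irreducibleAdjoin r n := by
          refine Subalgebra.list_prod_mem _ fun x hx => ?_
          obtain ⟨w, hw, rfl⟩ := List.mem_map.1 hx
          exact hlt w (hsum ▸ weight_lt_sum hp hne hw)
        -- A product of total weight n has no terms above weight n, so it differs from its weight n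
        -- part by lighter words only.
        have h2 : (p.map QSh.word).prod - QSh.weightPart n (p.map QSh.word).prod ∈
            irreducibleAdjoin r n := by
          refine hfil _ (mem_weightLE.2 fun w hw => ?_)
          rw [QSh.coeff_sub] at hw
          have hwn : weight w ≠ n := fun h => by
            rw [coeff_weightPart_of_eq _ h, sub_self] at hw
            exact hw rfl
          rw [coeff_weightPart_of_ne _ hwn, sub_zero] at hw
          have := mem_weightLE.1 (prod_word_mem_weightLE p) w hw
          rw [hsum] at this
          omega
        have h3 := sub_mem h1 h2
        rw [sub_sub_cancel] at h3
        exact h3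
      exact hle hf
    have hbad : {w : Word K H | weight w ≤ n ∧ QSh.word w ∉ irreducibleAdjoin r n} = ∅ := by
      by_contra hne
      have hfin : {w : Word K H | weight w ≤ n ∧ QSh.word w ∉ irreducibleAdjoin r n}.Finite :=
        (finite_words_le K H n).subset fun w hw => hw.1
      -- The reversed order selects the last word that is not generated. Finiteness of the set
      -- replaces well-foundedness of the order.
      obtain ⟨m, hm, hmax⟩ := exists_first_word (Function.swap r) hfin.toFinset
        (by rwa [Set.Finite.toFinset_nonempty, Set.nonempty_iff_ne_empty])
      have hm' := hfin.mem_toFinset.1 hm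
      refine hm'.2 ?_
      by_cases hmn : weight m < n
      · exact hlt m hmn
      have hmn' : weight m = n := le_antisymm hm'.1 (not_lt.1 hmn)
      by_cases hnil : m = []
      · rw [hnil, QSh.word_nil]; exact one_mem _
      by_cases hred : IsReducible r m
      swap
      · exact Algebra.subset_adjoin ⟨m, ⟨⟨hnil, hred⟩, hm'.1⟩, rfl⟩
      obtain ⟨f, hf, hfm, hfirst⟩ := hred
      rw [hmn'] at hf
      -- All other words of a relation with pivot m come after m and are therefore generated, so the
      -- relation can be solved for m.
      have hrest : f - f.coeff m • QSh.word m ∈ irreducibleAdjoin r n := by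
        have hspan : f - f.coeff m • QSh.word m ∈ Submodule.span K
            (QSh.word '' {v | weight v = n ∧ r m v}) := by
          refine mem_span_word.2 fun v hv => ?_
          rw [QSh.coeff_sub, QSh.coeff_smul] at hv
          have hvm : v ≠ m := by
            rintro rfl
            rw [QSh.coeff_word_self, mul_one, sub_self] at hv
            exact hv rfl
          rw [QSh.coeff_word_of_ne hvm, mul_zero, sub_zero] at hv
          exact ⟨weight_eq_of_mem_relSpace hf hv, (hfirst v hv).resolve_left hvm⟩
        have hle : Submodule.span K (QSh.word '' {v | weight v = n ∧ r m v}) ≤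
            Subalgebra.toSubmodule (irreducibleAdjoin r n) := by
          refine Submodule.span_le.2 ?_
          rintro _ ⟨v, ⟨hvn, hmv⟩, rfl⟩
          by_contra hv
          rcases hmax v (hfin.mem_toFinset.2 ⟨hvn.le, hv⟩) with h | h
          · rw [h] at hmv; exact irrefl_of r m hmv
          · exact irrefl_of r m (trans_of r hmv h)
        exact hle hspan
      have h1 := sub_mem (hrel f hf) hrest
      rw [sub_sub_cancel] at h1
      have h2 := Subalgebra.smul_mem _ h1 (f.coeff m)⁻¹
      rwa [smul_smul, inv_mul_cancel₀ hfm, one_smul] at h2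
    intro w hw
    by_contra h
    have : w ∈ {w : Word K H | weight w ≤ n ∧ QSh.word w ∉ irreducibleAdjoin r n} := ⟨hw, h⟩
    rw [hbad] at this
    exact this

end BasisWords

/-! ## The reduced ring as a `Σ*`-extension -/

section Reduced

/-- Evaluation over A is the base change of evaluation over K, and tensoring over a field preserves
injectivity. -/
theorem algebraicIndependent_one_tmul {K A B ι : Type*} [Field K] [CommRing A] [CommRing B]
    [Algebra K A] [Algebra K B] {x : ι → B} (hx : AlgebraicIndependent K x) :
    AlgebraicIndependent A fun i => (1 : A) ⊗ₜ[K] x i := by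
  have e : (MvPolynomial.aeval fun i => (1 : A) ⊗ₜ[K] x i) =
      (Algebra.TensorProduct.map (AlgHom.id A A) (MvPolynomial.aeval x : MvPolynomial ι K →ₐ[K] B)).comp
        ((MvPolynomial.algebraTensorAlgEquiv (σ := ι) K A).symm : _ →ₐ[A] _) := by
    refine MvPolynomial.algHom_ext fun i => ?_
    simp
  rw [AlgebraicIndependent, e, AlgHom.coe_comp]
  refine Function.Injective.comp (g := Algebra.TensorProduct.map (AlgHom.id A A)
    (MvPolynomial.aeval x : MvPolynomial ι K →ₐ[K] B)) ?_
    (MvPolynomial.algebraTensorAlgEquiv (σ := ι) K A).symm.injective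
  exact Module.Flat.lTensor_preserves_injective_linearMap (M := A)
    (MvPolynomial.aeval x : MvPolynomial ι K →ₐ[K] B).toLinearMap hx

variable {K : Type*} [Field K] [CharZero K] {H : Alphabet} {d : ℕ}

/-- The embedding of the reduced ring into the quasi-shuffle algebra over `K(n)[x]`. -/
def reducedEmbedding (K : Type*) [Field K] [CharZero K] (H : Alphabet) (d : ℕ) :
    ReducedRing K H d →ₐ[RatAlt K] RatAlt K ⊗[K] QSh K H :=
  Ideal.Quotient.liftₐ (relIdeal K H d) (linearize K H d) fun _ hf => hf

theorem reducedEmbedding_mk (f : NaiveRing K H d) :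
    reducedEmbedding K H d (Ideal.Quotient.mk _ f) = linearize K H d f := rfl

theorem reducedEmbedding_injective : Function.Injective (reducedEmbedding K H d) := by
  rw [injective_iff_map_eq_zero]
  intro f hf
  obtain ⟨f, rfl⟩ := Ideal.Quotient.mk_surjective f
  exact Ideal.Quotient.eq_zero_iff_mem.2 hf

theorem reducedEmbedding_reducedSum (v : SumVar K H d) :
    reducedEmbedding K H d (reducedSum K H d v) = 1 ⊗ₜ QSh.word v.1 := by
  rw [reducedSum, reducedEmbedding_mk]
  simp [linearize]

theorem reducedEmbedding_shiftReduced (f : ReducedRing K H d) :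
    reducedEmbedding K H d (shiftReduced K H d f) = shiftTensor (reducedEmbedding K H d f) := by
  obtain ⟨f, rfl⟩ := Ideal.Quotient.mk_surjective f
  rw [shiftReduced_mk, reducedEmbedding_mk, reducedEmbedding_mk, linearize_shiftNaive]

/-- The constants of the reduced ring lie in `K`. -/
theorem eq_algebraMap_of_shiftReduced_eq {f : ReducedRing K H d} (h : shiftReduced K H d f = f) :
    ∃ c : K, f = algebraMap (RatAlt K) (ReducedRing K H d) (algebraMap K (RatAlt K) c) := by
  obtain ⟨c, hc⟩ := eq_smul_one_of_shiftTensor_eq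
    ((reducedEmbedding_shiftReduced f).symm.trans (by rw [h]))
  refine ⟨c, reducedEmbedding_injective ?_⟩
  rw [hc, AlgHom.commutes, smul_eq_tmul_one_mul, mul_one]
  rfl

theorem algebraMap_reducedRing_injective :
    Function.Injective (algebraMap (RatAlt K) (ReducedRing K H d)) := by
  intro a b h
  have h1 := congrArg (reducedEmbedding K H d) h
  rw [AlgHom.commutes, AlgHom.commutes] at h1
  have h2 : a • wordBasisRat K H [] = b • wordBasisRat K H [] := by
    rw [wordBasisRat_nil, smul_eq_tmul_one_mul, smul_eq_tmul_one_mul, mul_one, mul_one]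
    exact h1
  have h3 := congrArg (fun f => (wordBasisRat K H).repr f []) h2
  simpa using h3

theorem shiftReduced_algebraMap (a : RatAlt K) :
    shiftReduced K H d (algebraMap (RatAlt K) (ReducedRing K H d) a) =
      algebraMap (RatAlt K) (ReducedRing K H d) (shiftRatAlt K a) := by
  have e : ∀ a, algebraMap (RatAlt K) (ReducedRing K H d) a =
    Ideal.Quotient.mk _ (MvPolynomial.C a) := fun _ => rfl
  rw [e, e, shiftReduced_mk]
  congr 1
  change shiftNaiveHom K H d (MvPolynomial.C a) = _
  simp [shiftNaiveHom]

variable (r : Word K H → Word K H → Prop)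

theorem algebraicIndependent_basisSums [IsStrictTotalOrder (Word K H) r] :
    AlgebraicIndependent (RatAlt K) fun v : basisSums r d => reducedSum K H d v.1 := by
  have h1 := algebraicIndependent_one_tmul (A := RatAlt K)
    (algebraicIndependent_word (fun w => w.2.1) (isSeparated_irreducible r))
  have h2 := h1.comp (fun v : basisSums r d =>
    (⟨v.1.1, v.1.2.1, v.2⟩ : {w : Word K H // w ≠ [] ∧ ¬ IsReducible r w}))
    (fun v w h => Subtype.ext (Subtype.ext (congrArg (fun x => x.1) h)))
  refine AlgebraicIndependent.of_comp (reducedEmbedding K H d) ?_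
  convert h2 using 1
  funext v
  exact reducedEmbedding_reducedSum v.1

/-- Every sum of weight at most `n` is a polynomial in the basis sums of weight at most `n`. -/
theorem reducedSum_mem_adjoin [IsStrictTotalOrder (Word K H) r] (v : SumVar K H d) :
    reducedSum K H d v ∈ Algebra.adjoin (RatAlt K)
      (reducedSum K H d '' {u | u ∈ basisSums r d ∧ weight u.1 ≤ weight v.1}) := by
  set S := {u : SumVar K H d | u ∈ basisSums r d ∧ weight u.1 ≤ weight v.1} with hS
  have h1 : (1 : RatAlt K) ⊗ₜ[K] QSh.word v.1 ∈ Algebra.adjoin (RatAlt K)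
      (reducedEmbedding K H d '' (reducedSum K H d '' S)) := by
    have h2 := word_mem_irreducibleAdjoin r (weight v.1) v.1 le_rfl
    have h3 : irreducibleAdjoin r (weight v.1) ≤
        ((Algebra.adjoin (RatAlt K) (reducedEmbedding K H d '' (reducedSum K H d '' S))).restrictScalars
          K).comap (Algebra.TensorProduct.includeRight : QSh K H →ₐ[K] RatAlt K ⊗[K] QSh K H) := by
      refine Algebra.adjoin_le ?_
      rintro _ ⟨w, ⟨⟨hw, hirr⟩, hle⟩, rfl⟩
      exact Algebra.subset_adjoin ⟨_, ⟨⟨w, hw, hle.trans v.2.2⟩, ⟨hirr, hle⟩, rfl⟩,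
        reducedEmbedding_reducedSum _⟩
    exact h3 h2
  -- The generated subalgebra is the image of one in the reduced ring, and injectivity of the
  -- embedding brings membership back.
  rw [← AlgHom.map_adjoin, ← reducedEmbedding_reducedSum] at h1
  obtain ⟨y, hy, e⟩ := h1
  rwa [← reducedEmbedding_injective e]

theorem mk_shiftSum_mem {R : Subalgebra (RatAlt K) (ReducedRing K H d)} {n : ℕ}
    (hR : ∀ v : SumVar K H d, weight v.1 ≤ n → reducedSum K H d v ∈ R) (w : Word K H)
    (h : weight w ≤ d) (hn : weight w ≤ n) :
    Ideal.Quotient.mk (relIdeal K H d) (shiftSum w h) ∈ R := by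
  induction w with
  | nil => rw [shiftSum, map_one]; exact one_mem _
  | cons l w ih =>
    rw [shiftSum, map_add, map_mul]
    exact add_mem (hR _ hn) (mul_mem (R.algebraMap_mem (shiftRatAlt K (letterBar l.1)))
      (ih _ (weight_tail_le hn)))

/-- For the word l w the difference is σ(λ(l)) σ(S_w), and σ(S_w) involves only suffixes of w, which
are strictly lighter than l w. -/
theorem shiftReduced_sub_mem {R : Subalgebra (RatAlt K) (ReducedRing K H d)} (v : SumVar K H d)
    (hR : ∀ u : SumVar K H d, weight u.1 < weight v.1 → reducedSum K H d u ∈ R) :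
    shiftReduced K H d (reducedSum K H d v) - reducedSum K H d v ∈ R := by
  obtain ⟨w, hw, hd⟩ := v
  obtain _ | ⟨l, w⟩ := w
  · exact absurd rfl hw
  have e : shiftReduced K H d (reducedSum K H d ⟨l :: w, hw, hd⟩) =
      Ideal.Quotient.mk (relIdeal K H d) (shiftSum (l :: w) hd) := by
    rw [reducedSum, shiftReduced_mk]
    congr 1
    change shiftNaiveHom K H d (MvPolynomial.X _) = _
    simp [shiftNaiveHom]
  have hc := l.1.c_pos
  rw [e, shiftSum, map_add, map_mul, reducedSum, add_sub_cancel_left]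
  refine mul_mem (R.algebraMap_mem (shiftRatAlt K (letterBar l.1)))
    (mk_shiftSum_mem (n := weight w) (fun u hu => hR u ?_) w _ le_rfl)
  change weight u.1 < weight (l :: w)
  rw [weight_cons]
  omega

theorem adjoin_reducedSum_eq_top : Algebra.adjoin (RatAlt K) (Set.range (reducedSum K H d)) = ⊤ := by
  have h := congrArg (Subalgebra.map (Ideal.Quotient.mkₐ (RatAlt K) (relIdeal K H d)))
    (MvPolynomial.adjoin_range_X (R := RatAlt K) (σ := SumVar K H d))
  rw [AlgHom.map_adjoin, ← Set.range_comp, Algebra.map_top,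
    (AlgHom.range_eq_top _).2 (Ideal.Quotient.mkₐ_surjective _ _)] at h
  exact h

/-- Transcendence is algebraic independence read one generator at a time. The condition on constants
is immediate, since every constant of the whole ring lies in K. -/
theorem isSigmaStarExtension [IsStrictTotalOrder (Word K H) r] {m : ℕ} (e : Fin m ≃ basisSums r d)
    (hmono : Monotone fun i => weight (e i).1.1) :
    IsSigmaStarExtension (shiftRatAlt K) (shiftReduced K H d)
      (algebraMap (RatAlt K) (ReducedRing K H d)) (fun i => reducedSum K H d (e i).1) := by
  have hcl : ∀ s : Set (ReducedRing K H d), Subring.closure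
      (Set.range (algebraMap (RatAlt K) (ReducedRing K H d)) ∪ s) =
      (Algebra.adjoin (RatAlt K) s).toSubring := fun s => (Algebra.adjoin_eq_ring_closure s).symm
  have hall : ∀ v : SumVar K H d, reducedSum K H d v ∈ Algebra.adjoin (RatAlt K)
      (Set.range fun i => reducedSum K H d (e i).1) := by
    intro v
    refine Algebra.adjoin_mono ?_ (reducedSum_mem_adjoin r v)
    rintro _ ⟨u, ⟨hu, -⟩, rfl⟩
    exact ⟨e.symm ⟨u, hu⟩, by simp⟩
  refine ⟨algebraMap_reducedRing_injective, shiftReduced_algebraMap, ?_, fun i => ?_, fun i => ?_,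
    fun i => ?_⟩
  · rw [hcl, ← Algebra.top_toSubring (R := RatAlt K)]
    congr 1
    rw [eq_top_iff, ← adjoin_reducedSum_eq_top]
    refine Algebra.adjoin_le ?_
    rintro _ ⟨v, rfl⟩
    exact hall v
  · rw [hcl]
    have h := ((algebraicIndependent_basisSums (d := d) r).comp e e.injective).transcendental_adjoin
      (s := Set.Iio i) (i := i) (by simp)
    exact h
  · rw [hcl]
    refine shiftReduced_sub_mem (e i).1 fun v hv => ?_
    refine Algebra.adjoin_mono ?_ (reducedSum_mem_adjoin r v)
    rintro _ ⟨u, ⟨hu, hle⟩, rfl⟩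
    refine ⟨e.symm ⟨u, hu⟩, ?_, by simp⟩
    -- At position i or later, u would weigh at least as much as `e i` by monotonicity; but u is no
    -- heavier than v, which is strictly lighter.
    by_contra h
    have := hmono (not_lt.1 h)
    simp only [Equiv.apply_symm_apply] at this
    omega
  · ext c
    refine and_congr_left fun hc => ⟨fun _ => ?_, fun h => ?_⟩
    · obtain ⟨k, rfl⟩ := eq_algebraMap_of_shiftReduced_eq hc
      exact Subring.subset_closure (Or.inl ⟨_, rfl⟩)
    · exact Subring.closure_mono (Set.union_subset_union_right _
        (Set.image_mono (Set.Iio_subset_Iic_self))) h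

theorem finite_basisSums : (basisSums (d := d) r).Finite :=
  Set.Finite.of_finite_image ((finite_words_le K H d).subset (by
    rintro _ ⟨v, -, rfl⟩
    exact v.2.2)) (Subtype.val_injective.injOn)

end Reduced

end HarmonicSums

end

theorem mainTheorem1 {K : Type*} [Field K] [CharZero K] (H : Alphabet) (d : ℕ)
    (r : Word K H → Word K H → Prop) [IsStrictTotalOrder (Word K H) r] :
    (basisSums (d := d) r).Finite ∧
    (∀ (m : ℕ) (e : Fin m ≃ basisSums r d), (Monotone fun i => weight (e i).1.1) →
      IsSigmaStarExtension (shiftRatAlt K) (shiftReduced K H d)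
        (algebraMap (RatAlt K) (ReducedRing K H d)) (fun i => reducedSum K H d (e i).1)) ∧
    (∀ f, tau K H d (shiftReduced K H d f) = shiftSeq K (tau K H d f)) ∧
    Function.Injective (tau K H d) :=
  ⟨finite_basisSums r, fun _ e he => isSigmaStarExtension r e he, tau_shiftReduced, tau_injective⟩
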